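/- Let $\alpha>0$, $\beta\in(0,1)$ and $\mathbb R_+=[0,\infty)$. Let $\mathcal F(\mathbb R_+)$ be the space of closed subsets of $\mathbb R_+$ with the Borel $\sigma$-algebra of the Fell topology, and let $P_\beta$ be the law on $\mathcal F(\mathbb R_+)$ of a $\beta$-stable regenerative set, that is, of the closure of the range of a strictly $\beta$-stable subordinator. Let $(U_j,V_j,R_j)_{j\in\mathbb N}$ be a measurable enumeration of the points of a Poisson point process on $\mathbb R_+\times\mathbb R_+\times\mathcal F(\mathbb R_+)$ with mean measure $$\alpha u^{-(1+\alpha)}\,du\;(1-\beta)v^{-\beta}\,dv\;dP_\beta .$$ A sup-measure on $\mathbb R_+$ is a map $m$ from the open subsets of $\mathbb R_+$ to $[0,\infty]$ with $m(\bigcup_i G_i)=\sup_i m(G_i)$ for all families of open sets; it is extended to all $B\subset\mathbb R_+$ by $m(B)=\sup_{t\in B}\inf\{m(G): G\ni t\text{ open}\}$. The space of sup-measures carries the sup-vague topology, which has as a subbase the sets $\{m: m(K)<x\}$, $K$ compact, and $\{m: m(G)>x\}$, $G$ open, $x\in\mathbb R_+$, and the corresponding Borel $\sigma$-algebra. Put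 $$\eta^{\alpha,\beta}(G)=\sup_{t\in G}\ \sum_{j} U_j\,\mathbf 1\{t\in V_j+R_j\},\qquad G\subset\mathbb R_+\ \text{open}.$$ Then $\eta^{\alpha,\beta}$ is a random sup-measure (a random element of the space of sup-measures), and, as random sup-measures, 1. (stationarity) $\eta^{\alpha,\beta}(\cdot+b)\overset{d}{=}\eta^{\alpha,\beta}(\cdot)$ for every $b\ge 0$; 2. ($H$-self-similarity) $\eta^{\alpha,\beta}(a\,\cdot)\overset{d}{=}a^{H}\,\eta^{\alpha,\beta}(\cdot)$ for every $a>0$, where $H=(1-\beta)/\alpha$. -/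

import Mathlib

open MeasureTheory ProbabilityTheory
open scoped NNReal ENNReal

noncomputable section

/-! ### The space of closed subsets of `[0, ∞)` with the Fell topology -/

/-- The space `F(ℝ₊)` of closed subsets of `ℝ₊ = [0, ∞)`. This is a type synonym of Mathlib's
`Closeds ℝ≥0`, so that it carries the Fell topology and not the Hausdorff one. -/
def ClosedSets : Type := TopologicalSpace.Closeds ℝ≥0

namespace ClosedSets

/-- The underlying set. -/
def carrier (F : ClosedSets) : Set ℝ≥0 := TopologicalSpace.Closeds.carrier F

/-- The closure of a set, as a point of `F(ℝ₊)`. -/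
def ofClosure (A : Set ℝ≥0) : ClosedSets := TopologicalSpace.Closeds.closure A

/-- The Fell topology. -/
instance : TopologicalSpace ClosedSets :=
  TopologicalSpace.generateFrom
    ({s | ∃ G : Set ℝ≥0, IsOpen G ∧ s = {F : ClosedSets | (F.carrier ∩ G).Nonempty}} ∪
     {s | ∃ K : Set ℝ≥0, IsCompact K ∧ s = {F : ClosedSets | F.carrier ∩ K = ∅}})

/-- The Borel `σ`-algebra of the Fell topology. -/
instance : MeasurableSpace ClosedSets := borel ClosedSets

/-- The shifted set `v + F`. -/
def shift (v : ℝ≥0) (F : ClosedSets) : Set ℝ≥0 := (fun r => v + r) '' F.carrier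

end ClosedSets

/-! ### Sup-measures on `[0, ∞)` -/

/-- A sup-measure on `ℝ₊`: a map `m` from the (relatively) open subsets of `ℝ₊` to `[0, ∞]` which
turns arbitrary unions into suprema (in particular `m ∅ = 0`). -/
structure SupMeasure where
  /-- The value of the sup-measure on open sets. -/
  onOpen : TopologicalSpace.Opens ℝ≥0 → ℝ≥0∞
  map_sSup : ∀ 𝒢 : Set (TopologicalSpace.Opens ℝ≥0), onOpen (sSup 𝒢) = ⨆ G ∈ 𝒢, onOpen G

namespace SupMeasure

/-- The sup-derivative `d^∨ m (t) = inf {m(G) : G open, t ∈ G}`. -/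
def supDeriv (m : SupMeasure) (t : ℝ≥0) : ℝ≥0∞ :=
  ⨅ (G : TopologicalSpace.Opens ℝ≥0) (_ : t ∈ G), m.onOpen G

/-- The canonical extension of a sup-measure to all subsets of `ℝ₊`. -/
def ext (m : SupMeasure) (B : Set ℝ≥0) : ℝ≥0∞ := ⨆ t ∈ B, m.supDeriv t

/-- The sup-integral `G ↦ sup_{t ∈ G} f t`. -/
def supIntegral (f : ℝ≥0 → ℝ≥0∞) : SupMeasure where
  onOpen G := ⨆ t ∈ G, f t
  map_sSup 𝒢 := by
    apply le_antisymm
    · refine iSup₂_le fun t ht => ?_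
      obtain ⟨G, hG, htG⟩ := TopologicalSpace.Opens.mem_sSup.1 ht
      exact le_iSup₂_of_le G hG (le_iSup₂_of_le t htG le_rfl)
    · refine iSup₂_le fun G hG => iSup₂_le fun t ht => ?_
      exact le_iSup₂_of_le t (TopologicalSpace.Opens.mem_sSup.2 ⟨G, hG, ht⟩) le_rfl

/-- The sup-vague topology: the sets `{m : m(K) < x}`, `K` compact, and `{m : m(G) > x}`, `G` open,
form a subbase. -/
instance : TopologicalSpace SupMeasure :=
  TopologicalSpace.generateFrom
    ({s | ∃ (K : Set ℝ≥0) (x : ℝ≥0), IsCompact K ∧ s = {m : SupMeasure | m.ext K < x}} ∪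
     {s | ∃ (G : TopologicalSpace.Opens ℝ≥0) (x : ℝ≥0), s = {m : SupMeasure | x < m.onOpen G}})

/-- The Borel `σ`-algebra of the sup-vague topology. -/
instance : MeasurableSpace SupMeasure := borel SupMeasure

/-- The shifted sup-measure `G ↦ m(G + b)`. If `0 ∈ G` and `b > 0`, then `G + b` is not open, and
`m(G + b)` is the value of the canonical extension. -/
def shift (b : ℝ≥0) (m : SupMeasure) : SupMeasure where
  onOpen G := m.ext ((fun t => t + b) '' (G : Set ℝ≥0))
  map_sSup 𝒢 := by
    simp only [ext, iSup_image]
    exact (supIntegral fun t => m.supDeriv (t + b)).map_sSup 𝒢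

/-- The rescaled sup-measure `G ↦ m(a G)`. -/
def dilate (a : ℝ≥0) (m : SupMeasure) : SupMeasure where
  onOpen G := m.ext ((fun t => a * t) '' (G : Set ℝ≥0))
  map_sSup 𝒢 := by
    simp only [ext, iSup_image]
    exact (supIntegral fun t => m.supDeriv (a * t)).map_sSup 𝒢

/-- The multiple `G ↦ c · m(G)`. -/
def scale (c : ℝ≥0) (m : SupMeasure) : SupMeasure where
  onOpen G := c * m.onOpen G
  map_sSup 𝒢 := by
    simp only [m.map_sSup, ENNReal.mul_iSup]

end SupMeasure

/-- A random sup-measure: a random element of the space of sup-measures with its Borel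
`σ`-algebra. -/
def IsRandomSupMeasure {Ω : Type*} [MeasurableSpace Ω] (η : Ω → SupMeasure) : Prop :=
  Measurable η

/-- Stationarity: `η(· + b)` has the same law as `η`, for all shifts `b ≥ 0`. -/
def IsStationarySupMeasure {Ω : Type*} [MeasurableSpace Ω] (η : Ω → SupMeasure)
    (P : Measure Ω) : Prop :=
  ∀ b : ℝ≥0, IdentDistrib (fun ω => (η ω).shift b) η P P

/-- `H`-self-similarity: `η(a ·)` has the same law as `a ^ H η(·)`, for all `a > 0`. -/
def IsSelfSimilarSupMeasure {Ω : Type*} [MeasurableSpace Ω] (H : ℝ) (η : Ω → SupMeasure)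
    (P : Measure Ω) : Prop :=
  ∀ a : ℝ≥0, 0 < a →
    IdentDistrib (fun ω => (η ω).dilate a) (fun ω => (η ω).scale (a ^ H)) P P

/-! ### Stable subordinators and stable regenerative sets -/

/-- A (strictly) `β`-stable subordinator: a process with values in `[0, ∞)`, started at `0`, with
independent and stationary increments, almost surely nondecreasing right-continuous paths, and
Laplace transform `E exp (-θ S_t) = exp (-c t θ ^ β)` for some constant `c > 0`. (The truncated
subtraction of `ℝ≥0` in the increments is harmless, as the paths are almost surely monotone.) -/
structure IsStableSubordinator {Ω : Type*} [MeasurableSpace Ω] (β : ℝ) (S : ℝ≥0 → Ω → ℝ≥0)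
    (P : Measure Ω) : Prop where
  measurable : ∀ t, Measurable (S t)
  zero : ∀ᵐ ω ∂P, S 0 ω = 0
  indep : HasIndepIncrements S P
  stationary : ∀ s t : ℝ≥0, IdentDistrib (fun ω => S (s + t) ω - S s ω) (S t) P P
  path : ∀ᵐ ω ∂P, Monotone (fun t => S t ω) ∧
    ∀ t, ContinuousWithinAt (fun s => S s ω) (Set.Ici t) t
  laplace : ∃ c : ℝ, 0 < c ∧ ∀ t θ : ℝ≥0,
    ∫ ω, Real.exp (-((θ : ℝ) * (S t ω : ℝ))) ∂P = Real.exp (-(c * (t : ℝ) * (θ : ℝ) ^ β))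

/-- The closure of the range of a process, as a random closed set. For a `β`-stable subordinator
this is the `β`-stable regenerative set. -/
def closedRange {Ω : Type*} (S : ℝ≥0 → Ω → ℝ≥0) (ω : Ω) : ClosedSets :=
  ClosedSets.ofClosure (Set.range fun t => S t ω)

/-! ### The Poisson point process and the random sup-measure -/

/-- The number of indices `j` such that `X j ω` lies in `A`. -/
def pointCount {Ω E : Type*} (X : ℕ → Ω → E) (A : Set E) (ω : Ω) : ℕ∞ :=
  Set.encard {j : ℕ | X j ω ∈ A}

/-- `X 0, X 1, …` is a measurable enumeration of the points of a Poisson point process with mean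
measure `ν`: the number of points in a measurable set of finite `ν`-measure has the Poisson
distribution with mean `ν A`, and the numbers of points in disjoint measurable sets are
independent. -/
structure IsPoissonEnumeration {Ω E : Type*} [MeasurableSpace Ω] [MeasurableSpace E]
    (X : ℕ → Ω → E) (ν : Measure E) (P : Measure Ω) : Prop where
  measurable : ∀ j, Measurable (X j)
  law : ∀ A : Set E, MeasurableSet A → ν A ≠ ∞ →
    P.map (pointCount X A) = (poissonMeasure (ν A).toNNReal).map (fun n : ℕ => (n : ℕ∞))
  indep : ∀ (n : ℕ) (A : Fin n → Set E), (∀ i, MeasurableSet (A i)) →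
    (∀ i j, i ≠ j → Disjoint (A i) (A j)) → iIndepFun (fun i => pointCount X (A i)) P

/-- Lebesgue measure on `ℝ₊ = [0, ∞)`. -/
def lebesgueNNReal : Measure ℝ≥0 := ((volume : Measure ℝ).restrict (Set.Ici 0)).map Real.toNNReal

/-- The measure `α u ^ (-(1 + α)) du ⊗ (1 - β) v ^ (-β) dv ⊗ Q` on `ℝ₊ × ℝ₊ × F(ℝ₊)`. -/
def meanMeasure (α β : ℝ) (Q : Measure ClosedSets) : Measure (ℝ≥0 × ℝ≥0 × ClosedSets) :=
  (lebesgueNNReal.withDensity fun u => ENNReal.ofReal (α * (u : ℝ) ^ (-(1 + α)))).prod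
    ((lebesgueNNReal.withDensity fun v =>
      ENNReal.ofReal ((1 - β) * (v : ℝ) ^ (-β))).prod Q)

/-- The random function `η(t) = ∑_j U_j 1{t ∈ V_j + R_j}`. -/
def etaFun {Ω : Type*} (U V : ℕ → Ω → ℝ≥0) (R : ℕ → Ω → ClosedSets) (ω : Ω) (t : ℝ≥0) : ℝ≥0∞ :=
  ∑' j, ((R j ω).shift (V j ω)).indicator (fun _ => (U j ω : ℝ≥0∞)) t

/-- The random sup-measure `η(G) = sup_{t ∈ G} ∑_j U_j 1{t ∈ V_j + R_j}`. -/
def eta {Ω : Type*} (U V : ℕ → Ω → ℝ≥0) (R : ℕ → Ω → ClosedSets) (ω : Ω) : SupMeasure :=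
  SupMeasure.supIntegral (etaFun U V R ω)

end

/-!
Pass from the points `(U, V, R)` to the weighted closed sets `(U, V + R)`: these form a Poisson
process with mean measure `α u ^ (-(1 + α)) du ⊗ μ`, where `μ` is the law of `v + R` under
`(1 - β) v ^ (-β) dv ⊗ P_β`, and the random sup-measure is a functional of them.

The measure `μ` is invariant under `F ↦ (F - b) ∩ ℝ₊`. By the strong Markov property at the passage
over `b`, this map sends `v + R` to an overshoot plus an independent copy of `R`, and the overshoot
again has density `(1 - β) v ^ (-β)`: this is seen from Laplace transforms, because the potential
measure of the delayed subordinator is a multiple of Lebesgue measure. Stability shows that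
contracting the sets by `a` multiplies `μ` by `a ^ (1 - β)`, which is also the effect on the mean
measure of multiplying the weights by `a ^ ((1 - β) / α)`.

The law of the sup-measure depends only on the mean measure, because its values on open sets are
suprema of functionals of the finitely many sets of weight at least `δ` which hit a given compact
set. It remains to see that the shift by `b` loses nothing on the open sets containing `0`, that is,
that the sup-derivative at `b` vanishes almost surely. The `μ`-measure of the sets hitting an
interval of length `ε` is at most `ε ^ (1 - β)`, so no point lies in `k` of the sets once
`k (1 - β) > 1`, and only small weights occur near `b`.
-/

noncomputable section

open TopologicalSpace (Opens countableBasis)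

/-! ### Interpolating between compact and open sets -/

section RelCompactBasis

variable (X : Type*) [TopologicalSpace X] [SecondCountableTopology X]

/-- The relatively compact finite unions of members of a countable basis of `X`: a countable family
of open sets that interpolates between the compact and the open subsets of a locally compact
space. -/
def relCompactBasis : Set (Opens X) :=
  {G | IsCompact (closure (G : Set X)) ∧
    ∃ s ∈ {s : Set (Set X) | s.Finite ∧ s ⊆ countableBasis X}, ⋃₀ s = G}

instance : Countable (relCompactBasis X) := by
  have hfin := Set.countable_ofPred_finite_subset (TopologicalSpace.countable_countableBasis X)
  exact (((hfin.image Set.sUnion).preimage SetLike.coe_injective).mono fun _ hG => hG.2).to_subtype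

variable {X}

lemma isCompact_closure_of_mem_relCompactBasis {G : Opens X} (hG : G ∈ relCompactBasis X) :
    IsCompact (closure (G : Set X)) := hG.1

lemma countable_sep_relCompactBasis (p : Opens X → Prop) :
    {G ∈ relCompactBasis X | p G}.Countable :=
  (Set.to_countable (relCompactBasis X)).mono (Set.sep_subset _ _)

variable [LocallyCompactSpace X] [RegularSpace X]

lemma exists_mem_relCompactBasis_between {K U : Set X} (hK : IsCompact K) (hU : IsOpen U)
    (hKU : K ⊆ U) : ∃ G ∈ relCompactBasis X, K ⊆ G ∧ closure (G : Set X) ⊆ U := by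
  obtain ⟨V, hV, hKV, hVU, hVc⟩ := exists_open_between_and_isCompact_closure hK hU hKU
  have hbasis := TopologicalSpace.isBasis_countableBasis X
  obtain ⟨s, hsV, hsfin, hKs⟩ := hK.elim_finite_subcover_image
    (b := {b ∈ countableBasis X | b ⊆ V}) (c := fun b => b) (fun b hb => hbasis.isOpen hb.1) (by
      rw [← Set.sUnion_eq_biUnion, ← hbasis.open_eq_sUnion' hV]
      exact hKV)
  rw [← Set.sUnion_eq_biUnion] at hKs
  have hsub : closure (⋃₀ s) ⊆ closure V := closure_mono (Set.sUnion_subset fun b hb => (hsV hb).2)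
  exact ⟨⟨⋃₀ s, isOpen_sUnion fun b hb => hbasis.isOpen (hsV hb).1⟩,
    ⟨hVc.of_isClosed_subset isClosed_closure hsub, s, ⟨hsfin, fun b hb => (hsV hb).1⟩, rfl⟩,
    hKs, hsub.trans hVU⟩

lemma exists_mem_relCompactBasis {U : Set X} (hU : IsOpen U) {x : X} (hx : x ∈ U) :
    ∃ G ∈ relCompactBasis X, x ∈ G ∧ closure (G : Set X) ⊆ U := by
  simpa using exists_mem_relCompactBasis_between isCompact_singleton hU
    (Set.singleton_subset_iff.2 hx)

lemma iUnion_closure_relCompactBasis {U : Set X} (hU : IsOpen U) :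
    ⋃ G ∈ {G ∈ relCompactBasis X | closure (G : Set X) ⊆ U}, closure (G : Set X) = U := by
  refine Set.Subset.antisymm (Set.iUnion₂_subset fun G hG => hG.2) fun x hx => ?_
  obtain ⟨G, hG, hxG, hGU⟩ := exists_mem_relCompactBasis hU hx
  exact Set.mem_biUnion (x := G) ⟨hG, hGU⟩ (subset_closure hxG)

end RelCompactBasis

/-! ### The space of closed sets -/

namespace ClosedSets

lemma isClosed_carrier (F : ClosedSets) : IsClosed F.carrier :=
  TopologicalSpace.Closeds.isClosed' F

lemma carrier_injective : Function.Injective carrier :=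
  fun _ _ h => TopologicalSpace.Closeds.ext h

/-- A closed set as a point of `F(ℝ₊)`. -/
def ofIsClosed (A : Set ℝ≥0) (hA : IsClosed A) : ClosedSets :=
  (⟨A, hA⟩ : TopologicalSpace.Closeds ℝ≥0)

@[simp] lemma carrier_ofClosure (A : Set ℝ≥0) : (ofClosure A).carrier = closure A := rfl

/-- The event `{F | F ∩ A ≠ ∅}` that a closed set hits `A`. -/
def hitting (A : Set ℝ≥0) : Set ClosedSets := {F | (F.carrier ∩ A).Nonempty}

lemma mem_hitting {A : Set ℝ≥0} {F : ClosedSets} : F ∈ hitting A ↔ (F.carrier ∩ A).Nonempty :=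
  Iff.rfl

lemma hitting_mono {A B : Set ℝ≥0} (h : A ⊆ B) : hitting A ⊆ hitting B :=
  fun _ hF => hF.mono (Set.inter_subset_inter_right _ h)

lemma hitting_biUnion {ι : Type*} (s : Set ι) (A : ι → Set ℝ≥0) :
    hitting (⋃ i ∈ s, A i) = ⋃ i ∈ s, hitting (A i) := by
  ext F
  simp [mem_hitting, Set.inter_iUnion]

lemma compl_hitting (A : Set ℝ≥0) : (hitting A)ᶜ = {F : ClosedSets | F.carrier ∩ A = ∅} := by
  ext F
  exact Set.not_nonempty_iff_eq_empty

lemma isOpen_hitting {G : Set ℝ≥0} (hG : IsOpen G) : IsOpen (hitting G) :=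
  TopologicalSpace.isOpen_generateFrom_of_mem (Or.inl ⟨G, hG, rfl⟩)

lemma isClosed_hitting {K : Set ℝ≥0} (hK : IsCompact K) : IsClosed (hitting K) :=
  ⟨TopologicalSpace.isOpen_generateFrom_of_mem (Or.inr ⟨K, hK, compl_hitting K⟩)⟩

instance : BorelSpace ClosedSets := ⟨rfl⟩

lemma measurableSet_hitting {K : Set ℝ≥0} (hK : IsCompact K) : MeasurableSet (hitting K) :=
  (isClosed_hitting hK).measurableSet

lemma hitting_eq_biUnion_relCompactBasis {G : Set ℝ≥0} (hG : IsOpen G) :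
    hitting G = ⋃ B ∈ {B ∈ relCompactBasis ℝ≥0 | closure (B : Set ℝ≥0) ⊆ G}, hitting B := by
  refine Set.Subset.antisymm ?_ (Set.iUnion₂_subset fun B hB =>
    hitting_mono (subset_closure.trans hB.2))
  rintro F ⟨x, hxF, hxG⟩
  obtain ⟨B, hB, hxB, hBG⟩ := exists_mem_relCompactBasis hG hxG
  exact Set.mem_biUnion (x := B) ⟨hB, hBG⟩ ⟨x, hxF, hxB⟩

lemma exists_relCompactBasis_of_notMem_hitting {K : Set ℝ≥0} (hK : IsCompact K) {F : ClosedSets}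
    (hF : F ∉ hitting K) : ∃ B ∈ relCompactBasis ℝ≥0, K ⊆ B ∧ F ∉ hitting (closure B) := by
  obtain ⟨B, hB, hKB, hBF⟩ := exists_mem_relCompactBasis_between hK F.isClosed_carrier.isOpen_compl
    fun x hxK hxF => hF ⟨x, hxF, hxK⟩
  exact ⟨B, hB, hKB, fun ⟨x, hxF, hxB⟩ => hBF hxB hxF⟩

lemma compl_hitting_eq_biUnion_relCompactBasis {K : Set ℝ≥0} (hK : IsCompact K) :
    (hitting K)ᶜ =
      ⋃ B ∈ {B ∈ relCompactBasis ℝ≥0 | K ⊆ B}, (hitting (closure (B : Set ℝ≥0)))ᶜ := by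
  refine Set.Subset.antisymm (fun F hF => ?_) (Set.iUnion₂_subset fun B hB =>
    Set.compl_subset_compl.2 (hitting_mono (hB.2.trans subset_closure)))
  obtain ⟨B, hB, hKB, hBF⟩ := exists_relCompactBasis_of_notMem_hitting hK hF
  exact Set.mem_biUnion (x := B) ⟨hB, hKB⟩ hBF

lemma hitting_eq_biInter_relCompactBasis {K : Set ℝ≥0} (hK : IsCompact K) :
    hitting K = ⋂ B ∈ {B ∈ relCompactBasis ℝ≥0 | K ⊆ B}, hitting (B : Set ℝ≥0) := by
  refine Set.Subset.antisymm (Set.subset_iInter₂ fun B hB => hitting_mono hB.2) fun F hF => ?_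
  by_contra hFK
  obtain ⟨B, hB, hKB, hBF⟩ := exists_relCompactBasis_of_notMem_hitting hK hFK
  exact hBF (hitting_mono subset_closure (Set.mem_iInter₂.1 hF B ⟨hB, hKB⟩))

instance : SecondCountableTopology ClosedSets := by
  refine ⟨⟨(fun B : Opens ℝ≥0 => hitting B) '' relCompactBasis ℝ≥0 ∪
    (fun B : Opens ℝ≥0 => (hitting (closure B))ᶜ) '' relCompactBasis ℝ≥0,
    ((Set.to_countable _).image _).union ((Set.to_countable _).image _),
    le_antisymm (le_generateFrom ?_) (le_generateFrom ?_)⟩⟩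
  · rintro _ (⟨B, -, rfl⟩ | ⟨B, hB, rfl⟩)
    · exact isOpen_hitting B.isOpen
    · exact (isClosed_hitting (isCompact_closure_of_mem_relCompactBasis hB)).isOpen_compl
  · rintro _ (⟨G, hG, rfl⟩ | ⟨K, hK, rfl⟩)
    · rw [← hitting, hitting_eq_biUnion_relCompactBasis hG]
      exact @isOpen_biUnion _ _ (_) _ _ fun B hB =>
        TopologicalSpace.isOpen_generateFrom_of_mem (Or.inl ⟨B, hB.1, rfl⟩)
    · rw [← compl_hitting, compl_hitting_eq_biUnion_relCompactBasis hK]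
      exact @isOpen_biUnion _ _ (_) _ _ fun B hB =>
        TopologicalSpace.isOpen_generateFrom_of_mem (Or.inr ⟨B, hB.1, rfl⟩)

section Measurability

variable {Ω : Type*} [MeasurableSpace Ω] {f : Ω → ClosedSets}

lemma measurable_of_hitting_isCompact (h : ∀ K, IsCompact K → MeasurableSet (f ⁻¹' hitting K)) :
    Measurable f := by
  rw [BorelSpace.measurable_eq (α := ClosedSets),
    borel_eq_generateFrom_of_subbasis (α := ClosedSets) rfl]
  refine measurable_generateFrom ?_
  rintro _ (⟨G, hG, rfl⟩ | ⟨K, hK, rfl⟩)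
  · rw [← hitting, ← iUnion_closure_relCompactBasis hG, hitting_biUnion, Set.preimage_iUnion₂]
    exact MeasurableSet.biUnion (countable_sep_relCompactBasis _) fun B hB =>
      h _ (isCompact_closure_of_mem_relCompactBasis hB.1)
  · rw [← compl_hitting, Set.preimage_compl]
    exact (h K hK).compl

lemma measurable_of_hitting_isOpen (h : ∀ G, IsOpen G → MeasurableSet (f ⁻¹' hitting G)) :
    Measurable f := by
  refine measurable_of_hitting_isCompact fun K hK => ?_
  rw [hitting_eq_biInter_relCompactBasis hK, Set.preimage_iInter₂]
  exact MeasurableSet.biInter (countable_sep_relCompactBasis _) fun B _ => h _ B.isOpen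

end Measurability

/-- The translated set `v + F`, as a closed set. -/
def translate (v : ℝ≥0) (F : ClosedSets) : ClosedSets :=
  ofIsClosed (F.shift v) ((isometry_iff_dist_eq.2 fun x y => by
    simp [NNReal.dist_eq]).isClosedEmbedding.isClosedMap _ F.isClosed_carrier)

@[simp] lemma carrier_translate (v : ℝ≥0) (F : ClosedSets) :
    (F.translate v).carrier = F.shift v := rfl

lemma isOpen_preimage_translate {G : Set ℝ≥0} (hG : IsOpen G) :
    IsOpen ((fun p : ℝ≥0 × ClosedSets => p.2.translate p.1) ⁻¹' hitting G) := by
  rw [isOpen_iff_forall_mem_open]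
  rintro ⟨v, F⟩ ⟨_, ⟨r, hr, rfl⟩, hG'⟩
  obtain ⟨I, J, hI, hJ, hvI, hrJ, hIJ⟩ :=
    isOpen_prod_iff.1 (hG.preimage (continuous_add (M := ℝ≥0))) v r hG'
  refine ⟨I ×ˢ hitting J, ?_, hI.prod (isOpen_hitting hJ), hvI, r, hr, hrJ⟩
  rintro ⟨w, F'⟩ ⟨hw, s, hs, hsJ⟩
  exact ⟨w + s, ⟨s, hs, rfl⟩, hIJ (Set.mk_mem_prod hw hsJ)⟩

lemma measurable_translate : Measurable (fun p : ℝ≥0 × ClosedSets => p.2.translate p.1) :=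
  measurable_of_hitting_isOpen fun _ hG => (isOpen_preimage_translate hG).measurableSet

/-- The preimage of a closed set under a continuous self-map of `ℝ₊`. -/
def comap (g : C(ℝ≥0, ℝ≥0)) (F : ClosedSets) : ClosedSets :=
  ofIsClosed (g ⁻¹' F.carrier) (F.isClosed_carrier.preimage g.continuous)

lemma preimage_comap_hitting (g : C(ℝ≥0, ℝ≥0)) (A : Set ℝ≥0) :
    comap g ⁻¹' hitting A = hitting (g '' A) := by
  ext F
  constructor
  · rintro ⟨r, hr, hrA⟩
    exact ⟨g r, hr, r, hrA, rfl⟩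
  · rintro ⟨_, hr, r, hrA, rfl⟩
    exact ⟨r, hr, hrA⟩

lemma measurable_comap (g : C(ℝ≥0, ℝ≥0)) : Measurable (comap g) := by
  refine measurable_of_hitting_isCompact fun K hK => ?_
  rw [preimage_comap_hitting]
  exact measurableSet_hitting (hK.image g.continuous)

/-- The set `(F - b) ∩ [0, ∞)`. -/
def restart (b : ℝ≥0) : ClosedSets → ClosedSets := comap ⟨fun r => r + b, by fun_prop⟩

lemma measurable_restart (b : ℝ≥0) : Measurable (restart b) := measurable_comap _

lemma preimage_restart_hitting (b : ℝ≥0) (A : Set ℝ≥0) :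
    restart b ⁻¹' hitting A = hitting ((fun t => t + b) '' A) := preimage_comap_hitting _ A

/-- The set `{r | a * r ∈ F}`, which is `a⁻¹ F` if `a > 0`. -/
def contract (a : ℝ≥0) : ClosedSets → ClosedSets := comap ⟨fun r => a * r, by fun_prop⟩

@[simp] lemma mem_contract {a r : ℝ≥0} {F : ClosedSets} :
    r ∈ (F.contract a).carrier ↔ a * r ∈ F.carrier := Iff.rfl

lemma measurable_contract (a : ℝ≥0) : Measurable (contract a) := measurable_comap _

lemma measurable_ofClosure_range {ι : Type*} [Countable ι] :
    Measurable (fun w : ι → ℝ≥0 => ofClosure (Set.range w)) := by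
  refine measurable_of_hitting_isOpen fun G hG => ?_
  have hpre : (fun w : ι → ℝ≥0 => ofClosure (Set.range w)) ⁻¹' hitting G
      = ⋃ i, (fun w => w i) ⁻¹' G := by
    ext w
    simp only [Set.mem_preimage, mem_hitting, carrier_ofClosure,
      closure_inter_open_nonempty_iff hG, Set.mem_iUnion]
    exact Set.exists_range_iff
  rw [hpre]
  exact MeasurableSet.iUnion fun i => measurable_pi_apply i hG.measurableSet

end ClosedSets

/-! ### The space of sup-measures -/

namespace SupMeasure

variable (m : SupMeasure)

lemma onOpen_injective : Function.Injective onOpen := by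
  rintro ⟨f, _⟩ ⟨g, _⟩ rfl
  rfl

lemma onOpen_mono : Monotone m.onOpen := by
  intro G G' h
  have hsup := m.map_sSup {G, G'}
  rw [sSup_pair, sup_eq_right.2 h, iSup_pair] at hsup
  exact hsup ▸ le_sup_left

lemma supDeriv_le {t : ℝ≥0} {G : Opens ℝ≥0} (h : t ∈ G) : m.supDeriv t ≤ m.onOpen G :=
  iInf₂_le G h

lemma ext_mono {A B : Set ℝ≥0} (h : A ⊆ B) : m.ext A ≤ m.ext B :=
  biSup_mono h

lemma ext_le_onOpen {A : Set ℝ≥0} {G : Opens ℝ≥0} (h : A ⊆ G) : m.ext A ≤ m.onOpen G :=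
  iSup₂_le fun _ ht => m.supDeriv_le (h ht)

lemma exists_opens_of_ext_lt {A : Set ℝ≥0} {x : ℝ≥0∞} (h : m.ext A < x) :
    ∃ G : Opens ℝ≥0, A ⊆ G ∧ m.onOpen G < x := by
  obtain ⟨y, hAy, hyx⟩ := exists_between h
  refine ⟨sSup {G | m.onOpen G ≤ y}, fun t ht => ?_, ?_⟩
  · have hty : m.supDeriv t < y := (le_iSup₂ (f := fun t _ => m.supDeriv t) t ht).trans_lt hAy
    simp only [supDeriv, iInf_lt_iff] at hty
    obtain ⟨G, htG, hG⟩ := hty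
    exact Opens.mem_sSup.2 ⟨G, hG.le, htG⟩
  · rw [m.map_sSup]
    exact lt_of_le_of_lt (iSup₂_le fun _ hG => hG) hyx

lemma exists_mem_relCompactBasis_of_ext_lt {K : Set ℝ≥0} (hK : IsCompact K) {x : ℝ≥0∞}
    (h : m.ext K < x) : ∃ B ∈ relCompactBasis ℝ≥0, K ⊆ B ∧ m.onOpen B < x ∧
      m.ext (closure B) < x := by
  obtain ⟨G, hKG, hGx⟩ := m.exists_opens_of_ext_lt h
  obtain ⟨B, hB, hKB, hBG⟩ := exists_mem_relCompactBasis_between hK G.isOpen hKG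
  exact ⟨B, hB, hKB, (m.onOpen_mono (show B ≤ G from subset_closure.trans hBG)).trans_lt hGx,
    (m.ext_le_onOpen hBG).trans_lt hGx⟩

lemma exists_mem_relCompactBasis_of_lt_onOpen {G : Opens ℝ≥0} {x : ℝ≥0∞} (h : x < m.onOpen G) :
    ∃ B ∈ relCompactBasis ℝ≥0, B ≤ G ∧ x < m.onOpen B := by
  have hG : G = sSup {B ∈ relCompactBasis ℝ≥0 | B ≤ G} := by
    refine le_antisymm (fun t ht => ?_) (sSup_le fun B hB => hB.2)
    obtain ⟨B, hB, htB, hBG⟩ := exists_mem_relCompactBasis G.isOpen ht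
    exact Opens.mem_sSup.2 ⟨B, ⟨hB, subset_closure.trans hBG⟩, htB⟩
  rw [hG, m.map_sSup] at h
  simp only [lt_iSup_iff] at h
  obtain ⟨B, hB, hxB⟩ := h
  exact ⟨B, hB.1, hB.2, hxB⟩

lemma isOpen_setOf_ext_lt {K : Set ℝ≥0} (hK : IsCompact K) (x : ℝ≥0) :
    IsOpen {m : SupMeasure | m.ext K < x} :=
  TopologicalSpace.isOpen_generateFrom_of_mem (Or.inl ⟨K, x, hK, rfl⟩)

lemma isOpen_setOf_lt_onOpen (G : Opens ℝ≥0) (x : ℝ≥0) :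
    IsOpen {m : SupMeasure | x < m.onOpen G} :=
  TopologicalSpace.isOpen_generateFrom_of_mem (Or.inr ⟨G, x, rfl⟩)

instance : BorelSpace SupMeasure := ⟨rfl⟩

lemma setOf_ext_lt_eq_biUnion_rat {K : Set ℝ≥0} (hK : IsCompact K) (x : ℝ≥0) :
    {m : SupMeasure | m.ext K < x} =
      ⋃ p ∈ {p : relCompactBasis ℝ≥0 × ℚ | K ⊆ p.1 ∧ Real.toNNReal p.2 ≤ x},
        {m : SupMeasure | m.ext (closure (p.1 : Opens ℝ≥0)) < (Real.toNNReal p.2 : ℝ≥0)} := by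
  ext m
  simp only [Set.mem_ofPred_eq, Set.mem_iUnion, exists_prop]
  constructor
  · intro h
    obtain ⟨q, -, hKq, hqx⟩ := ENNReal.lt_iff_exists_rat_btwn.1 h
    obtain ⟨B, hB, hKB, -, hBq⟩ := m.exists_mem_relCompactBasis_of_ext_lt hK hKq
    exact ⟨(⟨B, hB⟩, q), ⟨hKB, by exact_mod_cast hqx.le⟩, hBq⟩
  · rintro ⟨⟨B, q⟩, ⟨hKB, hqx⟩, h⟩
    exact ((m.ext_mono (hKB.trans subset_closure)).trans_lt h).trans_le (by exact_mod_cast hqx)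

lemma setOf_lt_onOpen_eq_biUnion_rat (G : Opens ℝ≥0) (x : ℝ≥0) :
    {m : SupMeasure | x < m.onOpen G} =
      ⋃ p ∈ {p : relCompactBasis ℝ≥0 × ℚ | p.1 ≤ G ∧ x ≤ Real.toNNReal p.2},
        {m : SupMeasure | (Real.toNNReal p.2 : ℝ≥0) < m.onOpen p.1} := by
  ext m
  simp only [Set.mem_ofPred_eq, Set.mem_iUnion, exists_prop]
  constructor
  · intro h
    obtain ⟨q, -, hxq, hqG⟩ := ENNReal.lt_iff_exists_rat_btwn.1 h
    obtain ⟨B, hB, hBG, hqB⟩ := m.exists_mem_relCompactBasis_of_lt_onOpen hqG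
    exact ⟨(⟨B, hB⟩, q), ⟨hBG, by exact_mod_cast hxq.le⟩, hqB⟩
  · rintro ⟨⟨B, q⟩, ⟨hBG, hxq⟩, h⟩
    exact lt_of_le_of_lt (by exact_mod_cast hxq) (h.trans_le (m.onOpen_mono hBG))

instance : SecondCountableTopology SupMeasure := by
  refine ⟨⟨Set.range (fun p : relCompactBasis ℝ≥0 × ℚ =>
      {m : SupMeasure | m.ext (closure (p.1 : Opens ℝ≥0)) < (Real.toNNReal p.2 : ℝ≥0)}) ∪
    Set.range (fun p : relCompactBasis ℝ≥0 × ℚ =>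
      {m : SupMeasure | (Real.toNNReal p.2 : ℝ≥0) < m.onOpen p.1}),
    (Set.countable_range _).union (Set.countable_range _),
    le_antisymm (le_generateFrom ?_) (le_generateFrom ?_)⟩⟩
  · rintro _ (⟨p, rfl⟩ | ⟨p, rfl⟩)
    · exact isOpen_setOf_ext_lt (isCompact_closure_of_mem_relCompactBasis p.1.2) _
    · exact isOpen_setOf_lt_onOpen _ _
  · rintro _ (⟨K, x, hK, rfl⟩ | ⟨G, x, rfl⟩)
    · rw [setOf_ext_lt_eq_biUnion_rat hK]
      exact @isOpen_biUnion _ _ (_) _ _ fun p _ =>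
        TopologicalSpace.isOpen_generateFrom_of_mem (Or.inl ⟨p, rfl⟩)
    · rw [setOf_lt_onOpen_eq_biUnion_rat]
      exact @isOpen_biUnion _ _ (_) _ _ fun p _ =>
        TopologicalSpace.isOpen_generateFrom_of_mem (Or.inr ⟨p, rfl⟩)

lemma setOf_ext_lt_eq_biUnion_onOpen_lt {K : Set ℝ≥0} (hK : IsCompact K) (x : ℝ≥0∞) :
    {m : SupMeasure | m.ext K < x} =
      ⋃ B ∈ {B ∈ relCompactBasis ℝ≥0 | K ⊆ B}, {m : SupMeasure | m.onOpen B < x} := by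
  ext m
  simp only [Set.mem_ofPred_eq, Set.mem_iUnion, exists_prop]
  constructor
  · intro h
    obtain ⟨B, hB, hKB, hBx, -⟩ := m.exists_mem_relCompactBasis_of_ext_lt hK h
    exact ⟨B, ⟨hB, hKB⟩, hBx⟩
  · rintro ⟨B, ⟨-, hKB⟩, hBx⟩
    exact (m.ext_le_onOpen hKB).trans_lt hBx

lemma measurable_of_onOpen {Ω : Type*} [MeasurableSpace Ω] {f : Ω → SupMeasure}
    (h : ∀ G, Measurable fun ω => (f ω).onOpen G) : Measurable f := by
  rw [BorelSpace.measurable_eq (α := SupMeasure),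
    borel_eq_generateFrom_of_subbasis (α := SupMeasure) rfl]
  refine measurable_generateFrom ?_
  rintro _ (⟨K, x, hK, rfl⟩ | ⟨G, x, rfl⟩)
  · rw [setOf_ext_lt_eq_biUnion_onOpen_lt hK, Set.preimage_iUnion₂]
    exact MeasurableSet.biUnion (countable_sep_relCompactBasis _) fun B _ =>
      measurableSet_lt (h B) measurable_const
  · exact measurableSet_lt measurable_const (h G)

lemma exists_measurableSet_preimage_onOpen {A : Set SupMeasure} (hA : MeasurableSet A) :
    ∃ B : Set (Opens ℝ≥0 → ℝ≥0∞), MeasurableSet B ∧ onOpen ⁻¹' B = A := by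
  have hid : Measurable[MeasurableSpace.comap onOpen inferInstance]
      (id : SupMeasure → SupMeasure) :=
    @measurable_of_onOpen _ (MeasurableSpace.comap onOpen inferInstance) _ fun G =>
      (measurable_pi_apply G).comp (comap_measurable onOpen)
  exact hid hA

end SupMeasure

/-! ### Laplace transforms -/

/-- The kernel `exp (-θ x)` of the Laplace transform, with values in `[0, ∞]`. -/
def laplaceKernel (θ x : ℝ≥0) : ℝ≥0∞ := ENNReal.ofReal (Real.exp (-((θ : ℝ) * (x : ℝ))))

/-- The Laplace transform of a measure on `[0, ∞)`. -/
def laplaceTransform (μ : Measure ℝ≥0) (θ : ℝ≥0) : ℝ≥0∞ := ∫⁻ x, laplaceKernel θ x ∂μ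

@[fun_prop]
lemma measurable_laplaceKernel (θ : ℝ≥0) : Measurable (laplaceKernel θ) := by
  unfold laplaceKernel
  fun_prop

lemma laplaceKernel_ne_zero (θ x : ℝ≥0) : laplaceKernel θ x ≠ 0 :=
  (ENNReal.ofReal_pos.2 (Real.exp_pos _)).ne'

lemma laplaceKernel_ne_top (θ x : ℝ≥0) : laplaceKernel θ x ≠ ∞ := ENNReal.ofReal_ne_top

lemma laplaceKernel_add_left (θ θ' x : ℝ≥0) :
    laplaceKernel (θ + θ') x = laplaceKernel θ x * laplaceKernel θ' x := by
  rw [laplaceKernel, NNReal.coe_add, add_mul, neg_add, Real.exp_add,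
    ENNReal.ofReal_mul (Real.exp_pos _).le, laplaceKernel, laplaceKernel]

lemma laplaceKernel_mul_right (θ a x : ℝ≥0) :
    laplaceKernel θ (a * x) = laplaceKernel (θ * a) x := by
  simp only [laplaceKernel, NNReal.coe_mul, mul_assoc]

lemma laplaceKernel_comm (θ x : ℝ≥0) : laplaceKernel θ x = laplaceKernel x θ := by
  rw [laplaceKernel, mul_comm, laplaceKernel]

lemma laplaceKernel_add_right (θ x y : ℝ≥0) :
    laplaceKernel θ (x + y) = laplaceKernel θ x * laplaceKernel θ y := by
  simp only [laplaceKernel_comm θ, laplaceKernel_add_left]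

lemma laplaceKernel_antitone (θ : ℝ≥0) : Antitone (laplaceKernel θ) := fun x y hxy => by
  unfold laplaceKernel
  gcongr

lemma laplaceTransform_map {Ω : Type*} [MeasurableSpace Ω] {P : Measure Ω} {X : Ω → ℝ≥0}
    (hX : Measurable X) (θ : ℝ≥0) :
    laplaceTransform (P.map X) θ = ∫⁻ ω, laplaceKernel θ (X ω) ∂P :=
  lintegral_map (measurable_laplaceKernel θ) hX

lemma integrable_exp_neg_mul {Ω : Type*} [MeasurableSpace Ω] {P : Measure Ω} [IsFiniteMeasure P]
    {X : Ω → ℝ≥0} (hX : Measurable X) (θ : ℝ≥0) :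
    Integrable (fun ω => Real.exp (-((θ : ℝ) * (X ω : ℝ)))) P := by
  refine Integrable.of_bound (C := 1) (Measurable.aestronglyMeasurable (by fun_prop))
    (Filter.Eventually.of_forall fun ω => ?_)
  rw [Real.norm_eq_abs, Real.abs_exp, Real.exp_le_one_iff, neg_nonpos]
  positivity

lemma laplaceTransform_map_eq_ofReal_integral {Ω : Type*} [MeasurableSpace Ω] {P : Measure Ω}
    [IsFiniteMeasure P] {X : Ω → ℝ≥0} (hX : Measurable X) (θ : ℝ≥0) :
    laplaceTransform (P.map X) θ = ENNReal.ofReal (∫ ω, Real.exp (-((θ : ℝ) * (X ω : ℝ))) ∂P) := by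
  rw [laplaceTransform_map hX, ofReal_integral_eq_lintegral_ofReal (integrable_exp_neg_mul hX θ)
    (Filter.Eventually.of_forall fun ω => (Real.exp_pos _).le)]
  rfl

/-- The bounded continuous function `x ↦ exp (-x)` on `[0, ∞)`. It generates the algebra to which
the Stone–Weierstrass theorem is applied. -/
def expNegBCF : BoundedContinuousFunction ℝ≥0 ℝ :=
  BoundedContinuousFunction.ofNormedAddCommGroup (fun x : ℝ≥0 => Real.exp (-(x : ℝ)))
    (by fun_prop) 1 fun x => by
      rw [Real.norm_eq_abs, Real.abs_exp, Real.exp_le_one_iff, neg_nonpos]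
      exact x.coe_nonneg

@[simp] lemma expNegBCF_apply (x : ℝ≥0) : expNegBCF x = Real.exp (-(x : ℝ)) := rfl

lemma integral_expNegBCF_pow (μ : Measure ℝ≥0) [IsFiniteMeasure μ] (n : ℕ) :
    ∫ x, (expNegBCF ^ n) x ∂μ = (laplaceTransform μ n).toReal := by
  have h := laplaceTransform_map_eq_ofReal_integral (P := μ) measurable_id (n : ℝ≥0)
  rw [Measure.map_id] at h
  rw [h, ENNReal.toReal_ofReal (integral_nonneg fun x => (Real.exp_pos _).le)]
  refine integral_congr_ae (Filter.Eventually.of_forall fun x => ?_)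
  change expNegBCF x ^ n = _
  rw [expNegBCF_apply, ← Real.exp_nat_mul]
  congr 1
  simp

lemma integral_aeval_expNegBCF (μ : Measure ℝ≥0) [IsFiniteMeasure μ] (p : Polynomial ℝ) :
    ∫ x, (Polynomial.aeval expNegBCF p : BoundedContinuousFunction ℝ≥0 ℝ) x ∂μ
      = ∑ n ∈ Finset.range (p.natDegree + 1), p.coeff n * (laplaceTransform μ n).toReal := by
  simp only [Polynomial.aeval_eq_sum_range, BoundedContinuousFunction.coe_sum, Finset.sum_apply]
  rw [integral_finsetSum _ fun i _ => BoundedContinuousFunction.integrable μ _]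
  refine Finset.sum_congr rfl fun i _ => ?_
  rw [← integral_expNegBCF_pow, ← integral_const_mul]
  rfl

lemma ext_of_laplaceTransform_natCast {μ ν : Measure ℝ≥0} [IsFiniteMeasure μ] [IsFiniteMeasure ν]
    (h : ∀ n : ℕ, laplaceTransform μ n = laplaceTransform ν n) : μ = ν := by
  let A : StarSubalgebra ℝ (BoundedContinuousFunction ℝ≥0 ℝ) :=
    { Algebra.adjoin ℝ {expNegBCF} with star_mem' := id }
  refine ext_of_forall_mem_subalgebra_integral_eq_of_polish (𝕜 := ℝ) (A := A) ?_ ?_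
  · intro x y hxy
    refine ⟨expNegBCF, ⟨_, ⟨expNegBCF, Algebra.subset_adjoin rfl, rfl⟩, rfl⟩, ?_⟩
    simpa using hxy
  · intro g hg
    have hg : g ∈ Algebra.adjoin ℝ {expNegBCF} := hg
    rw [Algebra.adjoin_singleton_eq_range_aeval] at hg
    obtain ⟨p, rfl⟩ := hg
    refine (integral_aeval_expNegBCF μ p).trans (Eq.trans ?_ (integral_aeval_expNegBCF ν p).symm)
    simp only [h]

lemma laplaceTransform_withDensity_laplaceKernel (μ : Measure ℝ≥0) (θ θ' : ℝ≥0) :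
    laplaceTransform (μ.withDensity (laplaceKernel θ)) θ' = laplaceTransform μ (θ + θ') := by
  rw [laplaceTransform, lintegral_withDensity_eq_lintegral_mul _ (measurable_laplaceKernel θ)
    (measurable_laplaceKernel θ'), laplaceTransform]
  simp only [Pi.mul_apply, laplaceKernel_add_left]

-- Tilting by `exp (-x)` reduces to finite measures.
lemma ext_of_laplaceTransform {μ ν : Measure ℝ≥0}
    (hμ : ∀ θ : ℝ≥0, 0 < θ → laplaceTransform μ θ ≠ ∞)
    (h : ∀ θ : ℝ≥0, 0 < θ → laplaceTransform μ θ = laplaceTransform ν θ) : μ = ν := by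
  have untilt (ρ : Measure ℝ≥0) :
      (ρ.withDensity (laplaceKernel 1)).withDensity (fun x => (laplaceKernel 1 x)⁻¹) = ρ :=
    withDensity_inv_same (measurable_laplaceKernel 1)
      (Filter.Eventually.of_forall (laplaceKernel_ne_zero 1))
      (Filter.Eventually.of_forall (laplaceKernel_ne_top 1))
  have : IsFiniteMeasure (μ.withDensity (laplaceKernel 1)) :=
    isFiniteMeasure_withDensity (hμ 1 one_pos)
  have : IsFiniteMeasure (ν.withDensity (laplaceKernel 1)) :=
    isFiniteMeasure_withDensity ((h 1 one_pos).symm.trans_ne (hμ 1 one_pos))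
  have tilted : μ.withDensity (laplaceKernel 1) = ν.withDensity (laplaceKernel 1) :=
    ext_of_laplaceTransform_natCast fun n => by
      rw [laplaceTransform_withDensity_laplaceKernel, laplaceTransform_withDensity_laplaceKernel,
        h _ (by positivity)]
  rw [← untilt μ, tilted, untilt ν]

/-! ### Subordinators with regular paths -/

/-- A `β`-stable subordinator with Laplace exponent `c θ ^ β`, all of whose paths start at `0` and
are nondecreasing, right-continuous and unbounded. Every stable subordinator is indistinguishable
from one of these, for which there are no exceptional null sets to carry along. -/
structure IsRegularSubordinator {Ω : Type*} [MeasurableSpace Ω] (β c : ℝ) (S : ℝ≥0 → Ω → ℝ≥0)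
    (P : Measure Ω) : Prop where
  measurable : ∀ t, Measurable (S t)
  zero : ∀ ω, S 0 ω = 0
  mono : ∀ ω, Monotone fun t => S t ω
  rightCont : ∀ ω t, ContinuousWithinAt (fun s => S s ω) (Set.Ici t) t
  unbounded : ∀ ω x, ∃ t, x ≤ S t ω
  indep : HasIndepIncrements S P
  stationary : ∀ s t : ℝ≥0, IdentDistrib (fun ω => S (s + t) ω - S s ω) (S t) P P
  laplace_map : ∀ t θ : ℝ≥0,
    laplaceTransform (P.map (S t)) θ = ENNReal.ofReal (Real.exp (-(c * (t : ℝ) * (θ : ℝ) ^ β)))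

section

variable {Ω : Type*} [MeasurableSpace Ω] {P : Measure Ω}

lemma laplaceKernel_mul_measure_le_laplaceTransform {X : Ω → ℝ≥0} (hX : Measurable X)
    (θ x : ℝ≥0) : laplaceKernel θ x * P {ω | X ω ≤ x} ≤ laplaceTransform (P.map X) θ := by
  rw [laplaceTransform_map hX]
  refine le_trans ?_ (mul_meas_ge_le_lintegral ((measurable_laplaceKernel θ).comp hX)
    (laplaceKernel θ x))
  gcongr with ω
  exact fun hω => laplaceKernel_antitone θ hω

lemma ae_exists_le_of_tendsto_laplaceTransform {X : ℕ → Ω → ℝ≥0} (hX : ∀ n, Measurable (X n))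
    {θ : ℝ≥0}
    (h : Filter.Tendsto (fun n => laplaceTransform (P.map (X n)) θ) Filter.atTop (nhds 0)) :
    ∀ᵐ ω ∂P, ∀ x : ℝ≥0, ∃ n, x ≤ X n ω := by
  have unbounded_by (M : ℕ) : ∀ᵐ ω ∂P, ∃ n, (M : ℝ≥0) ≤ X n ω := by
    rw [ae_iff]
    have bound (n : ℕ) : laplaceKernel θ M * P {ω | ¬ ∃ n, (M : ℝ≥0) ≤ X n ω}
        ≤ laplaceTransform (P.map (X n)) θ :=
      le_trans (by
        gcongr with ω
        exact fun hω => (not_le.1 (not_exists.1 hω n)).le)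
        (laplaceKernel_mul_measure_le_laplaceTransform (hX n) θ M)
    have := le_antisymm (ge_of_tendsto' h bound) zero_le
    exact (mul_eq_zero.1 this).resolve_left (laplaceKernel_ne_zero θ M)
  filter_upwards [ae_all_iff.2 unbounded_by] with ω hω x
  obtain ⟨M, hM⟩ := exists_nat_ge x
  obtain ⟨n, hn⟩ := hω M
  exact ⟨n, hM.trans hn⟩

lemma IsStableSubordinator.exists_laplaceTransform_map [IsFiniteMeasure P] {β : ℝ}
    {S : ℝ≥0 → Ω → ℝ≥0} (hS : IsStableSubordinator β S P) :
    ∃ c > 0, ∀ t θ : ℝ≥0, laplaceTransform (P.map (S t)) θ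
      = ENNReal.ofReal (Real.exp (-(c * (t : ℝ) * (θ : ℝ) ^ β))) := by
  obtain ⟨c, hc, hlap⟩ := hS.laplace
  exact ⟨c, hc, fun t θ => by
    rw [laplaceTransform_map_eq_ofReal_integral (hS.measurable t), hlap]⟩

lemma IsStableSubordinator.ae_unbounded [IsFiniteMeasure P] {β : ℝ} {S : ℝ≥0 → Ω → ℝ≥0}
    (hS : IsStableSubordinator β S P) : ∀ᵐ ω ∂P, ∀ x : ℝ≥0, ∃ n : ℕ, x ≤ S n ω := by
  obtain ⟨c, hc, hlap⟩ := hS.exists_laplaceTransform_map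
  refine ae_exists_le_of_tendsto_laplaceTransform (θ := 1) (fun n => hS.measurable n) ?_
  simp only [hlap, NNReal.coe_natCast, NNReal.coe_one, Real.one_rpow, mul_one]
  rw [← ENNReal.ofReal_zero]
  exact ENNReal.tendsto_ofReal (Real.tendsto_exp_neg_atTop_nhds_zero.comp
    (tendsto_natCast_atTop_atTop.const_mul_atTop hc))

lemma IsStableSubordinator.isRegularSubordinator_of_ae_eq {β c : ℝ} {S S' : ℝ≥0 → Ω → ℝ≥0}
    (hS : IsStableSubordinator β S P)
    (hlap : ∀ t θ : ℝ≥0, laplaceTransform (P.map (S t)) θ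
      = ENNReal.ofReal (Real.exp (-(c * (t : ℝ) * (θ : ℝ) ^ β))))
    (heq : ∀ t, S t =ᵐ[P] S' t) (hmeas : ∀ t, Measurable (S' t))
    (hpath : ∀ ω, S' 0 ω = 0 ∧ Monotone (fun t => S' t ω) ∧
      (∀ t, ContinuousWithinAt (fun s => S' s ω) (Set.Ici t) t) ∧ ∀ x, ∃ t, x ≤ S' t ω) :
    IsRegularSubordinator β c S' P where
  measurable := hmeas
  zero ω := (hpath ω).1
  mono ω := (hpath ω).2.1
  rightCont ω := (hpath ω).2.2.1
  unbounded ω := (hpath ω).2.2.2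
  indep n t ht := (hS.indep n t ht).congr fun _ => (heq _).sub (heq _)
  stationary s t := by
    refine ⟨((hmeas _).sub (hmeas _)).aemeasurable, (hmeas t).aemeasurable, ?_⟩
    rw [← Measure.map_congr (heq t), ← (hS.stationary s t).map_eq]
    exact (Measure.map_congr ((heq (s + t)).sub (heq s))).symm
  laplace_map t θ := by rw [← Measure.map_congr (heq t), hlap]

lemma IsStableSubordinator.exists_isRegularSubordinator [IsFiniteMeasure P] {β : ℝ}
    {S : ℝ≥0 → Ω → ℝ≥0} (hS : IsStableSubordinator β S P) :
    ∃ c > 0, ∃ S' : ℝ≥0 → Ω → ℝ≥0, IsRegularSubordinator β c S' P ∧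
      ∀ᵐ ω ∂P, ∀ t, S t ω = S' t ω := by
  obtain ⟨c, hc, hlap⟩ := hS.exists_laplaceTransform_map
  obtain ⟨s, hs, hsm, hgood⟩ :=
    ((hS.zero.and hS.path).and hS.ae_unbounded).exists_measurable_mem
  classical
  let S' : ℝ≥0 → Ω → ℝ≥0 := fun t => s.piecewise (S t) fun _ => t
  have eq_of_mem {ω} (hω : ω ∈ s) (t) : S' t ω = S t ω := Set.piecewise_eq_of_mem _ _ _ hω
  have eq_of_notMem {ω} (hω : ω ∉ s) (t) : S' t ω = t := Set.piecewise_eq_of_notMem _ _ _ hω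
  have heq : ∀ᵐ ω ∂P, ∀ t, S t ω = S' t ω := by
    filter_upwards [hs] with ω hω t using (eq_of_mem hω t).symm
  refine ⟨c, hc, S', hS.isRegularSubordinator_of_ae_eq hlap (fun t => heq.mono fun ω h => h t)
    (fun t => (hS.measurable t).piecewise hsm measurable_const) fun ω => ?_, heq⟩
  by_cases hω : ω ∈ s
  · simp only [eq_of_mem hω]
    obtain ⟨⟨zero, mono, rightCont⟩, unbounded⟩ := hgood ω hω
    exact ⟨zero, mono, rightCont, fun x => (unbounded x).imp' _ fun _ hn => hn⟩
  · simp only [eq_of_notMem hω]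
    exact ⟨trivial, monotone_id, fun _ => continuousWithinAt_id, fun x => ⟨x, le_rfl⟩⟩

/-! ### Processes along the dyadic numbers -/

/-- The dyadic number `k / 2 ^ n`, for `p = (n, k)`. -/
def dyadic (p : ℕ × ℕ) : ℝ≥0 := (p.2 : ℝ≥0) / 2 ^ p.1

lemma dyadic_eq_dyadic_of_le {n N : ℕ} (h : n ≤ N) (k : ℕ) :
    dyadic (n, k) = dyadic (N, k * 2 ^ (N - n)) := by
  obtain ⟨d, rfl⟩ := Nat.exists_eq_add_of_le h
  simp only [dyadic, Nat.add_sub_cancel_left, Nat.cast_mul, Nat.cast_pow, Nat.cast_ofNat, pow_add]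
  rw [mul_div_mul_right _ _ (by positivity)]

lemma dyadic_mono (n : ℕ) : Monotone fun k => dyadic (n, k) := fun k l h => by
  simp only [dyadic]
  gcongr

lemma dyadic_add (n k l : ℕ) : dyadic (n, k) + dyadic (n, l) = dyadic (n, k + l) := by
  simp only [dyadic, Nat.cast_add, add_div]

lemma dyadic_zero (n : ℕ) : dyadic (n, 0) = 0 := by simp [dyadic]

/-- The restriction of a path to the dyadic times. Right-continuous paths are determined by it, and
it takes its values in a countable product. -/
def dyadicPath {Ω : Type*} (X : ℝ≥0 → Ω → ℝ≥0) (ω : Ω) (p : ℕ × ℕ) : ℝ≥0 := X (dyadic p) ω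

/-- The process of the increments after time `s`. -/
def futureIncr {Ω : Type*} (X : ℝ≥0 → Ω → ℝ≥0) (s t : ℝ≥0) (ω : Ω) : ℝ≥0 := X (s + t) ω - X s ω

/-- The increments of a process along the dyadic grid of level `N`. -/
def gridIncr {Ω : Type*} (X : ℝ≥0 → Ω → ℝ≥0) (N i : ℕ) (ω : Ω) : ℝ≥0 :=
  X (dyadic (N, i + 1)) ω - X (dyadic (N, i)) ω

lemma add_sum_gridIncr {Ω : Type*} {X : ℝ≥0 → Ω → ℝ≥0} {ω : Ω} (hX : Monotone fun t => X t ω)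
    (N k l : ℕ) :
    X (dyadic (N, k)) ω + ∑ i ∈ Finset.range l, gridIncr X N (k + i) ω
      = X (dyadic (N, k + l)) ω := by
  induction l with
  | zero => simp
  | succ l ih =>
    rw [Finset.sum_range_succ, ← add_assoc, ih, gridIncr, ← add_assoc k l 1]
    exact add_tsub_cancel_of_le (hX (dyadic_mono N (Nat.le_succ _)))

lemma sum_gridIncr {Ω : Type*} {X : ℝ≥0 → Ω → ℝ≥0} {ω : Ω} (hX0 : X 0 ω = 0)
    (hX : Monotone fun t => X t ω) {n N : ℕ} (h : n ≤ N) (k : ℕ) :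
    ∑ i ∈ Finset.range (k * 2 ^ (N - n)), gridIncr X N i ω = X (dyadic (n, k)) ω := by
  have := add_sum_gridIncr hX N 0 (k * 2 ^ (N - n))
  rwa [dyadic_zero, hX0, zero_add, zero_add, ← dyadic_eq_dyadic_of_le h,
    Finset.sum_congr rfl fun i _ => by rw [zero_add i]] at this

lemma iIndepFun_gridIncr {X : ℝ≥0 → Ω → ℝ≥0} (hX : HasIndepIncrements X P)
    (N : ℕ) : iIndepFun (gridIncr X N) P :=
  hX.nat (t := fun i => dyadic (N, i)) (dyadic_mono N)

lemma measurable_gridIncr {X : ℝ≥0 → Ω → ℝ≥0} (hX : ∀ t, Measurable (X t)) (N i : ℕ) :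
    Measurable (gridIncr X N i) := (hX _).sub (hX _)

lemma measurable_futureIncr {X : ℝ≥0 → Ω → ℝ≥0} (hX : ∀ t, Measurable (X t)) (s t : ℝ≥0) :
    Measurable (futureIncr X s t) := (hX _).sub (hX _)

lemma measurable_dyadicPath {X : ℝ≥0 → Ω → ℝ≥0} (hX : ∀ t, Measurable (X t)) :
    Measurable (dyadicPath X) := measurable_pi_lambda _ fun _ => hX _

lemma map_dyadicPath_eq_of_map_gridIncr_eq [IsProbabilityMeasure P] {X Y : ℝ≥0 → Ω → ℝ≥0}
    (hX : ∀ t, Measurable (X t)) (hY : ∀ t, Measurable (Y t))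
    (hX0 : ∀ ω, X 0 ω = 0) (hY0 : ∀ ω, Y 0 ω = 0)
    (hXm : ∀ ω, Monotone fun t => X t ω) (hYm : ∀ ω, Monotone fun t => Y t ω)
    (hXi : HasIndepIncrements X P) (hYi : HasIndepIncrements Y P)
    (h : ∀ N i, P.map (gridIncr X N i) = P.map (gridIncr Y N i)) :
    P.map (dyadicPath X) = P.map (dyadicPath Y) := by
  refine (map_eq_iff_forall_finset_map_restrict_eq
    (X := fun p => X (dyadic p)) (Y := fun p => Y (dyadic p))
    (measurable_dyadicPath hX).aemeasurable (measurable_dyadicPath hY).aemeasurable).2 fun I => ?_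
  let N := I.sup Prod.fst
  let sums : (ℕ → ℝ≥0) → (I → ℝ≥0) := fun δ p =>
    ∑ i ∈ Finset.range (p.1.2 * 2 ^ (N - p.1.1)), δ i
  have measurable_sums : Measurable sums :=
    measurable_pi_lambda _ fun p => Finset.measurable_sum _ fun i _ => measurable_pi_apply i
  have restrict_eq {Z : ℝ≥0 → Ω → ℝ≥0} (hZ0 : ∀ ω, Z 0 ω = 0)
      (hZm : ∀ ω, Monotone fun t => Z t ω) :
      (fun ω => I.restrict (fun p => Z (dyadic p) ω)) = sums ∘ fun ω i => gridIncr Z N i ω :=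
    funext₂ fun ω p =>
      (sum_gridIncr (hZ0 ω) (hZm ω) (Finset.le_sup (f := Prod.fst) p.2) p.1.2).symm
  rw [restrict_eq hX0 hXm, restrict_eq hY0 hYm,
    ← Measure.map_map measurable_sums (measurable_pi_lambda _ (measurable_gridIncr hX N)),
    ← Measure.map_map measurable_sums (measurable_pi_lambda _ (measurable_gridIncr hY N)),
    (iIndepFun_gridIncr hXi N).map_fun_eq_infinitePi_map (measurable_gridIncr hX N),
    (iIndepFun_gridIncr hYi N).map_fun_eq_infinitePi_map (measurable_gridIncr hY N)]
  simp only [h]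

namespace IsRegularSubordinator

variable {β c : ℝ} {S : ℝ≥0 → Ω → ℝ≥0}

lemma map_sub (hS : IsRegularSubordinator β c S P) {s t : ℝ≥0} (h : s ≤ t) :
    P.map (fun ω => S t ω - S s ω) = P.map (S (t - s)) := by
  have := (hS.stationary s (t - s)).map_eq
  rwa [add_tsub_cancel_of_le h] at this

lemma map_gridIncr (hS : IsRegularSubordinator β c S P) (N i : ℕ) :
    P.map (gridIncr S N i) = P.map (S (dyadic (N, i + 1) - dyadic (N, i))) :=
  hS.map_sub (dyadic_mono N (Nat.le_succ i))

lemma map_dyadicPath_futureIncr [IsProbabilityMeasure P] (hS : IsRegularSubordinator β c S P)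
    (s : ℝ≥0) : P.map (dyadicPath (futureIncr S s)) = P.map (dyadicPath S) := by
  have futureIncr_sub (ω) (a b : ℝ≥0) :
      futureIncr S s b ω - futureIncr S s a ω = S (s + b) ω - S (s + a) ω :=
    tsub_tsub_tsub_cancel_right (hS.mono ω le_self_add)
  refine map_dyadicPath_eq_of_map_gridIncr_eq (measurable_futureIncr hS.measurable s)
    hS.measurable (fun ω => by simp [futureIncr]) hS.zero
    (fun ω a b h => tsub_le_tsub_right (hS.mono ω (by gcongr)) _) hS.mono ?_ hS.indep fun N i => ?_
  · intro n t ht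
    have := hS.indep n (fun i => s + t i) fun i j h => by simpa using ht h
    simpa only [futureIncr_sub] using this
  · rw [hS.map_gridIncr, ← add_tsub_add_eq_tsub_left s,
      ← hS.map_sub (by gcongr; exact dyadic_mono N (Nat.le_succ i))]
    congr with ω
    exact congrArg _ (futureIncr_sub ω _ _)

lemma map_inv_mul [IsProbabilityMeasure P] (hS : IsRegularSubordinator β c S P) {a : ℝ≥0}
    (ha : 0 < a) (t : ℝ≥0) : P.map (fun ω => a⁻¹ * S (a ^ β * t) ω) = P.map (S t) := by
  have hmeas : Measurable fun ω => a⁻¹ * S (a ^ β * t) ω := (hS.measurable _).const_mul _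
  have := Measure.isProbabilityMeasure_map (μ := P) hmeas.aemeasurable
  have := Measure.isProbabilityMeasure_map (μ := P) (hS.measurable t).aemeasurable
  refine ext_of_laplaceTransform_natCast fun n => ?_
  rw [laplaceTransform_map hmeas]
  simp only [laplaceKernel_mul_right]
  rw [← laplaceTransform_map (hS.measurable _), hS.laplace_map, hS.laplace_map]
  have ha' : (0 : ℝ) < a := ha
  have : (a : ℝ) ^ β ≠ 0 := (Real.rpow_pos_of_pos ha' _).ne'
  simp only [NNReal.coe_mul, NNReal.coe_rpow, NNReal.coe_inv]
  rw [Real.mul_rpow (NNReal.coe_nonneg _) (inv_nonneg.2 ha'.le), Real.inv_rpow ha'.le]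
  field_simp

lemma map_dyadicPath_inv_mul [IsProbabilityMeasure P] (hS : IsRegularSubordinator β c S P)
    {a : ℝ≥0} (ha : 0 < a) :
    P.map (dyadicPath fun t ω => a⁻¹ * S (a ^ β * t) ω) = P.map (dyadicPath S) := by
  refine map_dyadicPath_eq_of_map_gridIncr_eq
    (fun t => (hS.measurable _).const_mul _) hS.measurable (fun ω => by simp [hS.zero]) hS.zero
    (fun ω s t h => mul_le_mul_right (hS.mono ω (by gcongr)) _) hS.mono ?_ hS.indep fun N i => ?_
  · intro n t ht
    have := (hS.indep n (fun i => a ^ β * t i) fun i j h => mul_le_mul_right (ht h) _).comp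
      (fun _ x => a⁻¹ * x) fun _ => by fun_prop
    simpa only [Function.comp_def, mul_tsub] using this
  · have hle : dyadic (N, i) ≤ dyadic (N, i + 1) := dyadic_mono N (Nat.le_succ i)
    have scaled : gridIncr (fun t ω => a⁻¹ * S (a ^ β * t) ω) N i = (fun x => a⁻¹ * x) ∘
        fun ω => S (a ^ β * dyadic (N, i + 1)) ω - S (a ^ β * dyadic (N, i)) ω := by
      funext ω
      simp only [gridIncr, Function.comp_apply, mul_tsub]
    rw [scaled, ← Measure.map_map (measurable_const_mul _)
      (by exact (hS.measurable _).sub (hS.measurable _)), hS.map_sub (by gcongr),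
      Measure.map_map (by fun_prop) (hS.measurable _), ← mul_tsub, hS.map_gridIncr,
      ← hS.map_inv_mul ha]
    rfl

end IsRegularSubordinator

end

/-! ### The strong Markov property at first passage times -/

/-- The index `k` of the first point `k / 2 ^ n` of the dyadic grid of level `n` which is at least
`t`. -/
def dyadicIdx (n : ℕ) (t : ℝ≥0) : ℕ := ⌈2 ^ n * t⌉₊

/-- The first point of the dyadic grid of level `n` which is at least `t`. -/
def dyadicCeil (n : ℕ) (t : ℝ≥0) : ℝ≥0 := dyadic (n, dyadicIdx n t)

lemma measurable_dyadicIdx (n : ℕ) : Measurable (dyadicIdx n) :=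
  Nat.measurable_ceil.comp (measurable_const_mul _)

lemma measurable_dyadicCeil (n : ℕ) : Measurable (dyadicCeil n) :=
  (measurable_from_top (f := fun k : ℕ => dyadic (n, k))).comp (measurable_dyadicIdx n)

lemma dyadicIdx_le_iff {n k : ℕ} {t : ℝ≥0} : dyadicIdx n t ≤ k ↔ t ≤ dyadic (n, k) := by
  rw [dyadicIdx, Nat.ceil_le, dyadic, le_div_iff₀ (by positivity), mul_comm]

lemma le_dyadicCeil (n : ℕ) (t : ℝ≥0) : t ≤ dyadicCeil n t := dyadicIdx_le_iff.1 le_rfl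

lemma dyadicCeil_le_add (n : ℕ) (t : ℝ≥0) : dyadicCeil n t ≤ t + (1 / 2) ^ n := by
  rw [dyadicCeil, dyadic, div_le_iff₀ (by positivity), add_mul, ← mul_pow,
    one_div_mul_cancel two_ne_zero, one_pow, mul_comm]
  exact (Nat.ceil_lt_add_one zero_le).le

lemma tendsto_dyadicCeil (t : ℝ≥0) :
    Filter.Tendsto (fun n => dyadicCeil n t) Filter.atTop (nhds t) := by
  have hlim : Filter.Tendsto (fun n : ℕ => t + (1 / 2 : ℝ≥0) ^ n) Filter.atTop (nhds (t + 0)) :=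
    tendsto_const_nhds.add (NNReal.tendsto_pow_atTop_nhds_zero_of_lt_one
      (div_lt_one two_pos |>.2 one_lt_two))
  rw [add_zero] at hlim
  exact tendsto_of_tendsto_of_tendsto_of_le_of_le tendsto_const_nhds hlim
    (fun n => le_dyadicCeil n t) (fun n => dyadicCeil_le_add n t)

lemma measurable_eval_nat {α Ω E : Type*} [MeasurableSpace α] [MeasurableSpace Ω]
    [MeasurableSpace E] {g : ℕ → Ω → E} (hg : ∀ k, Measurable (g k)) {κ : α → ℕ}
    (hκ : Measurable κ) {π : α → Ω} (hπ : Measurable π) : Measurable fun a => g (κ a) (π a) :=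
  (measurable_from_prod_countable_left (f := fun q : Ω × ℕ => g q.2 q.1) hg).comp (hπ.prodMk hκ)

lemma measure_setOf_mem_eq_tsum {Ω ι : Type*} [MeasurableSpace Ω] [Countable ι]
    [MeasurableSpace ι] [MeasurableSingletonClass ι] (P : Measure Ω) {κ : Ω → ι}
    (hκ : Measurable κ) {D : ι → Set Ω} (hD : ∀ k, MeasurableSet (D k)) :
    P {ω | ω ∈ D (κ ω)} = ∑' k, P (κ ⁻¹' {k} ∩ D k) := by
  rw [← measure_iUnion
    (fun i j hij => Set.disjoint_left.2 fun ω hi hj => hij (hi.1.symm.trans hj.1))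
    fun k => (hκ (measurableSet_singleton k)).inter (hD k)]
  congr 1
  ext ω
  simp

section

variable {Ω Ω' E : Type*} [MeasurableSpace Ω] [MeasurableSpace Ω'] [TopologicalSpace E]
  [TopologicalSpace.PseudoMetrizableSpace E] [MeasurableSpace E] [BorelSpace E]

lemma tendsto_integral_map {P : Measure Ω} [IsFiniteMeasure P] {X : ℕ → Ω → E} {Y : Ω → E}
    (hX : ∀ n, Measurable (X n))
    (hY : ∀ ω, Filter.Tendsto (fun n => X n ω) Filter.atTop (nhds (Y ω)))
    (f : BoundedContinuousFunction E ℝ) :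
    Filter.Tendsto (fun n => ∫ x, f x ∂(P.map (X n))) Filter.atTop
      (nhds (∫ x, f x ∂(P.map Y))) := by
  have hYm : Measurable Y := measurable_of_tendsto_metrizable hX (tendsto_pi_nhds.2 hY)
  have hf : Measurable f := f.continuous.measurable
  simp only [integral_map (hX _).aemeasurable hf.aestronglyMeasurable,
    integral_map hYm.aemeasurable hf.aestronglyMeasurable]
  exact tendsto_integral_of_dominated_convergence (fun _ => ‖f‖)
    (fun n => (hf.comp (hX n)).aestronglyMeasurable) (integrable_const _)
    (fun n => Filter.Eventually.of_forall fun ω => f.norm_coe_le_norm _)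
    (Filter.Eventually.of_forall fun ω => (f.continuous.tendsto _).comp (hY ω))

lemma map_eq_map_of_tendsto {P : Measure Ω} {P' : Measure Ω'} [IsFiniteMeasure P]
    [IsFiniteMeasure P'] {X : ℕ → Ω → E} {X' : ℕ → Ω' → E} {Y : Ω → E} {Y' : Ω' → E}
    (hX : ∀ n, Measurable (X n)) (hX' : ∀ n, Measurable (X' n))
    (hY : ∀ ω, Filter.Tendsto (fun n => X n ω) Filter.atTop (nhds (Y ω)))
    (hY' : ∀ ω, Filter.Tendsto (fun n => X' n ω) Filter.atTop (nhds (Y' ω)))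
    (h : ∀ n, P.map (X n) = P'.map (X' n)) : P.map Y = P'.map Y' :=
  ext_of_forall_integral_eq_of_IsFiniteMeasure fun f =>
    tendsto_nhds_unique (tendsto_integral_map hX hY f)
      ((tendsto_integral_map hX' hY' f).congr fun n => by rw [h n])

end

/-- The first passage time of the level `x`. -/
def passage {Ω : Type*} (S : ℝ≥0 → Ω → ℝ≥0) (x : ℝ≥0) (ω : Ω) : ℝ≥0 := sInf {t | x ≤ S t ω}

/-- The values of a process at the first `k + 1` points of the dyadic grid of level `n`. -/
def gridPast {Ω : Type*} (S : ℝ≥0 → Ω → ℝ≥0) (n k : ℕ) (ω : Ω) (j : Fin (k + 1)) : ℝ≥0 :=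
  S (dyadic (n, j)) ω

lemma sum_gridIncr_add {Ω : Type*} {X : ℝ≥0 → Ω → ℝ≥0} {ω : Ω} (hX : Monotone fun t => X t ω)
    {n m N : ℕ} (hn : n ≤ N) (hm : m ≤ N) (k l : ℕ) :
    ∑ i ∈ Finset.range (l * 2 ^ (N - m)), gridIncr X N (k * 2 ^ (N - n) + i) ω
      = futureIncr X (dyadic (n, k)) (dyadic (m, l)) ω := by
  rw [futureIncr, dyadic_eq_dyadic_of_le hn, dyadic_eq_dyadic_of_le hm, dyadic_add,
    ← add_sum_gridIncr hX N, add_tsub_cancel_left]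

namespace IsRegularSubordinator

variable {Ω : Type*} [MeasurableSpace Ω] {P : Measure Ω} {β c : ℝ} {S : ℝ≥0 → Ω → ℝ≥0}

lemma tendsto_of_ge (hS : IsRegularSubordinator β c S P) (ω : Ω) {t : ℝ≥0} {u : ℕ → ℝ≥0}
    (hu : Filter.Tendsto u Filter.atTop (nhds t)) (htu : ∀ n, t ≤ u n) :
    Filter.Tendsto (fun n => S (u n) ω) Filter.atTop (nhds (S t ω)) :=
  (hS.rightCont ω t).tendsto.comp
    (tendsto_nhdsWithin_iff.2 ⟨hu, Filter.Eventually.of_forall htu⟩)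

lemma tendsto_apply_dyadicCeil (hS : IsRegularSubordinator β c S P) (ω : Ω) (t : ℝ≥0) :
    Filter.Tendsto (fun n => S (dyadicCeil n t) ω) Filter.atTop (nhds (S t ω)) :=
  hS.tendsto_of_ge ω (tendsto_dyadicCeil t) fun n => le_dyadicCeil n t

lemma passage_le_iff (hS : IsRegularSubordinator β c S P) {x t : ℝ≥0} {ω : Ω} :
    passage S x ω ≤ t ↔ x ≤ S t ω := by
  refine ⟨fun h => le_trans ?_ (hS.mono ω h), fun h => csInf_le' h⟩
  have hne : {t | x ≤ S t ω}.Nonempty := hS.unbounded ω x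
  obtain ⟨u, -, hu, hu'⟩ := exists_seq_tendsto_sInf hne (OrderBot.bddBelow _)
  exact ge_of_tendsto' (hS.tendsto_of_ge ω hu fun n => csInf_le' (hu' n)) hu'

lemma le_at_passage (hS : IsRegularSubordinator β c S P) (x : ℝ≥0) (ω : Ω) :
    x ≤ S (passage S x ω) ω := hS.passage_le_iff.1 le_rfl

lemma measurable_uncurry (hS : IsRegularSubordinator β c S P) :
    Measurable fun q : ℝ≥0 × Ω => S q.1 q.2 :=
  measurable_of_tendsto_metrizable
    (fun n => measurable_eval_nat (g := fun k => S (dyadic (n, k))) (fun _ => hS.measurable _)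
      ((measurable_dyadicIdx n).comp measurable_fst) measurable_snd)
    (tendsto_pi_nhds.2 fun q => hS.tendsto_apply_dyadicCeil q.2 q.1)

lemma measurable_at (hS : IsRegularSubordinator β c S P) {T : Ω → ℝ≥0} (hT : Measurable T) :
    Measurable fun ω => S (T ω) ω :=
  hS.measurable_uncurry.comp (hT.prodMk measurable_id)

lemma measurable_dyadicPath_futureIncr_at (hS : IsRegularSubordinator β c S P) {T : Ω → ℝ≥0}
    (hT : Measurable T) : Measurable fun ω => dyadicPath (futureIncr S (T ω)) ω :=
  measurable_pi_lambda _ fun _ => (hS.measurable_at (hT.add_const _)).sub (hS.measurable_at hT)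

lemma measurable_passage_uncurry (hS : IsRegularSubordinator β c S P) :
    Measurable fun q : ℝ≥0 × Ω => passage S q.1 q.2 := by
  refine measurable_of_Iic fun t => ?_
  have : (fun q : ℝ≥0 × Ω => passage S q.1 q.2) ⁻¹' Set.Iic t = {q | q.1 ≤ S t q.2} :=
    Set.ext fun q => hS.passage_le_iff
  rw [this]
  exact measurableSet_le measurable_fst ((hS.measurable t).comp measurable_snd)

lemma measurable_passage (hS : IsRegularSubordinator β c S P) (x : ℝ≥0) :
    Measurable (passage S x) :=
  hS.measurable_passage_uncurry.comp (measurable_const.prodMk measurable_id)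

lemma indepFun_gridPast_dyadicPath_futureIncr [IsProbabilityMeasure P]
    (hS : IsRegularSubordinator β c S P) (n k : ℕ) :
    IndepFun (gridPast S n k) (dyadicPath (futureIncr S (dyadic (n, k)))) P := by
  refine IndepFun.indepFun_process (measurable_pi_lambda _ fun j => hS.measurable _)
    (fun p => measurable_futureIncr hS.measurable _ _) fun I => ?_
  let N := max n (I.sup Prod.fst)
  let K := k * 2 ^ (N - n)
  have hnN : n ≤ N := le_max_left _ _
  let sigma (T : Set ℕ) : MeasurableSpace Ω := ⨆ i ∈ T, .comap (gridIncr S N i) inferInstance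
  have indep_sigma : Indep (sigma (Set.Iio K)) (sigma (Set.Ici K)) P :=
    indep_iSup_of_disjoint (fun i => (measurable_gridIncr hS.measurable N i).comap_le)
      (iIndepFun_gridIncr hS.indep N).iIndep (Set.Iio_disjoint_Ici le_rfl)
  have measurable_sigma {T : Set ℕ} {i : ℕ} (hi : i ∈ T) :
      Measurable[sigma T] (gridIncr S N i) :=
    (comap_measurable (gridIncr S N i)).mono
      (le_iSup₂ (f := fun i (_ : i ∈ T) => MeasurableSpace.comap (gridIncr S N i) inferInstance)
        i hi) le_rfl
  refine indep_of_indep_of_le indep_sigma (Measurable.comap_le ?_) (Measurable.comap_le ?_)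
  · refine @measurable_pi_lambda _ _ _ (_) _ _ fun j => ?_
    have hj : (j : ℕ) * 2 ^ (N - n) ≤ K := Nat.mul_le_mul_right _ (Nat.lt_succ_iff.1 j.2)
    simp only [gridPast, ← sum_gridIncr (hS.zero _) (hS.mono _) hnN]
    exact @Finset.measurable_fun_sum _ _ _ _ _ _ (_) _ _ fun i hi =>
      measurable_sigma ((Finset.mem_range.1 hi).trans_le hj)
  · refine @measurable_pi_lambda _ _ _ (_) _ _ fun p => ?_
    have hpN : p.1.1 ≤ N := (Finset.le_sup (f := Prod.fst) p.2).trans (le_max_right _ _)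
    have := @Finset.measurable_fun_sum _ _ _ _ _ _ (sigma (Set.Ici K)) _
      (Finset.range (p.1.2 * 2 ^ (N - p.1.1)))
      fun i _ => measurable_sigma (Set.mem_Ici.2 (Nat.le_add_right K i))
    simp only [K, sum_gridIncr_add (hS.mono _) hnN hpN] at this
    exact this

-- The hypothesis on `κ` says that `dyadic (n, κ)` is a stopping time of the process on the grid.
lemma map_prodMk_dyadicPath_futureIncr_of_stopping [IsProbabilityMeasure P]
    (hS : IsRegularSubordinator β c S P) (n : ℕ) {κ : Ω → ℕ}
    (hκ : ∀ k, MeasurableSet[.comap (gridPast S n k) inferInstance] (κ ⁻¹' {k})) :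
    P.map (fun ω => (S (dyadic (n, κ ω)) ω, dyadicPath (futureIncr S (dyadic (n, κ ω))) ω))
      = (P.map fun ω => S (dyadic (n, κ ω)) ω).prod (P.map (dyadicPath S)) := by
  have measurable_gridPast (k : ℕ) : Measurable (gridPast S n k) :=
    measurable_pi_lambda _ fun _ => hS.measurable _
  have measurable_κ : Measurable κ :=
    measurable_to_countable' fun k => (measurable_gridPast k).comap_le _ (hκ k)
  have measurable_T : Measurable fun ω => dyadic (n, κ ω) :=
    (measurable_from_top (f := fun k : ℕ => dyadic (n, k))).comp measurable_κ
  have measurable_value := hS.measurable_at measurable_T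
  have measurable_future (k : ℕ) : Measurable (dyadicPath (futureIncr S (dyadic (n, k)))) :=
    measurable_dyadicPath (measurable_futureIncr hS.measurable _)
  have := Measure.isProbabilityMeasure_map (μ := P) measurable_value.aemeasurable
  have := Measure.isProbabilityMeasure_map (μ := P)
    (measurable_dyadicPath hS.measurable).aemeasurable
  refine (Measure.prod_eq fun A B hA hB => ?_).symm
  rw [Measure.map_apply
    (measurable_value.prodMk (hS.measurable_dyadicPath_futureIncr_at measurable_T)) (hA.prod hB),
    Measure.map_apply measurable_value hA]
  refine (measure_setOf_mem_eq_tsum P measurable_κ (D := fun k => S (dyadic (n, k)) ⁻¹' A ∩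
    dyadicPath (futureIncr S (dyadic (n, k))) ⁻¹' B) fun k =>
    (hS.measurable _ hA).inter (measurable_future k hB)).trans ?_
  refine Eq.trans ?_ (congrArg (· * _) (measure_setOf_mem_eq_tsum P measurable_κ
    (D := fun k => S (dyadic (n, k)) ⁻¹' A) fun k => hS.measurable _ hA).symm)
  rw [← ENNReal.tsum_mul_right]
  refine tsum_congr fun k => ?_
  obtain ⟨C, hC, hCκ⟩ := hκ k
  have past_eq : κ ⁻¹' {k} ∩ S (dyadic (n, k)) ⁻¹' A
      = gridPast S n k ⁻¹' (C ∩ (fun w => w (Fin.last k)) ⁻¹' A) := by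
    rw [Set.preimage_inter, hCκ]
    rfl
  rw [← Set.inter_assoc, past_eq,
    (hS.indepFun_gridPast_dyadicPath_futureIncr n k).measure_inter_preimage_eq_mul _ _
      (hC.inter (measurable_pi_apply (Fin.last k) hA)) hB,
    ← hS.map_dyadicPath_futureIncr (dyadic (n, k)), Measure.map_apply (measurable_future k) hB]

lemma dyadicIdx_passage_eq_iff (hS : IsRegularSubordinator β c S P) {x : ℝ≥0} {ω : Ω} {n k : ℕ} :
    dyadicIdx n (passage S x ω) = k ↔
      x ≤ S (dyadic (n, k)) ω ∧ ∀ j < k, S (dyadic (n, j)) ω < x := by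
  have le_iff (j : ℕ) : dyadicIdx n (passage S x ω) ≤ j ↔ x ≤ S (dyadic (n, j)) ω :=
    dyadicIdx_le_iff.trans hS.passage_le_iff
  have lt_iff (j : ℕ) : j < dyadicIdx n (passage S x ω) ↔ S (dyadic (n, j)) ω < x := by
    rw [← not_le, le_iff, not_le]
  simp only [← le_iff, ← lt_iff]
  exact ⟨by rintro rfl; exact ⟨le_rfl, fun j hj => hj⟩,
    fun ⟨hle, hlt⟩ => hle.antisymm (not_lt.1 fun h => (hlt _ h).false)⟩

lemma measurableSet_comap_gridPast_dyadicIdx_passage (hS : IsRegularSubordinator β c S P)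
    (x : ℝ≥0) (n k : ℕ) :
    MeasurableSet[.comap (gridPast S n k) inferInstance]
      ((fun ω => dyadicIdx n (passage S x ω)) ⁻¹' {k}) := by
  refine ⟨{w | x ≤ w (Fin.last k)} ∩ ⋂ j : Fin k, {w | w j.castSucc < x}, ?_, ?_⟩
  · exact (measurableSet_le measurable_const (measurable_pi_apply _)).inter
      (.iInter fun j => measurableSet_lt (measurable_pi_apply _) measurable_const)
  · ext ω
    simp [hS.dyadicIdx_passage_eq_iff, gridPast, Fin.forall_iff]

lemma map_prodMk_dyadicPath_futureIncr_passage [IsProbabilityMeasure P]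
    (hS : IsRegularSubordinator β c S P) (x : ℝ≥0) :
    P.map (fun ω => (S (passage S x ω) ω, dyadicPath (futureIncr S (passage S x ω)) ω))
      = (P.map fun ω => S (passage S x ω) ω).prod (P.map (dyadicPath S)) := by
  have measurable_τ := hS.measurable_passage x
  have measurable_τn (n : ℕ) := (measurable_dyadicCeil n).comp measurable_τ
  have measurable_path := measurable_dyadicPath hS.measurable
  have tendsto_value (ω : Ω) := hS.tendsto_apply_dyadicCeil ω (passage S x ω)
  have tendsto_future (ω : Ω) (t : ℝ≥0) : Filter.Tendsto
      (fun n => futureIncr S (dyadicCeil n (passage S x ω)) t ω) Filter.atTop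
      (nhds (futureIncr S (passage S x ω) t ω)) :=
    (hS.tendsto_of_ge ω ((tendsto_dyadicCeil _).add_const t)
      fun n => by gcongr; exact le_dyadicCeil n _).sub (tendsto_value ω)
  rw [Measure.map_prod_map _ _ (hS.measurable_at measurable_τ) measurable_path]
  refine map_eq_map_of_tendsto (fun n => (hS.measurable_at (measurable_τn n)).prodMk
      (hS.measurable_dyadicPath_futureIncr_at (measurable_τn n)))
    (fun n => (hS.measurable_at (measurable_τn n)).prodMap measurable_path)
    (fun ω => (tendsto_value ω).prodMk_nhds (tendsto_pi_nhds.2 fun p => tendsto_future ω _))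
    (fun q => (tendsto_value q.1).prodMk_nhds tendsto_const_nhds) fun n => ?_
  rw [← Measure.map_prod_map _ _ (hS.measurable_at (measurable_τn n)) measurable_path]
  exact hS.map_prodMk_dyadicPath_futureIncr_of_stopping n
    (hS.measurableSet_comap_gridPast_dyadicIdx_passage x n)

end IsRegularSubordinator

/-! ### Lebesgue measure and power densities on `[0, ∞)` -/

section PowerMeasure

instance : SFinite lebesgueNNReal := by
  unfold lebesgueNNReal
  infer_instance

variable {f : ℝ≥0 → ℝ≥0∞}

lemma setLIntegral_lebesgueNNReal_Ici (hf : Measurable f) (s : ℝ≥0) :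
    ∫⁻ t in Set.Ici s, f t ∂lebesgueNNReal = ∫⁻ x in Set.Ioi (s : ℝ), f x.toNNReal := by
  have hpre : Real.toNNReal ⁻¹' Set.Ici s ∩ Set.Ici 0 = Set.Ici (s : ℝ) := by
    ext x
    simp only [Set.mem_inter_iff, Set.mem_preimage, Set.mem_Ici]
    exact ⟨fun h => (Real.le_toNNReal_iff_coe_le h.2).1 h.1,
      fun h => ⟨NNReal.le_toNNReal_of_coe_le h, s.coe_nonneg.trans h⟩⟩
  rw [lebesgueNNReal, setLIntegral_map measurableSet_Ici hf measurable_real_toNNReal,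
    Measure.restrict_restrict (measurable_real_toNNReal measurableSet_Ici), hpre]
  exact setLIntegral_congr Ioi_ae_eq_Ici.symm

lemma lintegral_lebesgueNNReal (hf : Measurable f) :
    ∫⁻ t, f t ∂lebesgueNNReal = ∫⁻ x in Set.Ioi (0 : ℝ), f x.toNNReal := by
  have h := setLIntegral_lebesgueNNReal_Ici hf 0
  rwa [← bot_eq_zero, Set.Ici_bot, Measure.restrict_univ, bot_eq_zero, NNReal.coe_zero] at h

lemma lintegral_lebesgueNNReal_add (hf : Measurable f) (s : ℝ≥0) :
    ∫⁻ t, f (s + t) ∂lebesgueNNReal = ∫⁻ t in Set.Ici s, f t ∂lebesgueNNReal := by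
  rw [lintegral_lebesgueNNReal (f := fun t => f (s + t)) (by fun_prop),
    setLIntegral_lebesgueNNReal_Ici hf, ← (measurePreserving_add_left volume
      (s : ℝ)).setLIntegral_comp_preimage (s := Set.Ioi (s : ℝ)) measurableSet_Ioi (by fun_prop)]
  have hpre : (fun x : ℝ => (s : ℝ) + x) ⁻¹' Set.Ioi (s : ℝ) = Set.Ioi 0 := by
    ext x
    simp
  rw [hpre]
  refine setLIntegral_congr_fun measurableSet_Ioi fun x (hx : 0 < x) => ?_
  rw [Real.toNNReal_add s.coe_nonneg hx.le, Real.toNNReal_coe]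

lemma lintegral_lebesgueNNReal_mul (hf : Measurable f) {a : ℝ≥0} (ha : 0 < a) :
    ∫⁻ t, f (a * t) ∂lebesgueNNReal = (a⁻¹ : ℝ≥0) * ∫⁻ t, f t ∂lebesgueNNReal := by
  have ha' : (0 : ℝ) < a := ha
  have hpre : (fun x : ℝ => (a : ℝ) * x) ⁻¹' Set.Ioi 0 = Set.Ioi 0 := by
    ext x
    simp [ha']
  calc ∫⁻ t, f (a * t) ∂lebesgueNNReal
      = ∫⁻ x in Set.Ioi (0 : ℝ), f ((a : ℝ) * x).toNNReal := by
        simp only [lintegral_lebesgueNNReal (f := fun t => f (a * t)) (by fun_prop),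
          Real.toNNReal_mul a.coe_nonneg, Real.toNNReal_coe]
    _ = ∫⁻ x in Set.Ioi (0 : ℝ), f x.toNNReal ∂(volume.map fun x : ℝ => (a : ℝ) * x) := by
        rw [setLIntegral_map measurableSet_Ioi (by fun_prop) (by fun_prop), hpre]
    _ = (a⁻¹ : ℝ≥0) * ∫⁻ t, f t ∂lebesgueNNReal := by
        rw [Real.map_volume_mul_left ha'.ne', Measure.restrict_smul, lintegral_smul_measure,
          smul_eq_mul, abs_of_pos (inv_pos.2 ha'), ← NNReal.coe_inv, ENNReal.ofReal_coe_nnreal,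
          lintegral_lebesgueNNReal hf]

/-- The measure with density `K x ^ r` with respect to Lebesgue measure on `[0, ∞)`. Both the
weights (`r = -(1 + α)`) and the delays (`r = -β`) of the Poisson process have such intensities. -/
def powerMeasure (K r : ℝ) : Measure ℝ≥0 :=
  lebesgueNNReal.withDensity fun x => ENNReal.ofReal (K * (x : ℝ) ^ r)

instance (K r : ℝ) : SFinite (powerMeasure K r) := by
  unfold powerMeasure
  infer_instance

lemma lintegral_powerMeasure (K r : ℝ) (hf : Measurable f) :
    ∫⁻ x, f x ∂powerMeasure K r
      = ∫⁻ x, ENNReal.ofReal (K * (x : ℝ) ^ r) * f x ∂lebesgueNNReal :=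
  lintegral_withDensity_eq_lintegral_mul _ (by fun_prop) hf

lemma map_mul_powerMeasure (K r : ℝ) {a : ℝ≥0} (ha : 0 < a) :
    (powerMeasure K r).map (fun x => a * x) = (a ^ (-(r + 1)) : ℝ≥0) • powerMeasure K r := by
  refine Measure.ext_of_lintegral _ fun f hf => ?_
  have ha' : (0 : ℝ) < a := ha
  have hdensity (x : ℝ≥0) : ((a⁻¹ : ℝ≥0) : ℝ≥0∞) *
        ENNReal.ofReal (K * ((a⁻¹ * x : ℝ≥0) : ℝ) ^ r)
      = ((a ^ (-(r + 1)) : ℝ≥0) : ℝ≥0∞) * ENNReal.ofReal (K * (x : ℝ) ^ r) := by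
    rw [← ENNReal.ofReal_coe_nnreal, ← ENNReal.ofReal_coe_nnreal,
      ← ENNReal.ofReal_mul NNReal.zero_le_coe, ← ENNReal.ofReal_mul NNReal.zero_le_coe]
    simp only [NNReal.coe_mul, NNReal.coe_inv, NNReal.coe_rpow]
    rw [Real.mul_rpow (inv_nonneg.2 ha'.le) x.coe_nonneg, Real.inv_rpow ha'.le, neg_add,
      Real.rpow_add ha', Real.rpow_neg ha'.le, Real.rpow_neg ha'.le, Real.rpow_one]
    ring_nf
  have hsubst := lintegral_lebesgueNNReal_mul
    (f := fun x => ENNReal.ofReal (K * ((a⁻¹ * x : ℝ≥0) : ℝ) ^ r) * f x) (by fun_prop) ha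
  simp only [inv_mul_cancel_left₀ ha.ne'] at hsubst
  rw [lintegral_map hf (by fun_prop), lintegral_powerMeasure K r (by fun_prop), hsubst,
    lintegral_smul_measure, lintegral_powerMeasure K r hf, ENNReal.smul_def, smul_eq_mul,
    ← lintegral_const_mul _ (by fun_prop), ← lintegral_const_mul _ (by fun_prop)]
  simp only [← mul_assoc, hdensity]

lemma laplaceTransform_powerMeasure {K r : ℝ} (hK : 0 ≤ K) (hr : -1 < r) {θ : ℝ≥0} (hθ : 0 < θ) :
    laplaceTransform (powerMeasure K r) θ
      = ENNReal.ofReal (K * ((1 / (θ : ℝ)) ^ (r + 1) * Real.Gamma (r + 1))) := by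
  have hgamma := Real.integral_rpow_mul_exp_neg_mul_Ioi (a := r + 1) (r := θ) (by linarith) hθ
  have hintegrable : IntegrableOn (fun x : ℝ => x ^ r * Real.exp (-(θ * x))) (Set.Ioi 0) := by
    simpa using integrableOn_rpow_mul_exp_neg_mul_rpow (s := r) (p := 1) (b := θ) hr one_pos hθ
  rw [add_sub_cancel_right] at hgamma
  rw [laplaceTransform, lintegral_powerMeasure K r (measurable_laplaceKernel θ),
    lintegral_lebesgueNNReal (by fun_prop), ← hgamma, ← integral_const_mul,
    ofReal_integral_eq_lintegral_ofReal (hintegrable.const_mul K)]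
  · refine setLIntegral_congr_fun measurableSet_Ioi fun x (hx : 0 < x) => ?_
    rw [laplaceKernel, Real.coe_toNNReal _ hx.le, ← ENNReal.ofReal_mul (by positivity), mul_assoc]
  · filter_upwards [ae_restrict_mem measurableSet_Ioi] with x (hx : 0 < x)
    exact mul_nonneg hK (by positivity)

lemma laplaceTransform_lebesgueNNReal {θ : ℝ≥0} (hθ : 0 < θ) :
    laplaceTransform lebesgueNNReal θ = ENNReal.ofReal (1 / (θ : ℝ)) := by
  have hpower : powerMeasure 1 0 = lebesgueNNReal := by simp [powerMeasure]
  rw [← hpower, laplaceTransform_powerMeasure zero_le_one (by norm_num) hθ]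
  simp

lemma powerMeasure_Iic_one_ne_top {K r : ℝ} (hK : 0 ≤ K) (hr : -1 < r) :
    powerMeasure K r (Set.Iic 1) ≠ ∞ := by
  have hchernoff := laplaceKernel_mul_measure_le_laplaceTransform (P := powerMeasure K r)
    measurable_id 1 1
  rw [Measure.map_id, laplaceTransform_powerMeasure hK hr one_pos] at hchernoff
  exact (ENNReal.lt_top_of_mul_ne_top_right (ne_top_of_le_ne_top ENNReal.ofReal_ne_top hchernoff)
    (laplaceKernel_ne_zero 1 1)).ne

lemma powerMeasure_Iic {K r : ℝ} {x : ℝ≥0} (hx : 0 < x) :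
    powerMeasure K r (Set.Iic x) = (x ^ (r + 1) : ℝ≥0) * powerMeasure K r (Set.Iic 1) := by
  have hpre : (fun y : ℝ≥0 => x⁻¹ * y) ⁻¹' Set.Iic 1 = Set.Iic x := by
    ext y
    simp only [Set.mem_preimage, Set.mem_Iic]
    rw [inv_mul_le_iff₀ hx, mul_one]
  have hmap := congrArg (fun μ => μ (Set.Iic 1))
    (map_mul_powerMeasure K r (a := x⁻¹) (by positivity))
  rwa [Measure.map_apply (by fun_prop) measurableSet_Iic, hpre, Measure.smul_apply,
    ENNReal.smul_def, smul_eq_mul, NNReal.rpow_neg, NNReal.inv_rpow, inv_inv] at hmap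

lemma powerMeasure_Ioi_ne_top {K r : ℝ} (hr : r < -1) {x : ℝ≥0} (hx : 0 < x) :
    powerMeasure K r (Set.Ioi x) ≠ ∞ := by
  have hintegrable : IntegrableOn (fun y : ℝ => K * y ^ r) (Set.Ioi (x : ℝ)) :=
    (integrableOn_Ioi_rpow_of_lt hr hx).const_mul K
  refine ne_top_of_le_ne_top hintegrable.lintegral_lt_top.ne
    ((measure_mono Set.Ioi_subset_Ici_self).trans_eq ?_)
  rw [powerMeasure, withDensity_apply _ measurableSet_Ici,
    setLIntegral_lebesgueNNReal_Ici (by fun_prop)]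
  refine setLIntegral_congr_fun measurableSet_Ioi fun y (hy : (x : ℝ) < y) => ?_
  rw [Real.coe_toNNReal _ (x.coe_nonneg.trans hy.le)]

end PowerMeasure

/-! ### The stationary overshoot -/

/-- The potential `∫ exp (-θ w_t) dt` of a right-continuous path, as a measurable functional of its
values `w` along the dyadic numbers. -/
def dyadicPotential (θ : ℝ≥0) (w : ℕ × ℕ → ℝ≥0) : ℝ≥0∞ :=
  ∫⁻ t, Filter.liminf (fun n => laplaceKernel θ (w (n, dyadicIdx n t))) Filter.atTop
    ∂lebesgueNNReal

lemma measurable_dyadicPotential (θ : ℝ≥0) : Measurable (dyadicPotential θ) := by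
  refine Measurable.lintegral_prod_right' (f := fun q : (ℕ × ℕ → ℝ≥0) × ℝ≥0 =>
    Filter.liminf (fun n => laplaceKernel θ (q.1 (n, dyadicIdx n q.2))) Filter.atTop) ?_
  refine Measurable.liminf fun n => (measurable_laplaceKernel θ).comp ?_
  exact measurable_eval_nat (g := fun k (w : ℕ × ℕ → ℝ≥0) => w (n, k))
    (fun k => measurable_pi_apply _) ((measurable_dyadicIdx n).comp measurable_snd) measurable_fst

lemma continuous_laplaceKernel (θ : ℝ≥0) : Continuous (laplaceKernel θ) :=
  ENNReal.continuous_ofReal.comp (by fun_prop)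

lemma dyadicPotential_dyadicPath {Ω : Type*} (θ : ℝ≥0) {X : ℝ≥0 → Ω → ℝ≥0} {ω : Ω}
    (hX : ∀ t, Filter.Tendsto (fun n => X (dyadicCeil n t) ω) Filter.atTop (nhds (X t ω))) :
    dyadicPotential θ (dyadicPath X ω) = ∫⁻ t, laplaceKernel θ (X t ω) ∂lebesgueNNReal :=
  lintegral_congr fun t =>
    (((continuous_laplaceKernel θ).tendsto _).comp (hX t)).liminf_eq

/-- The overshoot over the level `b` of the process `v + S`, as a function of the pair `(v, ω)`. -/
def overshoot {Ω : Type*} (S : ℝ≥0 → Ω → ℝ≥0) (b : ℝ≥0) (q : ℝ≥0 × Ω) : ℝ≥0 :=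
  q.1 + S (passage S (b - q.1) q.2) q.2 - b

lemma laplaceTransform_powerMeasure_mul_ofReal {β c : ℝ} (hc : 0 < c) (hβ1 : β < 1) {θ : ℝ≥0}
    (hθ : 0 < θ) :
    laplaceTransform (powerMeasure (1 - β) (-β)) θ * ENNReal.ofReal (1 / (c * (θ : ℝ) ^ β))
      = ENNReal.ofReal ((1 - β) * Real.Gamma (1 - β) / c) * laplaceTransform lebesgueNNReal θ := by
  have hθ' : (0 : ℝ) < θ := hθ
  have hβ' : 0 < 1 - β := sub_pos.2 hβ1
  have : 0 < Real.Gamma (1 - β) := Real.Gamma_pos_of_pos hβ'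
  have hθβ : (θ : ℝ) ^ β ≠ 0 := (Real.rpow_pos_of_pos hθ' _).ne'
  rw [laplaceTransform_powerMeasure hβ'.le (by linarith) hθ, laplaceTransform_lebesgueNNReal hθ,
    neg_add_eq_sub, ← ENNReal.ofReal_mul (by positivity), ← ENNReal.ofReal_mul (by positivity),
    one_div (θ : ℝ), Real.inv_rpow hθ'.le, Real.rpow_sub hθ', Real.rpow_one]
  congr 1
  field_simp

namespace IsRegularSubordinator

variable {Ω : Type*} [MeasurableSpace Ω] {P : Measure Ω} {β c : ℝ} {S : ℝ≥0 → Ω → ℝ≥0}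

lemma le_add_passage (hS : IsRegularSubordinator β c S P) (b v : ℝ≥0) (ω : Ω) :
    b ≤ v + S (passage S (b - v) ω) ω := tsub_le_iff_left.1 (hS.le_at_passage _ _)

lemma measurable_passage_delay (hS : IsRegularSubordinator β c S P) (b : ℝ≥0) :
    Measurable fun q : ℝ≥0 × Ω => passage S (b - q.1) q.2 :=
  hS.measurable_passage_uncurry.comp ((measurable_fst.const_sub b).prodMk measurable_snd)

lemma measurable_overshoot (hS : IsRegularSubordinator β c S P) (b : ℝ≥0) :
    Measurable (overshoot S b) :=
  (measurable_fst.add (hS.measurable_uncurry.comp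
    ((hS.measurable_passage_delay b).prodMk measurable_snd))).sub_const b

lemma measurable_dyadicPath_futureIncr_passage_delay (hS : IsRegularSubordinator β c S P)
    (b : ℝ≥0) : Measurable fun q : ℝ≥0 × Ω =>
      dyadicPath (futureIncr S (passage S (b - q.1) q.2)) q.2 :=
  measurable_pi_lambda _ fun _ =>
    (hS.measurable_uncurry.comp
      (((hS.measurable_passage_delay b).add_const _).prodMk measurable_snd)).sub
    (hS.measurable_uncurry.comp ((hS.measurable_passage_delay b).prodMk measurable_snd))

lemma measurable_path (hS : IsRegularSubordinator β c S P) (ω : Ω) : Measurable fun t => S t ω :=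
  hS.measurable_uncurry.comp measurable_prodMk_right

lemma measurable_delay_add (hS : IsRegularSubordinator β c S P) :
    Measurable fun q : (ℝ≥0 × Ω) × ℝ≥0 => q.1.1 + S q.2 q.1.2 :=
  (measurable_fst.comp measurable_fst).add
    (hS.measurable_uncurry.comp (measurable_snd.prodMk (measurable_snd.comp measurable_fst)))

lemma lintegral_lintegral_laplaceKernel [SFinite P] (hS : IsRegularSubordinator β c S P)
    (hc : 0 < c) {θ : ℝ≥0} (hθ : 0 < θ) :
    ∫⁻ ω, ∫⁻ t, laplaceKernel θ (S t ω) ∂lebesgueNNReal ∂P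
      = ENNReal.ofReal (1 / (c * (θ : ℝ) ^ β)) := by
  have : (0 : ℝ) < θ := hθ
  have hrate : 0 < c * (θ : ℝ) ^ β := by positivity
  have laplace_at (t : ℝ≥0) : ∫⁻ ω, laplaceKernel θ (S t ω) ∂P
      = laplaceKernel (c * (θ : ℝ) ^ β).toNNReal t := by
    rw [← laplaceTransform_map (hS.measurable t), hS.laplace_map, laplaceKernel,
      Real.coe_toNNReal _ hrate.le, mul_right_comm]
  rw [lintegral_lintegral_swap (f := fun ω t => laplaceKernel θ (S t ω))
    ((measurable_laplaceKernel θ).comp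
      (hS.measurable_uncurry.comp measurable_swap)).aemeasurable]
  simp only [laplace_at]
  rw [← laplaceTransform, laplaceTransform_lebesgueNNReal (Real.toNNReal_pos.2 hrate),
    Real.coe_toNNReal _ hrate.le]

lemma laplaceTransform_map_delay_add [SFinite P] (hS : IsRegularSubordinator β c S P) (hc : 0 < c)
    (ν : Measure ℝ≥0) [SFinite ν] {θ : ℝ≥0} (hθ : 0 < θ) :
    laplaceTransform (((ν.prod P).prod lebesgueNNReal).map fun q => q.1.1 + S q.2 q.1.2) θ
      = laplaceTransform ν θ * ENNReal.ofReal (1 / (c * (θ : ℝ) ^ β)) := by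
  have measurable_kernel : Measurable fun q : (ℝ≥0 × Ω) × ℝ≥0 =>
      laplaceKernel θ (q.1.1 + S q.2 q.1.2) :=
    (measurable_laplaceKernel θ).comp hS.measurable_delay_add
  have measurable_potential : Measurable fun ω =>
      ∫⁻ t, laplaceKernel θ (S t ω) ∂lebesgueNNReal :=
    ((measurable_laplaceKernel θ).comp
      (hS.measurable_uncurry.comp measurable_swap)).lintegral_prod_right'
  rw [laplaceTransform_map hS.measurable_delay_add, lintegral_prod _ measurable_kernel.aemeasurable]
  simp only [laplaceKernel_add_right]
  calc ∫⁻ q : ℝ≥0 × Ω, ∫⁻ t, laplaceKernel θ q.1 * laplaceKernel θ (S t q.2) ∂lebesgueNNReal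
        ∂ν.prod P
      = ∫⁻ q : ℝ≥0 × Ω, laplaceKernel θ q.1 * ∫⁻ t, laplaceKernel θ (S t q.2) ∂lebesgueNNReal
        ∂ν.prod P := lintegral_congr fun q => lintegral_const_mul _
          ((measurable_laplaceKernel θ).comp (hS.measurable_path q.2))
    _ = laplaceTransform ν θ * ENNReal.ofReal (1 / (c * (θ : ℝ) ^ β)) := by
      rw [lintegral_prod_mul (measurable_laplaceKernel θ).aemeasurable
        measurable_potential.aemeasurable, hS.lintegral_lintegral_laplaceKernel hc hθ,
        ← laplaceTransform]

lemma map_delay_add [SFinite P] (hS : IsRegularSubordinator β c S P) (hc : 0 < c) (hβ1 : β < 1) :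
    (((powerMeasure (1 - β) (-β)).prod P).prod lebesgueNNReal).map
        (fun q : (ℝ≥0 × Ω) × ℝ≥0 => q.1.1 + S q.2 q.1.2)
      = ENNReal.ofReal ((1 - β) * Real.Gamma (1 - β) / c) • lebesgueNNReal := by
  refine ext_of_laplaceTransform (fun θ hθ => ?_) (fun θ hθ => ?_)
  · rw [hS.laplaceTransform_map_delay_add hc _ hθ,
      laplaceTransform_powerMeasure (by linarith) (by linarith) hθ]
    exact ENNReal.mul_ne_top ENNReal.ofReal_ne_top ENNReal.ofReal_ne_top
  · rw [hS.laplaceTransform_map_delay_add hc _ hθ,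
      laplaceTransform_powerMeasure_mul_ofReal hc hβ1 hθ, laplaceTransform, laplaceTransform,
      lintegral_smul_measure, smul_eq_mul]

lemma tendsto_futureIncr_dyadicCeil (hS : IsRegularSubordinator β c S P) (s t : ℝ≥0) (ω : Ω) :
    Filter.Tendsto (fun n => futureIncr S s (dyadicCeil n t) ω) Filter.atTop
      (nhds (futureIncr S s t ω)) :=
  (hS.tendsto_of_ge ω ((tendsto_dyadicCeil t).const_add s)
    fun n => by gcongr; exact le_dyadicCeil n t).sub_const _

lemma dyadicPotential_dyadicPath_futureIncr (hS : IsRegularSubordinator β c S P) (θ s : ℝ≥0)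
    (ω : Ω) : dyadicPotential θ (dyadicPath (futureIncr S s) ω)
      = ∫⁻ t, laplaceKernel θ (S (s + t) ω - S s ω) ∂lebesgueNNReal :=
  dyadicPotential_dyadicPath θ fun t => hS.tendsto_futureIncr_dyadicCeil s t ω

-- `v + S` is at least `b` exactly from the passage time on.
lemma laplaceKernel_overshoot_mul_dyadicPotential (hS : IsRegularSubordinator β c S P)
    (θ b v : ℝ≥0) (ω : Ω) :
    laplaceKernel θ (overshoot S b (v, ω)) *
        dyadicPotential θ (dyadicPath (futureIncr S (passage S (b - v) ω)) ω)
      = ∫⁻ t, (Set.Ici b).indicator (fun y => laplaceKernel θ (y - b)) (v + S t ω)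
        ∂lebesgueNNReal := by
  set τ := passage S (b - v) ω with hτ
  have measurable_path := hS.measurable_path ω
  have hpre : (fun t => v + S t ω) ⁻¹' Set.Ici b = Set.Ici τ := by
    ext t
    rw [Set.mem_preimage, Set.mem_Ici, Set.mem_Ici, hτ, hS.passage_le_iff, tsub_le_iff_left]
  have split (t : ℝ≥0) : v + S (τ + t) ω - b
      = overshoot S b (v, ω) + (S (τ + t) ω - S τ ω) := by
    rw [overshoot, ← hτ, tsub_add_eq_add_tsub (hS.le_add_passage b v ω), add_assoc,
      add_tsub_cancel_of_le (hS.mono ω le_self_add)]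
  calc laplaceKernel θ (overshoot S b (v, ω)) * dyadicPotential θ (dyadicPath (futureIncr S τ) ω)
      = ∫⁻ t, laplaceKernel θ (v + S (τ + t) ω - b) ∂lebesgueNNReal := by
        simp only [split, laplaceKernel_add_right]
        rw [hS.dyadicPotential_dyadicPath_futureIncr, lintegral_const_mul _ (by fun_prop)]
    _ = ∫⁻ t in Set.Ici τ, laplaceKernel θ (v + S t ω - b) ∂lebesgueNNReal :=
        lintegral_lebesgueNNReal_add (f := fun t => laplaceKernel θ (v + S t ω - b))
          (by fun_prop) τ
    _ = ∫⁻ t, (Set.Ici b).indicator (fun y => laplaceKernel θ (y - b)) (v + S t ω)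
        ∂lebesgueNNReal := by
        rw [← lintegral_indicator measurableSet_Ici, ← hpre]
        rfl

lemma map_prodMk_overshoot_dyadicPath [IsProbabilityMeasure P]
    (hS : IsRegularSubordinator β c S P) (ν : Measure ℝ≥0) [SFinite ν] (b : ℝ≥0) :
    (ν.prod P).map (fun q => (overshoot S b q,
        dyadicPath (futureIncr S (passage S (b - q.1) q.2)) q.2))
      = ((ν.prod P).map (overshoot S b)).prod (P.map (dyadicPath S)) := by
  refine Measure.ext_of_lintegral _ fun f hf => ?_
  have measurable_pair := (hS.measurable_overshoot b).prodMk
    (hS.measurable_dyadicPath_futureIncr_passage_delay b)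
  have measurable_section : Measurable fun x => ∫⁻ w, f (x, w) ∂P.map (dyadicPath S) :=
    hf.lintegral_prod_right'
  rw [lintegral_map hf measurable_pair, lintegral_prod _ hf.aemeasurable,
    lintegral_map measurable_section (hS.measurable_overshoot b),
    lintegral_prod _ (by exact (hf.comp measurable_pair).aemeasurable),
    lintegral_prod _ (by exact (measurable_section.comp (hS.measurable_overshoot b)).aemeasurable)]
  refine lintegral_congr fun v => ?_
  have measurable_τ := hS.measurable_passage (b - v)
  have measurable_value := hS.measurable_at measurable_τ
  have measurable_fv : Measurable fun z : ℝ≥0 × (ℕ × ℕ → ℝ≥0) => f (v + z.1 - b, z.2) := by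
    fun_prop
  have strong_markov := congrArg (fun μ => ∫⁻ z, f (v + z.1 - b, z.2) ∂μ)
    (hS.map_prodMk_dyadicPath_futureIncr_passage (b - v))
  rwa [lintegral_map measurable_fv
      (measurable_value.prodMk (hS.measurable_dyadicPath_futureIncr_at measurable_τ)),
    lintegral_prod _ measurable_fv.aemeasurable,
    lintegral_map measurable_fv.lintegral_prod_right' measurable_value] at strong_markov

lemma laplaceTransform_map_overshoot_mul [IsProbabilityMeasure P]
    (hS : IsRegularSubordinator β c S P) (hc : 0 < c) (ν : Measure ℝ≥0) [SFinite ν] (b : ℝ≥0)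
    {θ : ℝ≥0} (hθ : 0 < θ) :
    laplaceTransform ((ν.prod P).map (overshoot S b)) θ * ENNReal.ofReal (1 / (c * (θ : ℝ) ^ β))
      = ∫⁻ y in Set.Ici b, laplaceKernel θ (y - b)
        ∂(((ν.prod P).prod lebesgueNNReal).map fun q => q.1.1 + S q.2 q.1.2) := by
  have measurable_kernel : Measurable ((Set.Ici b).indicator fun y => laplaceKernel θ (y - b)) :=
    Measurable.indicator (by fun_prop) measurableSet_Ici
  have measurable_potential := measurable_dyadicPotential θ
  have potential_eq : ∫⁻ w, dyadicPotential θ w ∂P.map (dyadicPath S)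
      = ENNReal.ofReal (1 / (c * (θ : ℝ) ^ β)) := by
    rw [lintegral_map measurable_potential (measurable_dyadicPath hS.measurable),
      ← hS.lintegral_lintegral_laplaceKernel hc hθ]
    exact lintegral_congr fun ω => dyadicPotential_dyadicPath θ (hS.tendsto_apply_dyadicCeil ω)
  rw [← potential_eq, laplaceTransform, ← lintegral_prod_mul
      (measurable_laplaceKernel θ).aemeasurable measurable_potential.aemeasurable,
    ← hS.map_prodMk_overshoot_dyadicPath, lintegral_map (by fun_prop)
      ((hS.measurable_overshoot b).prodMk (hS.measurable_dyadicPath_futureIncr_passage_delay b)),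
    ← lintegral_indicator measurableSet_Ici,
    lintegral_map measurable_kernel hS.measurable_delay_add,
    lintegral_prod (μ := ν.prod P) _
      (by exact (measurable_kernel.comp hS.measurable_delay_add).aemeasurable)]
  exact lintegral_congr fun q => hS.laplaceKernel_overshoot_mul_dyadicPotential θ b q.1 q.2

lemma map_overshoot [IsProbabilityMeasure P] (hS : IsRegularSubordinator β c S P) (hc : 0 < c)
    (hβ1 : β < 1) (b : ℝ≥0) :
    ((powerMeasure (1 - β) (-β)).prod P).map (overshoot S b) = powerMeasure (1 - β) (-β) := by
  symm
  refine ext_of_laplaceTransform (fun θ hθ => ?_) (fun θ hθ => ?_)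
  · rw [laplaceTransform_powerMeasure (by linarith) (by linarith) hθ]
    exact ENNReal.ofReal_ne_top
  have : (0 : ℝ) < θ := hθ
  refine (ENNReal.mul_left_inj (ENNReal.ofReal_pos.2 (by positivity)).ne'
    ENNReal.ofReal_ne_top).1 ((laplaceTransform_powerMeasure_mul_ofReal hc hβ1 hθ).trans ?_)
  rw [hS.laplaceTransform_map_overshoot_mul hc _ b hθ, hS.map_delay_add hc hβ1,
    Measure.restrict_smul, lintegral_smul_measure, smul_eq_mul,
    ← lintegral_lebesgueNNReal_add (by fun_prop), laplaceTransform]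
  simp only [add_tsub_cancel_left]

end IsRegularSubordinator

/-! ### The stationary law of shifted stable regenerative sets -/

lemma preimage_add_closure {b : ℝ≥0} {A : Set ℝ≥0} (hb : b ∉ closure A) :
    (fun t => t + b) ⁻¹' closure A = closure ((fun t => t + b) ⁻¹' A) := by
  have isClosedEmbedding_add : Topology.IsClosedEmbedding fun t : ℝ≥0 => t + b :=
    (isometry_iff_dist_eq.2 fun x y => by simp [NNReal.dist_eq]).isClosedEmbedding
  refine Set.Subset.antisymm (fun t ht => ?_)
    (closure_minimal (Set.preimage_mono subset_closure)
      (isClosed_closure.preimage (by fun_prop)))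
  have hbt : b < t + b := lt_of_le_of_ne le_add_self fun h => hb (h ▸ ht)
  rw [isClosedEmbedding_add.isInducing.closure_eq_preimage_closure_image, Set.mem_preimage]
  refine closure_mono ?_ (isOpen_Ioi.inter_closure ⟨hbt, ht⟩)
  rintro x ⟨hbx : b < x, hxA⟩
  exact ⟨x - b, by rwa [Set.mem_preimage, tsub_add_cancel_of_le hbx.le],
    tsub_add_cancel_of_le hbx.le⟩

lemma tendsto_powerMeasure_Iic {K r : ℝ} (hK : 0 ≤ K) (hr : -1 < r) :
    Filter.Tendsto (fun x => powerMeasure K r (Set.Iic x)) (nhdsWithin 0 (Set.Ioi 0)) (nhds 0) := by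
  have hr' : 0 < r + 1 := by linarith
  have hpow : Filter.Tendsto (fun x : ℝ≥0 => ((x ^ (r + 1) : ℝ≥0) : ℝ≥0∞)) (nhds 0) (nhds 0) := by
    refine ENNReal.tendsto_coe.2 ?_
    simpa only [NNReal.zero_rpow hr'.ne'] using (NNReal.continuous_rpow_const hr'.le).tendsto 0
  have hmul := ENNReal.Tendsto.mul_const (hpow.mono_left (nhdsWithin_le_nhds (s := Set.Ioi 0)))
    (Or.inr (powerMeasure_Iic_one_ne_top hK hr))
  rw [zero_mul] at hmul
  refine hmul.congr' ?_
  filter_upwards [self_mem_nhdsWithin] with x hx using (powerMeasure_Iic hx).symm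

namespace ClosedSets

lemma shift_ofClosure (v : ℝ≥0) (A : Set ℝ≥0) :
    (ofClosure A).shift v = closure ((fun r => v + r) '' A) := by
  have isClosedEmbedding_add : Topology.IsClosedEmbedding (fun r : ℝ≥0 => v + r) :=
    (isometry_iff_dist_eq.2 fun x y => by simp [NNReal.dist_eq]).isClosedEmbedding
  exact (isClosedEmbedding_add.closure_image_eq A).symm

lemma contract_translate {a : ℝ≥0} (ha : 0 < a) (v : ℝ≥0) (F : ClosedSets) :
    (F.translate v).contract a = (F.contract a).translate (a⁻¹ * v) := by
  apply carrier_injective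
  ext r
  simp only [mem_contract, carrier_translate, shift, Set.mem_image]
  constructor
  · rintro ⟨s, hs, h⟩
    exact ⟨a⁻¹ * s, by rwa [mul_inv_cancel_left₀ ha.ne'],
      by rw [← mul_add, h, inv_mul_cancel_left₀ ha.ne']⟩
  · rintro ⟨s, hs, rfl⟩
    exact ⟨a * s, hs, by rw [mul_add, mul_inv_cancel_left₀ ha.ne']⟩

lemma contract_ofClosure {a : ℝ≥0} (ha : 0 < a) (A : Set ℝ≥0) :
    (ofClosure A).contract a = ofClosure ((fun r => a⁻¹ * r) '' A) := by
  apply carrier_injective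
  let e : ℝ≥0 ≃ₜ ℝ≥0 := Homeomorph.mulLeft₀ a ha.ne'
  have himage : (fun r => a⁻¹ * r) '' A = e ⁻¹' A := by
    rw [← e.image_symm]
    rfl
  rw [carrier_ofClosure, himage, ← e.preimage_closure]
  rfl

end ClosedSets

lemma ofClosure_range_dyadicPath {Ω : Type*} {X : ℝ≥0 → Ω → ℝ≥0} {ω : Ω}
    (hX : ∀ t, Filter.Tendsto (fun n => X (dyadicCeil n t) ω) Filter.atTop (nhds (X t ω))) :
    ClosedSets.ofClosure (Set.range (dyadicPath X ω)) = closedRange X ω := by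
  apply ClosedSets.carrier_injective
  simp only [closedRange, ClosedSets.carrier_ofClosure]
  refine Set.Subset.antisymm (closure_mono ?_) (closure_minimal ?_ isClosed_closure)
  · rintro _ ⟨p, rfl⟩
    exact ⟨_, rfl⟩
  · rintro _ ⟨t, rfl⟩
    exact mem_closure_of_tendsto (hX t) (Filter.Eventually.of_forall fun n => ⟨_, rfl⟩)

/-- The distribution of `v + R`, where `v` has density `(1 - β) v ^ (-β)` and `R` has law `Q`. -/
def shiftedLaw (β : ℝ) (Q : Measure ClosedSets) : Measure ClosedSets :=
  ((powerMeasure (1 - β) (-β)).prod Q).map fun p => p.2.translate p.1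

instance (β : ℝ) (Q : Measure ClosedSets) [SFinite Q] : SFinite (shiftedLaw β Q) := by
  unfold shiftedLaw
  infer_instance

lemma isCompact_Iic_nnreal (x : ℝ≥0) : IsCompact (Set.Iic x) := by
  rw [← Set.Icc_bot]
  exact isCompact_Icc

lemma shiftedLaw_hitting_Iic_le (β : ℝ) (Q : Measure ClosedSets) [IsProbabilityMeasure Q]
    (x : ℝ≥0) : shiftedLaw β Q (ClosedSets.hitting (Set.Iic x))
      ≤ powerMeasure (1 - β) (-β) (Set.Iic x) := by
  rw [shiftedLaw, Measure.map_apply ClosedSets.measurable_translate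
    (ClosedSets.measurableSet_hitting (isCompact_Iic_nnreal x))]
  calc _ ≤ ((powerMeasure (1 - β) (-β)).prod Q) (Set.Iic x ×ˢ Set.univ) := by
        refine measure_mono ?_
        rintro ⟨v, F⟩ ⟨_, ⟨r, _, rfl⟩, hx⟩
        exact ⟨Set.mem_Iic.2 (le_self_add.trans (Set.mem_Iic.1 hx)), trivial⟩
    _ = powerMeasure (1 - β) (-β) (Set.Iic x) := by rw [Measure.prod_prod, measure_univ, mul_one]

namespace IsRegularSubordinator

variable {Ω : Type*} [MeasurableSpace Ω] {P : Measure Ω} {β c : ℝ} {S : ℝ≥0 → Ω → ℝ≥0}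

lemma closedRange_eq (hS : IsRegularSubordinator β c S P) :
    closedRange S = (fun w => ClosedSets.ofClosure (Set.range w)) ∘ dyadicPath S :=
  funext fun ω => (ofClosure_range_dyadicPath (hS.tendsto_apply_dyadicCeil ω)).symm

lemma measurable_closedRange (hS : IsRegularSubordinator β c S P) :
    Measurable (closedRange S) := by
  rw [hS.closedRange_eq]
  exact ClosedSets.measurable_ofClosure_range.comp (measurable_dyadicPath hS.measurable)

lemma map_closedRange (hS : IsRegularSubordinator β c S P) :
    P.map (closedRange S)
      = (P.map (dyadicPath S)).map fun w => ClosedSets.ofClosure (Set.range w) := by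
  rw [hS.closedRange_eq, Measure.map_map ClosedSets.measurable_ofClosure_range
    (measurable_dyadicPath hS.measurable)]

lemma isProbabilityMeasure_map_closedRange [IsProbabilityMeasure P]
    (hS : IsRegularSubordinator β c S P) : IsProbabilityMeasure (P.map (closedRange S)) :=
  Measure.isProbabilityMeasure_map hS.measurable_closedRange.aemeasurable

lemma contract_closedRange (hS : IsRegularSubordinator β c S P) {a : ℝ≥0} (ha : 0 < a) (ω : Ω) :
    (closedRange S ω).contract a = ClosedSets.ofClosure
      (Set.range (dyadicPath (fun t ω => a⁻¹ * S (a ^ β * t) ω) ω)) := by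
  have hpos : 0 < a ^ β := NNReal.rpow_pos ha
  have hrange : (fun r => a⁻¹ * r) '' Set.range (fun t => S t ω)
      = Set.range fun t => a⁻¹ * S (a ^ β * t) ω := by
    rw [← (mulLeft_bijective₀ (a ^ β) hpos.ne').surjective.range_comp, ← Set.range_comp]
    rfl
  rw [closedRange, ClosedSets.contract_ofClosure ha, hrange,
    ofClosure_range_dyadicPath (X := fun t ω => a⁻¹ * S (a ^ β * t) ω) fun t =>
      (hS.tendsto_of_ge ω ((tendsto_dyadicCeil t).const_mul (a ^ β))
        fun n => by gcongr; exact le_dyadicCeil n t).const_mul _]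
  rfl

lemma map_contract_closedRange [IsProbabilityMeasure P] (hS : IsRegularSubordinator β c S P)
    {a : ℝ≥0} (ha : 0 < a) :
    (P.map (closedRange S)).map (ClosedSets.contract a) = P.map (closedRange S) := by
  have hcontract : ClosedSets.contract a ∘ closedRange S
      = (fun w => ClosedSets.ofClosure (Set.range w)) ∘
        dyadicPath (fun t ω => a⁻¹ * S (a ^ β * t) ω) := funext (hS.contract_closedRange ha)
  rw [Measure.map_map (ClosedSets.measurable_contract a) hS.measurable_closedRange, hcontract,
    ← Measure.map_map ClosedSets.measurable_ofClosure_range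
      (measurable_dyadicPath fun t => (hS.measurable _).const_mul _),
    hS.map_dyadicPath_inv_mul ha, ← hS.map_closedRange]

lemma map_contract_shiftedLaw [IsProbabilityMeasure P] (hS : IsRegularSubordinator β c S P)
    {a : ℝ≥0} (ha : 0 < a) :
    (shiftedLaw β (P.map (closedRange S))).map (ClosedSets.contract a)
      = (a ^ (1 - β) : ℝ≥0) • shiftedLaw β (P.map (closedRange S)) := by
  have := hS.isProbabilityMeasure_map_closedRange
  have hcomm : ClosedSets.contract a ∘ (fun p : ℝ≥0 × ClosedSets => p.2.translate p.1)
      = (fun p : ℝ≥0 × ClosedSets => p.2.translate p.1) ∘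
        Prod.map (fun v => a⁻¹ * v) (ClosedSets.contract a) :=
    funext fun p => ClosedSets.contract_translate ha p.1 p.2
  rw [shiftedLaw, Measure.map_map (ClosedSets.measurable_contract a)
    ClosedSets.measurable_translate, hcomm, ← Measure.map_map ClosedSets.measurable_translate
    ((measurable_const_mul _).prodMap (ClosedSets.measurable_contract a)),
    ← Measure.map_prod_map _ _ (measurable_const_mul _) (ClosedSets.measurable_contract a),
    hS.map_contract_closedRange ha, map_mul_powerMeasure _ _ (inv_pos.2 ha),
    Measure.prod_smul_left, Measure.map_smul, neg_add_eq_sub, NNReal.inv_rpow, NNReal.rpow_neg,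
    inv_inv]

-- If `v + S` comes within `ε` of `b`, then its overshoot over `b - ε` is less than `2 ε`.
lemma overshoot_le_of_mem_shift (hS : IsRegularSubordinator β c S P) {b v ε : ℝ≥0} {ω : Ω}
    (hε : 0 < ε) (hb : b ∈ (closedRange S ω).shift v) :
    overshoot S (b - ε) (v, ω) ≤ 2 * ε := by
  rw [closedRange, ClosedSets.shift_ofClosure] at hb
  obtain ⟨_, ⟨_, ⟨t, rfl⟩, rfl⟩, hdist⟩ := Metric.mem_closure_iff.1 hb ε hε
  rw [NNReal.dist_eq, abs_lt, neg_lt_sub_iff_lt_add, sub_lt_iff_lt_add] at hdist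
  have hlow : b - ε ≤ v + S t ω := tsub_le_iff_left.2 (by exact_mod_cast hdist.2.le)
  have hhigh : v + S t ω ≤ b + ε := by
    exact_mod_cast (add_comm (ε : ℝ) b ▸ hdist.1).le
  have hpassage : passage S (b - ε - v) ω ≤ t :=
    hS.passage_le_iff.2 (tsub_le_iff_left.2 hlow)
  refine tsub_le_iff_left.2 ?_
  calc v + S (passage S (b - ε - v) ω) ω ≤ v + S t ω := by gcongr; exact hS.mono ω hpassage
    _ ≤ b + ε := hhigh
    _ ≤ b - ε + ε + ε := by gcongr; exact le_tsub_add
    _ = b - ε + 2 * ε := by ring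

lemma ae_notMem_shift [IsProbabilityMeasure P] (hS : IsRegularSubordinator β c S P) (hc : 0 < c)
    (hβ1 : β < 1) (b : ℝ≥0) :
    ∀ᵐ q ∂(powerMeasure (1 - β) (-β)).prod P, b ∉ (closedRange S q.2).shift q.1 := by
  have bound (ε : ℝ≥0) (hε : 0 < ε) : ((powerMeasure (1 - β) (-β)).prod P)
      {q | ¬ b ∉ (closedRange S q.2).shift q.1} ≤ powerMeasure (1 - β) (-β) (Set.Iic ε) := by
    conv_rhs => rw [← hS.map_overshoot hc hβ1 (b - ε / 2),
      Measure.map_apply (hS.measurable_overshoot _) measurableSet_Iic]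
    refine measure_mono fun q hq => (hS.overshoot_le_of_mem_shift (half_pos hε)
      (not_not.1 hq)).trans_eq (mul_div_cancel₀ ε two_ne_zero)
  refine le_antisymm (ge_of_tendsto (tendsto_powerMeasure_Iic (K := 1 - β) (r := -β)
    (by linarith) (by linarith)) ?_) zero_le
  filter_upwards [self_mem_nhdsWithin] with ε hε using bound ε hε

lemma restart_translate_closedRange (hS : IsRegularSubordinator β c S P) {b v : ℝ≥0} {ω : Ω}
    (hb : b ∉ (closedRange S ω).shift v) :
    ((closedRange S ω).translate v).restart b
      = (closedRange (futureIncr S (passage S (b - v) ω)) ω).translate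
        (overshoot S b (v, ω)) := by
  set τ := passage S (b - v) ω with hτ
  have decomp (t : ℝ≥0) :
      overshoot S b (v, ω) + (S (τ + t) ω - S τ ω) + b = v + S (τ + t) ω := by
    rw [overshoot, ← hτ, add_right_comm, tsub_add_cancel_of_le (hS.le_add_passage b v ω),
      add_assoc, add_tsub_cancel_of_le (hS.mono ω le_self_add)]
  apply ClosedSets.carrier_injective
  simp only [closedRange, ClosedSets.carrier_translate, ClosedSets.shift_ofClosure] at hb ⊢
  change (fun t => t + b) ⁻¹' ((ClosedSets.ofClosure _).translate v).carrier = _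
  rw [ClosedSets.carrier_translate, ClosedSets.shift_ofClosure, preimage_add_closure hb]
  congr 1
  ext r
  simp only [Set.mem_preimage, Set.mem_image, Set.exists_range_iff, futureIncr]
  constructor
  · rintro ⟨t, ht⟩
    have hτt : τ ≤ t := hS.passage_le_iff.2 (tsub_le_iff_left.2 (ht ▸ le_add_self))
    obtain ⟨s, rfl⟩ := le_iff_exists_add.1 hτt
    exact ⟨s, add_right_cancel ((decomp s).trans ht)⟩
  · rintro ⟨s, rfl⟩
    exact ⟨τ + s, (decomp s).symm⟩

lemma shiftedLaw_map_closedRange [SFinite P] (hS : IsRegularSubordinator β c S P) :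
    shiftedLaw β (P.map (closedRange S)) = ((powerMeasure (1 - β) (-β)).prod P).map
      fun q => (closedRange S q.2).translate q.1 := by
  conv_lhs => rw [shiftedLaw, ← Measure.map_id (μ := powerMeasure (1 - β) (-β)),
    Measure.map_prod_map _ _ measurable_id hS.measurable_closedRange,
    Measure.map_map ClosedSets.measurable_translate
      (measurable_id.prodMap hS.measurable_closedRange)]
  rfl

lemma map_restart_shiftedLaw [IsProbabilityMeasure P] (hS : IsRegularSubordinator β c S P)
    (hc : 0 < c) (hβ1 : β < 1) (b : ℝ≥0) :
    (shiftedLaw β (P.map (closedRange S))).map (ClosedSets.restart b)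
      = shiftedLaw β (P.map (closedRange S)) := by
  set ν := powerMeasure (1 - β) (-β) with hν
  have measurable_assemble : Measurable fun z : ℝ≥0 × (ℕ × ℕ → ℝ≥0) =>
      (ClosedSets.ofClosure (Set.range z.2)).translate z.1 :=
    ClosedSets.measurable_translate.comp
      (measurable_id.prodMap ClosedSets.measurable_ofClosure_range)
  have measurable_translate_closedRange : Measurable fun q : ℝ≥0 × Ω =>
      (closedRange S q.2).translate q.1 :=
    ClosedSets.measurable_translate.comp (measurable_id.prodMap hS.measurable_closedRange)
  have restart_ae : (fun q : ℝ≥0 × Ω => ((closedRange S q.2).translate q.1).restart b)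
      =ᵐ[ν.prod P] fun q => (ClosedSets.ofClosure (Set.range
        (dyadicPath (futureIncr S (passage S (b - q.1) q.2)) q.2))).translate
          (overshoot S b q) := by
    filter_upwards [hS.ae_notMem_shift hc hβ1 b] with q hq
    rw [hS.restart_translate_closedRange hq, ofClosure_range_dyadicPath fun t =>
      hS.tendsto_futureIncr_dyadicCeil _ t q.2]
  calc (shiftedLaw β (P.map (closedRange S))).map (ClosedSets.restart b)
      = (ν.prod P).map fun q => ((closedRange S q.2).translate q.1).restart b := by
        rw [hS.shiftedLaw_map_closedRange, Measure.map_map (ClosedSets.measurable_restart b)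
          measurable_translate_closedRange]
        rfl
    _ = ((ν.prod P).map fun q => (overshoot S b q,
          dyadicPath (futureIncr S (passage S (b - q.1) q.2)) q.2)).map
        fun z => (ClosedSets.ofClosure (Set.range z.2)).translate z.1 := by
        rw [Measure.map_congr restart_ae, Measure.map_map measurable_assemble
          ((hS.measurable_overshoot b).prodMk
            (hS.measurable_dyadicPath_futureIncr_passage_delay b))]
        rfl
    _ = (ν.prod (P.map (dyadicPath S))).map
        fun z => (ClosedSets.ofClosure (Set.range z.2)).translate z.1 := by
        rw [hS.map_prodMk_overshoot_dyadicPath, hS.map_overshoot hc hβ1 b]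
    _ = shiftedLaw β (P.map (closedRange S)) := by
        conv_rhs => rw [shiftedLaw, hS.map_closedRange, ← hν, ← Measure.map_id (μ := ν),
          Measure.map_prod_map _ _ measurable_id ClosedSets.measurable_ofClosure_range,
          Measure.map_map ClosedSets.measurable_translate
            (measurable_id.prodMap ClosedSets.measurable_ofClosure_range)]
        rfl

lemma shiftedLaw_hitting_Icc_le [IsProbabilityMeasure P] (hS : IsRegularSubordinator β c S P)
    (hc : 0 < c) (hβ1 : β < 1) (x ε : ℝ≥0) :
    shiftedLaw β (P.map (closedRange S)) (ClosedSets.hitting (Set.Icc x (x + ε)))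
      ≤ powerMeasure (1 - β) (-β) (Set.Iic ε) := by
  have := hS.isProbabilityMeasure_map_closedRange
  have himage : (fun t => t + x) '' Set.Iic ε = Set.Icc x (x + ε) := by
    rw [← Set.Icc_bot, Set.image_add_const_Icc, bot_eq_zero, zero_add, add_comm]
  refine le_trans (le_of_eq ?_) (shiftedLaw_hitting_Iic_le β (P.map (closedRange S)) ε)
  conv_rhs => rw [← hS.map_restart_shiftedLaw hc hβ1 x, Measure.map_apply
    (ClosedSets.measurable_restart x) (ClosedSets.measurableSet_hitting (isCompact_Iic_nnreal ε)),
    ClosedSets.preimage_restart_hitting, himage]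

end IsRegularSubordinator

/-! ### Poisson point processes -/

section PointMeasure

variable {Ω E : Type*} [MeasurableSpace E]

/-- The counting measure of the points `X 0 ω, X 1 ω, …`. -/
def pointMeasure (X : ℕ → Ω → E) (ω : Ω) : Measure E :=
  Measure.sum fun j => Measure.dirac (X j ω)

lemma pointMeasure_apply (X : ℕ → Ω → E) (ω : Ω) {A : Set E} (hA : MeasurableSet A) :
    pointMeasure X ω A = (pointCount X A ω : ℝ≥0∞) := by
  rw [pointMeasure, Measure.sum_apply _ hA, pointCount, ← ENNReal.tsum_set_one,
    tsum_subtype _ (fun _ => (1 : ℝ≥0∞))]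
  refine tsum_congr fun j => ?_
  rw [Measure.dirac_apply' _ hA]
  rfl

lemma lintegral_pointMeasure (X : ℕ → Ω → E) (ω : Ω) {f : E → ℝ≥0∞} (hf : Measurable f) :
    ∫⁻ x, f x ∂(pointMeasure X ω) = ∑' j, f (X j ω) := by
  rw [pointMeasure, lintegral_sum_measure]
  exact tsum_congr fun j => lintegral_dirac' _ hf

lemma lintegral_restrict_pointMeasure (X : ℕ → Ω → E) (ω : Ω) {W : Set E} (hW : MeasurableSet W)
    {f : E → ℝ≥0∞} (hf : Measurable f) {J : Finset ℕ} (hJ : ∀ j, j ∈ J ↔ X j ω ∈ W) :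
    ∫⁻ x in W, f x ∂(pointMeasure X ω) = ∑ j ∈ J, f (X j ω) := by
  rw [← lintegral_indicator hW, lintegral_pointMeasure X ω (hf.indicator hW),
    tsum_eq_sum (s := J) fun j hj => Set.indicator_of_notMem (fun h => hj ((hJ j).2 h)) _]
  exact Finset.sum_congr rfl fun j hj => Set.indicator_of_mem ((hJ j).1 hj) _

variable [MeasurableSpace Ω]

lemma measurable_pointMeasure {X : ℕ → Ω → E} (hX : ∀ j, Measurable (X j)) :
    Measurable (pointMeasure X) := by
  refine Measure.measurable_of_measurable_coe _ fun A hA => ?_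
  simp only [pointMeasure, Measure.sum_apply _ hA, Measure.dirac_apply' _ hA]
  exact Measurable.tsum fun j => (measurable_one.indicator hA).comp (hX j)

lemma measurable_restrict_pointMeasure {X : ℕ → Ω → E} (hX : ∀ j, Measurable (X j)) {W : Set E}
    (hW : MeasurableSet W) : Measurable fun ω => (pointMeasure X ω).restrict W := by
  refine Measure.measurable_of_measurable_coe _ fun A hA => ?_
  simp only [Measure.restrict_apply hA]
  exact (Measure.measurable_coe (hA.inter hW)).comp (measurable_pointMeasure hX)

lemma measurable_pointCount {X : ℕ → Ω → E} (hX : ∀ j, Measurable (X j)) {A : Set E}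
    (hA : MeasurableSet A) : Measurable (pointCount X A) := by
  refine ENat.measurable_iff.2 fun n => ?_
  have measurable_apply : Measurable fun ω => pointMeasure X ω A :=
    (Measure.measurable_coe hA).comp (measurable_pointMeasure hX)
  convert measurable_apply (measurableSet_singleton (n : ℝ≥0∞)) using 1
  ext ω
  simp only [Set.mem_preimage, Set.mem_singleton_iff, pointMeasure_apply X ω hA]
  norm_cast

end PointMeasure

lemma poissonMeasure_singleton_add_le (r : ℝ≥0) (m k : ℕ) :
    poissonMeasure r {m + k} ≤ (r : ℝ≥0∞) ^ k * poissonMeasure r {m} := by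
  rw [poissonMeasure_singleton, poissonMeasure_singleton, ← ENNReal.ofReal_coe_nnreal,
    ← ENNReal.ofReal_pow r.coe_nonneg, ← ENNReal.ofReal_mul (by positivity)]
  refine ENNReal.ofReal_le_ofReal ?_
  have factorial_le : (m.factorial : ℝ) ≤ (m + k).factorial :=
    Nat.cast_le.2 (Nat.factorial_le (Nat.le_add_right m k))
  calc Real.exp (-r) * (r : ℝ) ^ (m + k) / (m + k).factorial
      ≤ Real.exp (-r) * (r : ℝ) ^ (m + k) / m.factorial := by gcongr
    _ = (r : ℝ) ^ k * (Real.exp (-r) * (r : ℝ) ^ m / m.factorial) := by ring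

lemma poissonMeasure_Ici_le_pow (r : ℝ≥0) (k : ℕ) :
    poissonMeasure r (Set.Ici k) ≤ (r : ℝ≥0∞) ^ k := by
  have hIci : Set.Ici k = ⋃ m : ℕ, {m + k} := by
    ext n
    simp only [Set.mem_Ici, Set.mem_iUnion, Set.mem_singleton_iff]
    exact ⟨fun h => ⟨n - k, by omega⟩, by rintro ⟨m, rfl⟩; omega⟩
  calc poissonMeasure r (Set.Ici k) ≤ ∑' m, poissonMeasure r {m + k} :=
        hIci ▸ measure_iUnion_le _
    _ ≤ ∑' m, (r : ℝ≥0∞) ^ k * poissonMeasure r {m} :=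
        ENNReal.tsum_le_tsum fun m => poissonMeasure_singleton_add_le r m k
    _ = (r : ℝ≥0∞) ^ k * poissonMeasure r Set.univ := by
        rw [ENNReal.tsum_mul_left, ← Set.iUnion_of_singleton,
          measure_iUnion (fun _ _ h => Set.disjoint_singleton.2 h) measurableSet_singleton]
    _ = (r : ℝ≥0∞) ^ k := by rw [measure_univ, mul_one]

section Atoms

variable {E ι : Type*} {B : ι → Set E}

/-- The points which lie in `B i` exactly for `i ∈ σ`. The atom of `σ = ∅` is taken to be empty, so
that every atom is contained in some `B i`. -/
def atom (B : ι → Set E) (σ : Finset ι) : Set E := {x | σ.Nonempty ∧ ∀ i, x ∈ B i ↔ i ∈ σ}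

lemma disjoint_atom {σ τ : Finset ι} (h : σ ≠ τ) : Disjoint (atom B σ) (atom B τ) :=
  Set.disjoint_left.2 fun _ hσ hτ => h (Finset.ext fun i => (hσ.2 i).symm.trans (hτ.2 i))

lemma atom_empty : atom B ∅ = ∅ :=
  Set.eq_empty_of_forall_notMem fun _ hx => Finset.not_nonempty_empty hx.1

lemma atom_subset {σ : Finset ι} {i : ι} (hi : i ∈ σ) : atom B σ ⊆ B i :=
  fun _ hx => (hx.2 i).2 hi

lemma biUnion_atom [Fintype ι] [DecidableEq ι] (B : ι → Set E) (i : ι) :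
    ⋃ σ ∈ Finset.univ.filter (i ∈ ·), atom B σ = B i := by
  classical
  refine Set.Subset.antisymm
    (Set.iUnion₂_subset fun σ hσ => atom_subset (Finset.mem_filter.1 hσ).2) fun x hx => ?_
  have mem_type (j : ι) : j ∈ Finset.univ.filter (fun j => x ∈ B j) ↔ x ∈ B j := by simp
  exact Set.mem_biUnion (Finset.mem_filter.2 ⟨Finset.mem_univ _, (mem_type i).2 hx⟩)
    ⟨⟨i, (mem_type i).2 hx⟩, fun j => (mem_type j).symm⟩

variable [MeasurableSpace E]

lemma measurableSet_atom [Countable ι] (hB : ∀ i, MeasurableSet (B i)) (σ : Finset ι) :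
    MeasurableSet (atom B σ) := by
  have (i : ι) : MeasurableSet {x | x ∈ B i ↔ i ∈ σ} := by
    by_cases hi : i ∈ σ
    · simp only [hi, iff_true]
      exact hB i
    · simp only [hi, iff_false]
      exact (hB i).compl
  rw [atom, Set.ofPred_and, Set.ofPred_forall]
  exact (MeasurableSet.const _).inter (MeasurableSet.iInter this)

lemma measure_atom_ne_top {ν : Measure E} (hfin : ∀ i, ν (B i) ≠ ∞) (σ : Finset ι) :
    ν (atom B σ) ≠ ∞ := by
  obtain rfl | ⟨i, hi⟩ := σ.eq_empty_or_nonempty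
  · simp only [atom_empty, measure_empty, ne_eq, ENNReal.zero_ne_top, not_false_eq_true]
  · exact measure_ne_top_of_subset (atom_subset hi) (hfin i)

end Atoms

lemma measure_pi_measure_ext {κ E : Type*} [MeasurableSpace E] {μ μ' : Measure (κ → Measure E)}
    [IsFiniteMeasure μ] [IsFiniteMeasure μ'] (h : ∀ I : Finset (κ × {A : Set E // MeasurableSet A}),
      μ.map (fun M (i : I) => M i.1.1 i.1.2.1) = μ'.map fun M (i : I) => M i.1.1 i.1.2.1) :
    μ = μ' := by
  let values (M : κ → Measure E) (i : κ × {A : Set E // MeasurableSet A}) : ℝ≥0∞ := M i.1 i.2.1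
  have measurable_values : Measurable values := measurable_pi_lambda _ fun i =>
    (Measure.measurable_coe i.2.2).comp (measurable_pi_apply i.1)
  have le_comap_values : (inferInstance : MeasurableSpace (κ → Measure E))
      ≤ MeasurableSpace.comap values inferInstance := by
    refine iSup_le fun k => measurable_iff_comap_le.1 ?_
    exact @Measure.measurable_of_measurable_coe _ _ _ (MeasurableSpace.comap values inferInstance) _
      fun A hA => (measurable_pi_apply ((k, ⟨A, hA⟩) : κ × {A : Set E // MeasurableSet A})).comp
        (comap_measurable values)
  have map_values : μ.map values = μ'.map values := by
    have projLimit := isProjectiveLimit_map (X := fun i M => values M i)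
      measurable_values.aemeasurable (P := μ)
    simp only [Finset.restrict_def, values, h] at projLimit
    exact projLimit.unique
      (isProjectiveLimit_map (X := fun i M => values M i) measurable_values.aemeasurable (P := μ'))
  ext D hD
  obtain ⟨B, hB, rfl⟩ := le_comap_values D hD
  rw [← Measure.map_apply measurable_values hB, map_values, Measure.map_apply measurable_values hB]

namespace IsPoissonEnumeration

variable {Ω Ω' E : Type*} [MeasurableSpace Ω] [MeasurableSpace Ω'] [MeasurableSpace E]
  {X : ℕ → Ω → E} {Y : ℕ → Ω' → E} {ν : Measure E} {P : Measure Ω} {P' : Measure Ω'}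

lemma map {E' : Type*} [MeasurableSpace E'] (hX : IsPoissonEnumeration X ν P) {T : E → E'}
    (hT : Measurable T) : IsPoissonEnumeration (fun j ω => T (X j ω)) (ν.map T) P where
  measurable j := hT.comp (hX.measurable j)
  law A hA hfin := by
    rw [Measure.map_apply hT hA] at hfin ⊢
    exact hX.law _ (hT hA) hfin
  indep n A hA hd :=
    hX.indep n (fun i => T ⁻¹' A i) (fun i => hT (hA i)) fun i j hij => (hd i j hij).preimage T

lemma measure_le_pointCount_le (hX : IsPoissonEnumeration X ν P) {A : Set E}
    (hA : MeasurableSet A) (hfin : ν A ≠ ∞) (k : ℕ) :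
    P {ω | (k : ℕ∞) ≤ pointCount X A ω} ≤ ν A ^ k := by
  have preimage_cast : (fun n : ℕ => (n : ℕ∞)) ⁻¹' Set.Ici (k : ℕ∞) = Set.Ici k :=
    Set.ext fun n => Nat.cast_le (α := ℕ∞)
  calc P {ω | (k : ℕ∞) ≤ pointCount X A ω}
      = P.map (pointCount X A) (Set.Ici (k : ℕ∞)) := by
        rw [Measure.map_apply (measurable_pointCount hX.measurable hA) .of_discrete]
        rfl
    _ = poissonMeasure (ν A).toNNReal (Set.Ici k) := by
        rw [hX.law A hA hfin, Measure.map_apply .of_discrete .of_discrete, preimage_cast]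
    _ ≤ ((ν A).toNNReal : ℝ≥0∞) ^ k := poissonMeasure_Ici_le_pow _ k
    _ = ν A ^ k := by rw [ENNReal.coe_toNNReal hfin]

lemma ae_pointCount_ne_top (hX : IsPoissonEnumeration X ν P) {A : Set E}
    (hA : MeasurableSet A) (hfin : ν A ≠ ∞) : ∀ᵐ ω ∂P, pointCount X A ω ≠ ⊤ := by
  have : ∀ᵐ n ∂P.map (pointCount X A), n ≠ ⊤ := by
    rw [hX.law A hA hfin, ae_map_iff Measurable.of_discrete.aemeasurable .of_discrete]
    exact Filter.Eventually.of_forall fun n => ENat.natCast_ne_top n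
  exact ae_of_ae_map (measurable_pointCount hX.measurable hA).aemeasurable this

lemma map_pointCount_disjoint (hX : IsPoissonEnumeration X ν P) {ι : Type*} [Fintype ι]
    {C : ι → Set E} (hC : ∀ i, MeasurableSet (C i)) (hd : ∀ i j, i ≠ j → Disjoint (C i) (C j))
    (hfin : ∀ i, ν (C i) ≠ ∞) :
    P.map (fun ω i => pointCount X (C i) ω) = Measure.pi fun i =>
      (poissonMeasure (ν (C i)).toNNReal).map (fun n : ℕ => (n : ℕ∞)) := by
  have iIndepFun_pointCount : iIndepFun (fun i => pointCount X (C i)) P := by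
    let e := Fintype.equivFin ι
    simpa only [e.symm_apply_apply] using (hX.indep _ (fun i => C (e.symm i)) (fun i => hC _)
      fun i j hij => hd _ _ (e.symm.injective.ne hij)).precomp e.injective
  rw [iIndepFun_pointCount.map_fun_eq_pi_map
    fun i => (measurable_pointCount hX.measurable (hC i)).aemeasurable]
  congr with i : 1
  exact hX.law _ (hC i) (hfin i)

-- The sets `B i` may overlap, but each is the disjoint union of its atoms.
lemma map_pointMeasure_apply (hX : IsPoissonEnumeration X ν P) {ι : Type*} [DecidableEq ι]
    [Fintype ι] {B : ι → Set E} (hB : ∀ i, MeasurableSet (B i)) (hfin : ∀ i, ν (B i) ≠ ∞) :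
    P.map (fun ω i => pointMeasure X ω (B i))
      = (Measure.pi fun σ => (poissonMeasure (ν (atom B σ)).toNNReal).map
          (fun n : ℕ => (n : ℕ∞))).map
        fun n i => ∑ σ ∈ Finset.univ.filter (i ∈ ·), ((n σ : ℕ∞) : ℝ≥0∞) := by
  have measurable_sum : Measurable fun (n : Finset ι → ℕ∞) i =>
      ∑ σ ∈ Finset.univ.filter (i ∈ ·), (n σ : ℝ≥0∞) :=
    measurable_pi_lambda _ fun i => Finset.measurable_fun_sum _ fun σ _ =>
      (measurable_from_top (f := ((↑) : ℕ∞ → ℝ≥0∞))).comp (measurable_pi_apply σ)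
  rw [← hX.map_pointCount_disjoint (measurableSet_atom hB) (fun _ _ => disjoint_atom)
    (measure_atom_ne_top hfin), Measure.map_map measurable_sum
    (measurable_pi_lambda _ fun σ => measurable_pointCount hX.measurable (measurableSet_atom hB σ))]
  congr with ω i
  rw [← biUnion_atom B i, measure_biUnion_finset (fun _ _ _ _ => disjoint_atom)
    fun σ _ => measurableSet_atom hB σ]
  exact Finset.sum_congr rfl fun σ _ => pointMeasure_apply X ω (measurableSet_atom hB σ)

lemma map_restrict_pointMeasure_eq [IsFiniteMeasure P] [IsFiniteMeasure P']
    (hX : IsPoissonEnumeration X ν P) (hY : IsPoissonEnumeration Y ν P') {κ : Type*} {W : κ → Set E}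
    (hW : ∀ k, MeasurableSet (W k)) (hfin : ∀ k, ν (W k) ≠ ∞) :
    P.map (fun ω k => (pointMeasure X ω).restrict (W k))
      = P'.map (fun ω k => (pointMeasure Y ω).restrict (W k)) := by
  classical
  refine measure_pi_measure_ext fun I => ?_
  have measurable_values : Measurable fun (M : κ → Measure E) (i : I) => M i.1.1 i.1.2.1 :=
    measurable_pi_lambda _ fun i =>
      (Measure.measurable_coe i.1.2.2).comp (measurable_pi_apply i.1.1)
  have hB (i : I) : MeasurableSet (i.1.2.1 ∩ W i.1.1) := i.1.2.2.inter (hW _)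
  have hBfin (i : I) : ν (i.1.2.1 ∩ W i.1.1) ≠ ∞ :=
    measure_ne_top_of_subset Set.inter_subset_right (hfin _)
  rw [Measure.map_map measurable_values
      (measurable_pi_lambda _ fun k => measurable_restrict_pointMeasure hX.measurable (hW k)),
    Measure.map_map measurable_values
      (measurable_pi_lambda _ fun k => measurable_restrict_pointMeasure hY.measurable (hW k))]
  simp only [Function.comp_def, Measure.restrict_apply, Subtype.prop]
  rw [hX.map_pointMeasure_apply hB hBfin, hY.map_pointMeasure_apply hB hBfin]

end IsPoissonEnumeration

/-! ### Common points of closed sets -/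

/-- The `i`-th interval of length `1 / (n + 1)`. -/
def cell (n i : ℕ) : Set ℝ≥0 :=
  Set.Icc ((i : ℝ≥0) / (n + 1)) ((i : ℝ≥0) / (n + 1) + 1 / ((n : ℝ≥0) + 1))

lemma isCompact_cell (n i : ℕ) : IsCompact (cell n i) := isCompact_Icc

lemma exists_mem_cell (n : ℕ) (t : ℝ≥0) : ∃ i : ℕ, t ∈ cell n i ∧ (i : ℝ≥0) ≤ t * (n + 1) := by
  have floor_le : (⌊t * (n + 1)⌋₊ : ℝ≥0) ≤ t * (n + 1) := Nat.floor_le zero_le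
  refine ⟨⌊t * (n + 1)⌋₊, ⟨?_, ?_⟩, floor_le⟩
  · rwa [div_le_iff₀ (by positivity)]
  · rw [← add_div, le_div_iff₀ (by positivity)]
    exact (Nat.lt_floor_add_one _).le

lemma dist_le_of_mem_cell {n i : ℕ} {s t : ℝ≥0} (hs : s ∈ cell n i) (ht : t ∈ cell n i) :
    dist s t ≤ 1 / ((n : ℝ) + 1) := by
  have coe_mem {r : ℝ≥0} (hr : r ∈ cell n i) :
      (r : ℝ) ∈ Set.Icc ((i : ℝ) / (n + 1)) ((i : ℝ) / (n + 1) + 1 / ((n : ℝ) + 1)) :=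
    ⟨by exact_mod_cast hr.1, by exact_mod_cast hr.2⟩
  exact (Real.dist_le_of_mem_Icc (coe_mem hs) (coe_mem ht)).trans_eq (add_sub_cancel_left _ _)

section CommonPoints

variable {ι : Type*} {K : Set ℝ≥0} {F : ι → Set ℝ≥0}

lemma exists_mem_of_frequently_cell (hK : IsCompact K) (hF : ∀ j, IsClosed (F j)) {J : Set ι}
    (hJ : J.Nonempty)
    (h : ∃ᶠ n in Filter.atTop, ∃ i, ∀ j ∈ J, (F j ∩ (K ∩ cell n i)).Nonempty) :
    ∃ t ∈ K, ∀ j ∈ J, t ∈ F j := by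
  obtain ⟨φ, hφ, h⟩ := Filter.extraction_of_frequently_atTop h
  choose i hi using h
  obtain ⟨j₀, hj₀⟩ := hJ
  choose x hx using fun n => hi n j₀ hj₀
  obtain ⟨t, htK, ψ, hψ, ht⟩ := hK.tendsto_subseq fun n => (hx n).2.1
  refine ⟨t, htK, fun j hj => ?_⟩
  choose y hy using fun n => hi n j hj
  have dist_le (n : ℕ) : dist (x (ψ n)) (y (ψ n)) ≤ 1 / ((φ (ψ n) : ℝ) + 1) :=
    dist_le_of_mem_cell (hx (ψ n)).2.2 (hy (ψ n)).2.2
  have tendsto_dist : Filter.Tendsto (fun n => dist (x (ψ n)) (y (ψ n))) Filter.atTop (nhds 0) :=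
    squeeze_zero (fun _ => dist_nonneg) dist_le
      ((tendsto_one_div_add_atTop_nhds_zero_nat (𝕜 := ℝ)).comp (hφ.comp hψ).tendsto_atTop)
  exact (hF j).mem_of_tendsto (ht.congr_dist tendsto_dist)
    (Filter.Eventually.of_forall fun n => (hy (ψ n)).1)

lemma exists_mem_iff_forall_cell (hK : IsCompact K) (hF : ∀ j, IsClosed (F j)) {J : Set ι}
    (hJ : J.Nonempty) :
    (∃ t ∈ K, ∀ j ∈ J, t ∈ F j) ↔ ∀ n, ∃ i, ∀ j ∈ J, (F j ∩ (K ∩ cell n i)).Nonempty := by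
  refine ⟨?_, fun h => exists_mem_of_frequently_cell hK hF hJ (Filter.Frequently.of_forall h)⟩
  rintro ⟨t, htK, ht⟩ n
  obtain ⟨i, hi, -⟩ := exists_mem_cell n t
  exact ⟨i, fun j hj => ⟨t, ht j hj, htK, hi⟩⟩

open Classical in
-- By pigeonhole, the sets which meet the chosen cell are the same for infinitely many `n`.
lemma exists_lt_sum_of_forall_cell (hK : IsCompact K) (hF : ∀ j, IsClosed (F j)) {J : Finset ι}
    {w : ι → ℝ≥0∞} {c : ℝ≥0∞}
    (h : ∀ n, ∃ i, c < ∑ j ∈ J with (F j ∩ (K ∩ cell n i)).Nonempty, w j) :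
    ∃ t ∈ K, c < ∑ j ∈ J with t ∈ F j, w j := by
  choose i hi using h
  obtain ⟨I, hIJ, hI⟩ := (J.powerset.frequently_exists (l := Filter.atTop)
      (p := fun I n => {j ∈ J | (F j ∩ (K ∩ cell n (i n))).Nonempty} = I)).1
    (Filter.Frequently.of_forall fun n =>
      ⟨_, Finset.mem_powerset.2 (Finset.filter_subset _ _), rfl⟩)
  have lt_sum : c < ∑ j ∈ I, w j := by
    obtain ⟨n, rfl⟩ := hI.exists
    exact hi n
  have hne : (I : Set ι).Nonempty :=
    Finset.coe_nonempty.2 (Finset.nonempty_of_sum_ne_zero (zero_le.trans_lt lt_sum).ne')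
  obtain ⟨t, htK, ht⟩ := exists_mem_of_frequently_cell hK hF hne
    (hI.mono fun n hn => ⟨i n, fun j hj => (Finset.mem_filter.1 (hn.ge hj)).2⟩)
  exact ⟨t, htK, lt_sum.trans_le (Finset.sum_le_sum_of_subset fun j hj =>
    Finset.mem_filter.2 ⟨Finset.mem_powerset.1 hIJ hj, ht j hj⟩)⟩

open Classical in
lemma iInf_iSup_sum_cell (hK : IsCompact K) (hF : ∀ j, IsClosed (F j)) (J : Finset ι)
    (w : ι → ℝ≥0∞) :
    ⨅ n, ⨆ i, ∑ j ∈ J with (F j ∩ (K ∩ cell n i)).Nonempty, w j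
      = ⨆ t ∈ K, ∑ j ∈ J with t ∈ F j, w j := by
  refine le_antisymm (le_of_forall_lt fun c hc => ?_) (le_iInf fun n => iSup₂_le fun t htK => ?_)
  · obtain ⟨t, htK, ht⟩ := exists_lt_sum_of_forall_cell hK hF fun n =>
      lt_iSup_iff.1 (hc.trans_le (iInf_le _ n))
    exact ht.trans_le (le_iSup₂_of_le t htK le_rfl)
  · obtain ⟨i, hi, -⟩ := exists_mem_cell n t
    exact le_iSup_of_le i (Finset.sum_le_sum_of_subset
      (Finset.monotone_filter_right J fun j _ ht => ⟨t, ht, htK, hi⟩))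

end CommonPoints

lemma measurableSet_exists_mem_isCompact {Ω ι : Type*} [MeasurableSpace Ω]
    {F : ι → Ω → ClosedSets} (hF : ∀ j, Measurable (F j)) {J : Finset ι} (hJ : J.Nonempty)
    {K : Set ℝ≥0} (hK : IsCompact K) :
    MeasurableSet {ω | ∃ t ∈ K, ∀ j ∈ J, t ∈ (F j ω).carrier} := by
  have eq_iInter : {ω | ∃ t ∈ K, ∀ j ∈ J, t ∈ (F j ω).carrier}
      = ⋂ n, ⋃ i, ⋂ j ∈ J, F j ⁻¹' ClosedSets.hitting (K ∩ cell n i) := by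
    ext ω
    simpa [ClosedSets.mem_hitting] using exists_mem_iff_forall_cell hK
      (fun j => (F j ω).isClosed_carrier) (Finset.coe_nonempty.2 hJ)
  rw [eq_iInter]
  exact MeasurableSet.iInter fun n => MeasurableSet.iUnion fun i => J.measurableSet_biInter
    fun j _ => hF j (ClosedSets.measurableSet_hitting (hK.inter (isCompact_cell n i)))

lemma measurableSet_exists_mem_isOpen {Ω ι : Type*} [MeasurableSpace Ω]
    {F : ι → Ω → ClosedSets} (hF : ∀ j, Measurable (F j)) {J : Finset ι} (hJ : J.Nonempty)
    {G : Set ℝ≥0} (hG : IsOpen G) :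
    MeasurableSet {ω | ∃ t ∈ G, ∀ j ∈ J, t ∈ (F j ω).carrier} := by
  have eq_biUnion : {ω | ∃ t ∈ G, ∀ j ∈ J, t ∈ (F j ω).carrier}
      = ⋃ B ∈ {B ∈ relCompactBasis ℝ≥0 | closure (B : Set ℝ≥0) ⊆ G},
        {ω | ∃ t ∈ closure (B : Set ℝ≥0), ∀ j ∈ J, t ∈ (F j ω).carrier} := by
    ext ω
    conv_lhs => rw [← iUnion_closure_relCompactBasis hG]
    simp only [Set.mem_ofPred_eq, Set.mem_iUnion, exists_prop]
    tauto
  rw [eq_biUnion]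
  exact MeasurableSet.biUnion (countable_sep_relCompactBasis _) fun B hB =>
    measurableSet_exists_mem_isCompact hF hJ (isCompact_closure_of_mem_relCompactBasis hB.1)

/-! ### The sup-measure of a sequence of weighted closed sets -/

/-- The total weight of those sets of a sequence of weighted closed sets which contain `t`. -/
def coverFun (z : ℕ → ℝ≥0 × ClosedSets) (t : ℝ≥0) : ℝ≥0∞ :=
  ∑' j, (z j).2.carrier.indicator (fun _ => ((z j).1 : ℝ≥0∞)) t

/-- The sup-measure with density `coverFun z`. -/
def coverSup (z : ℕ → ℝ≥0 × ClosedSets) : SupMeasure := SupMeasure.supIntegral (coverFun z)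

lemma coverSup_onOpen (z : ℕ → ℝ≥0 × ClosedSets) (G : Opens ℝ≥0) :
    (coverSup z).onOpen G = ⨆ t ∈ G, coverFun z t := rfl

lemma sum_le_coverFun (z : ℕ → ℝ≥0 × ClosedSets) {J : Finset ℕ} {t : ℝ≥0}
    (hJ : ∀ j ∈ J, t ∈ (z j).2.carrier) : ∑ j ∈ J, ((z j).1 : ℝ≥0∞) ≤ coverFun z t := by
  refine le_trans (Finset.sum_le_sum fun j hj => ?_) (ENNReal.sum_le_tsum J)
  rw [Set.indicator_of_mem (hJ j hj)]

lemma lt_coverFun_iff {z : ℕ → ℝ≥0 × ClosedSets} {t : ℝ≥0} {a : ℝ≥0∞} :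
    a < coverFun z t ↔ ∃ J : Finset ℕ, (∀ j ∈ J, t ∈ (z j).2.carrier ∧ 0 < (z j).1) ∧
      a < ∑ j ∈ J, ((z j).1 : ℝ≥0∞) := by
  classical
  refine ⟨fun h => ?_, fun ⟨J, hJ, h⟩ => h.trans_le (sum_le_coverFun z fun j hj => (hJ j hj).1)⟩
  rw [coverFun, ENNReal.tsum_eq_iSup_sum, lt_iSup_iff] at h
  obtain ⟨J, hJ⟩ := h
  refine ⟨{j ∈ J | t ∈ (z j).2.carrier ∧ 0 < (z j).1}, fun j hj => (Finset.mem_filter.1 hj).2, ?_⟩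
  rw [Finset.sum_filter]
  refine hJ.trans_le (Finset.sum_le_sum fun j _ => ?_)
  by_cases hpos : 0 < (z j).1
  · simp only [hpos, and_true, Set.indicator_apply, le_refl]
  · simp [nonpos_iff_eq_zero.1 (not_lt.1 hpos)]

lemma lt_coverSup_onOpen_iff {z : ℕ → ℝ≥0 × ClosedSets} {G : Opens ℝ≥0} {a : ℝ≥0∞} :
    a < (coverSup z).onOpen G ↔ ∃ J : Finset ℕ, J.Nonempty ∧
      (∃ t ∈ G, ∀ j ∈ J, t ∈ (z j).2.carrier) ∧ a < ∑ j ∈ J, ((z j).1 : ℝ≥0∞) := by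
  simp only [coverSup_onOpen, lt_iSup_iff, exists_prop]
  constructor
  · rintro ⟨t, ht, h⟩
    obtain ⟨J, hJ, hJa⟩ := lt_coverFun_iff.1 h
    exact ⟨J, Finset.nonempty_of_sum_ne_zero (zero_le.trans_lt hJa).ne',
      ⟨t, ht, fun j hj => (hJ j hj).1⟩, hJa⟩
  · rintro ⟨J, -, ⟨t, ht, hJ⟩, hJa⟩
    exact ⟨t, ht, hJa.trans_le (sum_le_coverFun z hJ)⟩

lemma measurable_coverSup {Ω : Type*} [MeasurableSpace Ω] {Z : ℕ → Ω → ℝ≥0 × ClosedSets}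
    (hZ : ∀ j, Measurable (Z j)) : Measurable fun ω => coverSup fun j => Z j ω := by
  refine SupMeasure.measurable_of_onOpen fun G => measurable_of_Ioi fun a => ?_
  have eq_biUnion : (fun ω => (coverSup fun j => Z j ω).onOpen G) ⁻¹' Set.Ioi a
      = ⋃ J ∈ {J : Finset ℕ | J.Nonempty}, {ω | ∃ t ∈ G, ∀ j ∈ J, t ∈ (Z j ω).2.carrier} ∩
        {ω | a < ∑ j ∈ J, ((Z j ω).1 : ℝ≥0∞)} := by
    ext ω
    simp only [Set.mem_preimage, Set.mem_Ioi, lt_coverSup_onOpen_iff, Set.mem_iUnion,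
      Set.mem_inter_iff, Set.mem_ofPred_eq, exists_prop]
  rw [eq_biUnion]
  exact MeasurableSet.biUnion (Set.to_countable _) fun J hJ =>
    (measurableSet_exists_mem_isOpen (fun j => measurable_snd.comp (hZ j)) hJ G.isOpen).inter
      (measurableSet_lt measurable_const (Finset.measurable_fun_sum _ fun j _ =>
        (measurable_fst.comp (hZ j)).coe_nnreal_ennreal))

/-! ### The law of the sup-measure of a Poisson process -/

/-- The function `(u, F) ↦ u 1{F ∩ K ≠ ∅}`. -/
def hitWeight (K : Set ℝ≥0) (x : ℝ≥0 × ClosedSets) : ℝ≥0∞ :=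
  (ClosedSets.hitting K).indicator (fun _ => (x.1 : ℝ≥0∞)) x.2

lemma measurable_hitWeight {K : Set ℝ≥0} (hK : IsCompact K) : Measurable (hitWeight K) :=
  measurable_fst.coe_nnreal_ennreal.indicator
    (measurable_snd (ClosedSets.measurableSet_hitting hK))

/-- The supremum over the compact set `K` of the total weight, as a functional of the counting
measure of the weighted sets. Unlike the supremum, it is visibly measurable in this measure. -/
def cellSup (K : Set ℝ≥0) (M : Measure (ℝ≥0 × ClosedSets)) : ℝ≥0∞ :=
  ⨅ n, ⨆ i, ∫⁻ x, hitWeight (K ∩ cell n i) x ∂M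

lemma measurable_cellSup {K : Set ℝ≥0} (hK : IsCompact K) : Measurable (cellSup K) :=
  Measurable.iInf fun n => Measurable.iSup fun i =>
    Measure.measurable_lintegral (measurable_hitWeight (hK.inter (isCompact_cell n i)))

open Classical in
lemma cellSup_restrict_pointMeasure {Ω : Type*} (X : ℕ → Ω → ℝ≥0 × ClosedSets) (ω : Ω)
    {W : Set (ℝ≥0 × ClosedSets)} (hW : MeasurableSet W) {K : Set ℝ≥0} (hK : IsCompact K)
    {J : Finset ℕ} (hJ : ∀ j, j ∈ J ↔ X j ω ∈ W) :
    cellSup K ((pointMeasure X ω).restrict W)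
      = ⨆ t ∈ K, ∑ j ∈ J with t ∈ (X j ω).2.carrier, ((X j ω).1 : ℝ≥0∞) := by
  have lintegral_hitWeight (n i : ℕ) :
      ∫⁻ x in W, hitWeight (K ∩ cell n i) x ∂(pointMeasure X ω)
        = ∑ j ∈ J with ((X j ω).2.carrier ∩ (K ∩ cell n i)).Nonempty, ((X j ω).1 : ℝ≥0∞) := by
    rw [lintegral_restrict_pointMeasure X ω hW
      (measurable_hitWeight (hK.inter (isCompact_cell n i))) hJ, Finset.sum_filter]
    simp only [hitWeight, Set.indicator_apply, ClosedSets.mem_hitting]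
  simp only [cellSup, lintegral_hitWeight]
  exact iInf_iSup_sum_cell hK (fun j => (X j ω).2.isClosed_carrier) J _

/-- The weighted sets of weight larger than `δ` which hit `K`. -/
def heavyHit (δ : ℝ≥0) (K : Set ℝ≥0) : Set (ℝ≥0 × ClosedSets) :=
  Set.Ioi δ ×ˢ ClosedSets.hitting K

lemma heavyHit_mono (δ : ℝ≥0) {K L : Set ℝ≥0} (h : K ⊆ L) : heavyHit δ K ⊆ heavyHit δ L :=
  Set.prod_mono_right (ClosedSets.hitting_mono h)

lemma measurableSet_heavyHit {K : Set ℝ≥0} (hK : IsCompact K) (δ : ℝ≥0) :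
    MeasurableSet (heavyHit δ K) :=
  measurableSet_Ioi.prod (ClosedSets.measurableSet_hitting hK)

/-- A countable family of the sets `heavyHit δ K` with `δ > 0` and compact `K`, which exhausts the
sets of positive weight. -/
def basicHeavyHit (p : ℕ × relCompactBasis ℝ≥0) : Set (ℝ≥0 × ClosedSets) :=
  heavyHit (1 / ((p.1 : ℝ≥0) + 1)) (closure (p.2 : Opens ℝ≥0))

lemma measurableSet_basicHeavyHit (p : ℕ × relCompactBasis ℝ≥0) :
    MeasurableSet (basicHeavyHit p) :=
  measurableSet_heavyHit (isCompact_closure_of_mem_relCompactBasis p.2.2) _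

lemma exists_one_div_add_one_lt {ι : Type*} (J : Finset ι) {w : ι → ℝ≥0} (hw : ∀ j ∈ J, 0 < w j) :
    ∃ n : ℕ, ∀ j ∈ J, 1 / ((n : ℝ≥0) + 1) < w j :=
  ((Filter.eventually_all_finset J).2 fun j hj =>
    (tendsto_one_div_add_atTop_nhds_zero_nat (𝕜 := ℝ≥0)).eventually
      (gt_mem_nhds (hw j hj))).exists

/-- The value on `G` of the sup-measure of a sequence of weighted closed sets, as a functional of
the restrictions of its counting measure to the sets `basicHeavyHit p`. -/
def supOfRestrictions (M : ℕ × relCompactBasis ℝ≥0 → Measure (ℝ≥0 × ClosedSets))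
    (G : Opens ℝ≥0) : ℝ≥0∞ :=
  ⨆ p ∈ {p : ℕ × relCompactBasis ℝ≥0 | closure (p.2 : Set ℝ≥0) ⊆ G},
    cellSup (closure (p.2 : Opens ℝ≥0)) (M p)

lemma measurable_supOfRestrictions : Measurable supOfRestrictions :=
  measurable_pi_lambda _ fun _ => Measurable.biSup _ (Set.to_countable _) fun p _ =>
    (measurable_cellSup (isCompact_closure_of_mem_relCompactBasis p.2.2)).comp
      (measurable_pi_apply p)

lemma coverSup_onOpen_eq_supOfRestrictions {Ω : Type*} (X : ℕ → Ω → ℝ≥0 × ClosedSets) (ω : Ω)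
    (hfin : ∀ p, pointCount X (basicHeavyHit p) ω ≠ ⊤) :
    (coverSup fun j => X j ω).onOpen
      = supOfRestrictions fun p => (pointMeasure X ω).restrict (basicHeavyHit p) := by
  classical
  have finite_heavy (p) : {j | X j ω ∈ basicHeavyHit p}.Finite :=
    Set.encard_ne_top_iff.1 (hfin p)
  have cellSup_eq (p) := cellSup_restrict_pointMeasure X ω (measurableSet_basicHeavyHit p)
    (isCompact_closure_of_mem_relCompactBasis p.2.2) (J := (finite_heavy p).toFinset)
    fun j => (finite_heavy p).mem_toFinset
  funext G
  simp only [supOfRestrictions, cellSup_eq, coverSup_onOpen]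
  refine le_antisymm (iSup₂_le fun t ht => le_of_forall_lt fun a ha => ?_)
    (iSup₂_le fun p hp => iSup₂_le fun t ht => ?_)
  · obtain ⟨J, hJ, hJa⟩ := lt_coverFun_iff.1 ha
    obtain ⟨B, hB, htB, hBG⟩ := exists_mem_relCompactBasis G.isOpen ht
    obtain ⟨n, hn⟩ := exists_one_div_add_one_lt J fun j hj => (hJ j hj).2
    have hJ_subset : J ⊆ {j ∈ (finite_heavy (n, ⟨B, hB⟩)).toFinset | t ∈ (X j ω).2.carrier} :=
      fun j hj => Finset.mem_filter.2 ⟨(finite_heavy _).mem_toFinset.2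
        ⟨hn j hj, t, (hJ j hj).1, subset_closure htB⟩, (hJ j hj).1⟩
    exact hJa.trans_le (le_iSup₂_of_le (n, ⟨B, hB⟩) hBG
      (le_iSup₂_of_le t (subset_closure htB) (Finset.sum_le_sum_of_subset hJ_subset)))
  · exact (sum_le_coverFun _ fun j hj => (Finset.mem_filter.1 hj).2).trans
      (le_iSup₂ (f := fun t (_ : t ∈ G) => coverFun (fun j => X j ω) t) t (hp ht))

namespace IsPoissonEnumeration

variable {Ω Ω' : Type*} [MeasurableSpace Ω] [MeasurableSpace Ω'] {P : Measure Ω} {P' : Measure Ω'}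
  {X : ℕ → Ω → ℝ≥0 × ClosedSets} {Y : ℕ → Ω' → ℝ≥0 × ClosedSets} {ν : Measure (ℝ≥0 × ClosedSets)}

lemma map_coverSup_preimage_onOpen (hX : IsPoissonEnumeration X ν P)
    (hfin : ∀ p, ν (basicHeavyHit p) ≠ ∞) {B : Set (Opens ℝ≥0 → ℝ≥0∞)} (hB : MeasurableSet B)
    (hB' : MeasurableSet (SupMeasure.onOpen ⁻¹' B)) :
    P.map (fun ω => coverSup fun j => X j ω) (SupMeasure.onOpen ⁻¹' B)
      = P.map (fun ω p => (pointMeasure X ω).restrict (basicHeavyHit p))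
        (supOfRestrictions ⁻¹' B) := by
  rw [Measure.map_apply (measurable_coverSup hX.measurable) hB',
    Measure.map_apply (measurable_pi_lambda _ fun p =>
      measurable_restrict_pointMeasure hX.measurable (measurableSet_basicHeavyHit p))
      (measurable_supOfRestrictions hB)]
  refine measure_congr (Filter.eventuallyEq_set.2 ?_)
  filter_upwards [ae_all_iff.2 fun p =>
    hX.ae_pointCount_ne_top (measurableSet_basicHeavyHit p) (hfin p)] with ω hω
  simp only [Set.mem_preimage, coverSup_onOpen_eq_supOfRestrictions X ω hω]

lemma map_coverSup_eq [IsFiniteMeasure P] [IsFiniteMeasure P'] (hX : IsPoissonEnumeration X ν P)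
    (hY : IsPoissonEnumeration Y ν P')
    (hfin : ∀ δ > 0, ∀ K, IsCompact K → ν (heavyHit δ K) ≠ ∞) :
    P.map (fun ω => coverSup fun j => X j ω) = P'.map (fun ω => coverSup fun j => Y j ω) := by
  have hfin_basic (p) : ν (basicHeavyHit p) ≠ ∞ :=
    hfin _ (by positivity) _ (isCompact_closure_of_mem_relCompactBasis p.2.2)
  ext D hD
  obtain ⟨B, hB, rfl⟩ := SupMeasure.exists_measurableSet_preimage_onOpen hD
  rw [hX.map_coverSup_preimage_onOpen hfin_basic hB hD,
    hY.map_coverSup_preimage_onOpen hfin_basic hB hD,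
    hX.map_restrict_pointMeasure_eq hY measurableSet_basicHeavyHit hfin_basic]

end IsPoissonEnumeration

/-! ### Overlaps of the weighted sets -/

/-- The measure `μ` of the closed sets which hit an interval of length `ε` is at most
`∫₀^ε (1 - β) v ^ (-β) dv = ε ^ (1 - β)`. -/
def HasHittingBound (β : ℝ) (μ : Measure ClosedSets) : Prop :=
  ∀ x ε : ℝ≥0, μ (ClosedSets.hitting (Set.Icc x (x + ε))) ≤ powerMeasure (1 - β) (-β) (Set.Iic ε)

/-- The mean measure `α u ^ (-(1 + α)) du ⊗ μ` of a Poisson process of weighted closed sets. -/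
def markedLaw (α : ℝ) (μ : Measure ClosedSets) : Measure (ℝ≥0 × ClosedSets) :=
  (powerMeasure α (-(1 + α))).prod μ

/-- An upper bound for the mean number of sets of weight larger than `δ` which hit an interval of
length `ε`. -/
def heavyHitBound (α β : ℝ) (δ ε : ℝ≥0) : ℝ≥0∞ :=
  powerMeasure α (-(1 + α)) (Set.Ioi δ) * powerMeasure (1 - β) (-β) (Set.Iic ε)

section HeavyHitBound

variable {α β : ℝ} {δ ε : ℝ≥0}

lemma heavyHitBound_eq_mul_rpow (hε : 0 < ε) :
    heavyHitBound α β δ ε = heavyHitBound α β δ 1 * (ε ^ (1 - β) : ℝ≥0) := by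
  rw [heavyHitBound, heavyHitBound, powerMeasure_Iic hε, neg_add_eq_sub]
  ring

lemma heavyHitBound_one_ne_top (hα : 0 < α) (hβ1 : β < 1) (hδ : 0 < δ) :
    heavyHitBound α β δ 1 ≠ ∞ :=
  ENNReal.mul_ne_top (powerMeasure_Ioi_ne_top (by linarith) hδ)
    (powerMeasure_Iic_one_ne_top (by linarith) (by linarith))

lemma heavyHitBound_ne_top (hα : 0 < α) (hβ1 : β < 1) (hδ : 0 < δ) (ε : ℝ≥0) :
    heavyHitBound α β δ ε ≠ ∞ := by
  refine ne_top_of_le_ne_top (b := heavyHitBound α β δ (ε + 1)) ?_ ?_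
  · rw [heavyHitBound_eq_mul_rpow (by positivity)]
    exact ENNReal.mul_ne_top (heavyHitBound_one_ne_top hα hβ1 hδ) ENNReal.coe_ne_top
  · unfold heavyHitBound
    gcongr
    exact le_self_add

lemma tendsto_heavyHitBound (hα : 0 < α) (hβ1 : β < 1) (hδ : 0 < δ) :
    Filter.Tendsto (heavyHitBound α β δ) (nhdsWithin 0 (Set.Ioi 0)) (nhds 0) := by
  have hmul := ENNReal.Tendsto.const_mul
    (tendsto_powerMeasure_Iic (K := 1 - β) (r := -β) (by linarith) (by linarith))
    (Or.inr (powerMeasure_Ioi_ne_top (K := α) (r := -(1 + α)) (by linarith) hδ))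
  rwa [mul_zero] at hmul

end HeavyHitBound

section PointwiseOverlap

variable {Ω : Type*} {X : ℕ → Ω → ℝ≥0 × ClosedSets} {ω : Ω} {δ : ℝ≥0}

lemma exists_cell_encard_le_pointCount {t : ℝ≥0} {T : ℕ} (htT : t ≤ T) (n : ℕ) :
    ∃ i ∈ Finset.range (T * (n + 1) + 1),
      Set.encard {j | δ < (X j ω).1 ∧ t ∈ (X j ω).2.carrier}
        ≤ pointCount X (heavyHit δ (cell n i)) ω := by
  obtain ⟨i, hti, hit⟩ := exists_mem_cell n t
  have hiT : i ≤ T * (n + 1) := by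
    have : (i : ℝ≥0) ≤ T * (n + 1) := hit.trans (by gcongr)
    exact_mod_cast this
  exact ⟨i, Finset.mem_range_succ_iff.2 hiT,
    Set.encard_le_encard fun j hj => ⟨hj.1, t, hj.2, hti⟩⟩

lemma eventually_weight_le_of_pointCount_eq_zero {K : Set ℝ≥0} {b : ℝ≥0} (hK : K ∈ nhds b)
    (h : pointCount X (heavyHit δ K) ω = 0) :
    ∀ᶠ t in nhds b, ∀ j, t ∈ (X j ω).2.carrier → (X j ω).1 ≤ δ := by
  filter_upwards [hK] with t htK j htj
  by_contra hlt
  exact Set.eq_empty_iff_forall_notMem.1 (Set.encard_eq_zero.1 h) j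
    ⟨not_le.1 hlt, t, htj, htK⟩

end PointwiseOverlap

lemma Icc_sub_half_mem_nhds (b : ℝ≥0) {ε : ℝ≥0} (hε : 0 < ε) :
    Set.Icc (b - ε / 2) (b - ε / 2 + ε) ∈ nhds b := by
  have hright : b < b - ε / 2 + ε := by
    calc b ≤ b - ε / 2 + ε / 2 := le_tsub_add
      _ < b - ε / 2 + ε := by gcongr; exact half_lt_self hε
  rcases eq_or_ne b 0 with rfl | hb
  · rw [zero_tsub] at hright ⊢
    filter_upwards [Iic_mem_nhds hright] with t ht using ⟨zero_le, ht⟩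
  · exact Icc_mem_nhds (tsub_lt_self (pos_of_ne_zero hb) (half_pos hε)) hright

section MarkedLaw

variable {α β : ℝ} {μ : Measure ClosedSets} [SFinite μ]

lemma markedLaw_heavyHit_Icc_le (hμ : HasHittingBound β μ) (δ x ε : ℝ≥0) :
    markedLaw α μ (heavyHit δ (Set.Icc x (x + ε))) ≤ heavyHitBound α β δ ε := by
  rw [markedLaw, heavyHit, Measure.prod_prod]
  exact mul_le_mul_right (hμ x ε) _

lemma markedLaw_heavyHit_ne_top (hμ : HasHittingBound β μ) (hα : 0 < α) (hβ1 : β < 1) {δ : ℝ≥0}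
    (hδ : 0 < δ) {K : Set ℝ≥0} (hK : IsCompact K) : markedLaw α μ (heavyHit δ K) ≠ ∞ := by
  obtain ⟨T, hT⟩ := hK.bddAbove
  have hKT : K ⊆ Set.Icc 0 (0 + T) := fun t ht => ⟨zero_le, (hT ht).trans_eq (zero_add T).symm⟩
  exact ne_top_of_le_ne_top (heavyHitBound_ne_top hα hβ1 hδ T)
    ((measure_mono (heavyHit_mono δ hKT)).trans (markedLaw_heavyHit_Icc_le hμ δ 0 T))

variable {Ω : Type*} [MeasurableSpace Ω] {P : Measure Ω} {X : ℕ → Ω → ℝ≥0 × ClosedSets}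

lemma measure_le_pointCount_heavyHit_Icc_le (hX : IsPoissonEnumeration X (markedLaw α μ) P)
    (hμ : HasHittingBound β μ) (hα : 0 < α) (hβ1 : β < 1) {δ : ℝ≥0} (hδ : 0 < δ) (x ε : ℝ≥0)
    (k : ℕ) :
    P {ω | (k : ℕ∞) ≤ pointCount X (heavyHit δ (Set.Icc x (x + ε))) ω}
      ≤ heavyHitBound α β δ ε ^ k :=
  (hX.measure_le_pointCount_le (measurableSet_heavyHit isCompact_Icc δ)
    (markedLaw_heavyHit_ne_top hμ hα hβ1 hδ isCompact_Icc) k).trans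
    (pow_le_pow_left' (markedLaw_heavyHit_Icc_le hμ δ x ε) k)

-- There are of order `n` cells of length `1 / (n + 1)`, and each of them is hit by `k` heavy sets
-- with probability of order at most `n ^ (-(1 - β) k)`.
lemma measure_exists_le_encard_le (hX : IsPoissonEnumeration X (markedLaw α μ) P)
    (hμ : HasHittingBound β μ) (hα : 0 < α) (hβ1 : β < 1) {δ : ℝ≥0} (hδ : 0 < δ) (k T n : ℕ) :
    P {ω | ∃ t ≤ (T : ℝ≥0),
        (k : ℕ∞) ≤ Set.encard {j | δ < (X j ω).1 ∧ t ∈ (X j ω).2.carrier}}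
      ≤ ((T + 1) * heavyHitBound α β δ 1 ^ k) *
        ((1 / ((n : ℝ≥0) + 1)) ^ ((1 - β) * k - 1) : ℝ≥0) := by
  set c := heavyHitBound α β δ 1
  set x : ℝ≥0 := 1 / ((n : ℝ≥0) + 1) with hx
  have hxpos : 0 < x := by positivity
  have hsub : {ω | ∃ t ≤ (T : ℝ≥0),
        (k : ℕ∞) ≤ Set.encard {j | δ < (X j ω).1 ∧ t ∈ (X j ω).2.carrier}}
      ⊆ ⋃ i ∈ Finset.range (T * (n + 1) + 1),
        {ω | (k : ℕ∞) ≤ pointCount X (heavyHit δ (cell n i)) ω} := by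
    rintro ω ⟨t, htT, hk⟩
    obtain ⟨i, hi, hle⟩ := exists_cell_encard_le_pointCount htT n
    exact Set.mem_biUnion hi (hk.trans hle)
  have cell_le (i : ℕ) : P {ω | (k : ℕ∞) ≤ pointCount X (heavyHit δ (cell n i)) ω}
      ≤ (c * (x ^ (1 - β) : ℝ≥0)) ^ k := by
    rw [← heavyHitBound_eq_mul_rpow hxpos]
    exact measure_le_pointCount_heavyHit_Icc_le hX hμ hα hβ1 hδ _ x k
  have card_le : ((T * (n + 1) + 1 : ℕ) : ℝ≥0∞) ≤ (T + 1) * (n + 1) := by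
    exact_mod_cast (by nlinarith : T * (n + 1) + 1 ≤ (T + 1) * (n + 1))
  have mul_rpow : ((n : ℝ≥0) + 1) * (x ^ (1 - β)) ^ k = x ^ ((1 - β) * k - 1) := by
    rw [NNReal.rpow_sub_one hxpos.ne', NNReal.rpow_mul, NNReal.rpow_natCast, hx]
    field_simp
  calc _ ≤ ∑ i ∈ Finset.range (T * (n + 1) + 1),
          P {ω | (k : ℕ∞) ≤ pointCount X (heavyHit δ (cell n i)) ω} :=
        (measure_mono hsub).trans (measure_biUnion_finset_le _ _)
    _ ≤ (T * (n + 1) + 1 : ℕ) * (c * (x ^ (1 - β) : ℝ≥0)) ^ k := by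
        simpa using Finset.sum_le_card_nsmul (Finset.range (T * (n + 1) + 1)) _ _
          fun i _ => cell_le i
    _ ≤ ((T + 1) * (n + 1)) * (c * (x ^ (1 - β) : ℝ≥0)) ^ k := by gcongr
    _ = ((T + 1) * c ^ k) * (((n : ℝ≥0) + 1) * (x ^ (1 - β)) ^ k : ℝ≥0) := by
        push_cast
        ring
    _ = _ := by rw [mul_rpow]

lemma tendsto_const_mul_one_div_rpow {C : ℝ≥0∞} (hC : C ≠ ∞) {y : ℝ} (hy : 0 < y) :
    Filter.Tendsto (fun n : ℕ => C * ((1 / ((n : ℝ≥0) + 1)) ^ y : ℝ≥0)) Filter.atTop (nhds 0) := by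
  have hpow := ((NNReal.continuous_rpow_const hy.le).tendsto 0).comp
    (tendsto_one_div_add_atTop_nhds_zero_nat (𝕜 := ℝ≥0))
  rw [NNReal.zero_rpow hy.ne'] at hpow
  simpa using ENNReal.Tendsto.const_mul (ENNReal.tendsto_coe.2 hpow) (Or.inr hC)

lemma ae_forall_encard_lt (hX : IsPoissonEnumeration X (markedLaw α μ) P)
    (hμ : HasHittingBound β μ) (hα : 0 < α) (hβ1 : β < 1) {k : ℕ} (hk : 1 < (1 - β) * k)
    {δ : ℝ≥0} (hδ : 0 < δ) (T : ℕ) :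
    ∀ᵐ ω ∂P, ∀ t ≤ (T : ℝ≥0),
      Set.encard {j | δ < (X j ω).1 ∧ t ∈ (X j ω).2.carrier} < (k : ℕ∞) := by
  rw [ae_iff]
  simp only [not_forall, not_lt, exists_prop]
  have hC : (T + 1) * heavyHitBound α β δ 1 ^ k ≠ ∞ :=
    ENNReal.mul_ne_top (by finiteness) (ENNReal.pow_ne_top (heavyHitBound_one_ne_top hα hβ1 hδ))
  exact le_antisymm (ge_of_tendsto' (tendsto_const_mul_one_div_rpow hC (sub_pos.2 hk)) fun n =>
    measure_exists_le_encard_le hX hμ hα hβ1 hδ k T n) zero_le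

lemma ae_forall_card_lt (hX : IsPoissonEnumeration X (markedLaw α μ) P)
    (hμ : HasHittingBound β μ) (hα : 0 < α) (hβ1 : β < 1) {k : ℕ} (hk : 1 < (1 - β) * k) :
    ∀ᵐ ω ∂P, ∀ t, ∀ J : Finset ℕ, (∀ j ∈ J, t ∈ (X j ω).2.carrier ∧ 0 < (X j ω).1) →
      J.card < k := by
  filter_upwards [ae_all_iff.2 fun p : ℕ × ℕ => ae_forall_encard_lt hX hμ hα hβ1 hk
    (δ := 1 / ((p.1 : ℝ≥0) + 1)) (by positivity) p.2] with ω hω t J hJ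
  obtain ⟨T, hT⟩ := exists_nat_ge t
  obtain ⟨n, hn⟩ := exists_one_div_add_one_lt J fun j hj => (hJ j hj).2
  have hcard : (J.card : ℕ∞) < k := by
    rw [← Set.encard_coe_eq_coe_finsetCard]
    refine lt_of_le_of_lt (Set.encard_le_encard fun j hj => ?_) (hω (n, T) t hT)
    exact ⟨hn j hj, (hJ j hj).1⟩
  exact_mod_cast hcard

lemma ae_eventually_weight_le (hX : IsPoissonEnumeration X (markedLaw α μ) P)
    (hμ : HasHittingBound β μ) (hα : 0 < α) (hβ1 : β < 1) {δ : ℝ≥0} (hδ : 0 < δ) (b : ℝ≥0) :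
    ∀ᵐ ω ∂P, ∀ᶠ t in nhds b, ∀ j, t ∈ (X j ω).2.carrier → (X j ω).1 ≤ δ := by
  refine le_antisymm (ge_of_tendsto (tendsto_heavyHitBound hα hβ1 hδ) ?_) zero_le
  filter_upwards [self_mem_nhdsWithin] with ε hε
  rw [← pow_one (heavyHitBound α β δ ε)]
  refine le_trans (measure_mono fun ω hω => ?_)
    (measure_le_pointCount_heavyHit_Icc_le hX hμ hα hβ1 hδ (b - ε / 2) ε 1)
  rw [Set.mem_ofPred_eq, Nat.cast_one, Order.one_le_iff_ne_zero]
  exact fun h => hω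
    (eventually_weight_le_of_pointCount_eq_zero (Icc_sub_half_mem_nhds b hε) h)

end MarkedLaw

/-! ### The sup-derivative at a given point -/

namespace SupMeasure

lemma le_supDeriv_supIntegral (f : ℝ≥0 → ℝ≥0∞) (t : ℝ≥0) : f t ≤ (supIntegral f).supDeriv t :=
  le_iInf₂ fun G ht => le_iSup₂ (f := fun t (_ : t ∈ G) => f t) t ht

lemma supDeriv_supIntegral_le_of_mem_nhds (f : ℝ≥0 → ℝ≥0∞) {t : ℝ≥0} {A : Set ℝ≥0}
    (hA : A ∈ nhds t) : (supIntegral f).supDeriv t ≤ ⨆ s ∈ A, f s := by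
  obtain ⟨G, hGA, hG, htG⟩ := mem_nhds_iff.1 hA
  exact (supDeriv_le _ (G := ⟨G, hG⟩) htG).trans (biSup_mono hGA)

end SupMeasure

lemma supDeriv_coverSup_le {z : ℕ → ℝ≥0 × ClosedSets} {b δ : ℝ≥0} {k : ℕ}
    (hcard : ∀ t, ∀ J : Finset ℕ, (∀ j ∈ J, t ∈ (z j).2.carrier ∧ 0 < (z j).1) → J.card < k)
    (hweight : ∀ᶠ t in nhds b, ∀ j, t ∈ (z j).2.carrier → (z j).1 ≤ δ) :
    (coverSup z).supDeriv b ≤ k * δ := by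
  refine (SupMeasure.supDeriv_supIntegral_le_of_mem_nhds _ hweight).trans
    (iSup₂_le fun t ht => le_of_forall_lt fun a ha => ?_)
  obtain ⟨J, hJ, hJa⟩ := lt_coverFun_iff.1 ha
  calc a < ∑ j ∈ J, ((z j).1 : ℝ≥0∞) := hJa
    _ ≤ J.card • (δ : ℝ≥0∞) :=
        Finset.sum_le_card_nsmul J _ _ fun j hj => ENNReal.coe_le_coe.2 (ht j (hJ j hj).1)
    _ ≤ k * δ := by
        rw [nsmul_eq_mul]
        gcongr
        exact (hcard t J hJ).le

lemma ae_supDeriv_coverSup_eq_zero {α β : ℝ} {μ : Measure ClosedSets} [SFinite μ] {Ω : Type*}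
    [MeasurableSpace Ω] {P : Measure Ω} {X : ℕ → Ω → ℝ≥0 × ClosedSets}
    (hX : IsPoissonEnumeration X (markedLaw α μ) P) (hμ : HasHittingBound β μ) (hα : 0 < α)
    (hβ1 : β < 1) (b : ℝ≥0) : ∀ᵐ ω ∂P, (coverSup fun j => X j ω).supDeriv b = 0 := by
  obtain ⟨k, hk⟩ : ∃ k : ℕ, 1 < (1 - β) * k := by
    simpa only [nsmul_eq_mul, mul_comm] using exists_lt_nsmul (sub_pos.2 hβ1) 1
  filter_upwards [ae_forall_card_lt hX hμ hα hβ1 hk, ae_all_iff.2 fun n : ℕ =>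
    ae_eventually_weight_le hX hμ hα hβ1 (δ := 1 / ((n : ℝ≥0) + 1)) (by positivity) b]
    with ω hcard hweight
  have hlim := tendsto_const_mul_one_div_rpow (ENNReal.natCast_ne_top k) zero_lt_one
  simp only [NNReal.rpow_one] at hlim
  exact le_antisymm (ge_of_tendsto' hlim fun n => supDeriv_coverSup_le hcard (hweight n)) zero_le

/-! ### Stationarity and self-similarity -/

lemma coverSup_shift {z : ℕ → ℝ≥0 × ClosedSets} {b : ℝ≥0} (hb : (coverSup z).supDeriv b = 0) :
    (coverSup z).shift b = coverSup fun j => ((z j).1, (z j).2.restart b) := by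
  apply SupMeasure.onOpen_injective
  funext G
  change ⨆ s ∈ (fun t => t + b) '' (G : Set ℝ≥0), (coverSup z).supDeriv s
    = ⨆ t ∈ G, coverFun z (t + b)
  rw [iSup_image]
  refine le_antisymm (iSup₂_le fun t ht => ?_)
    (iSup₂_mono fun t _ => SupMeasure.le_supDeriv_supIntegral _ _)
  rcases eq_or_ne t 0 with rfl | hne
  · rw [zero_add, hb]
    exact zero_le
  -- Away from `0`, translation by `b` is an open map.
  have hmem : (fun t => t + b) '' (G : Set ℝ≥0) ∈ nhds (t + b) := by
    have hpre : ∀ᶠ s in nhds (t + b), s - b ∈ G :=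
      (continuous_sub_right b).continuousAt.eventually_mem
        (by simpa only [add_tsub_cancel_right] using G.isOpen.mem_nhds ht)
    filter_upwards [hpre, lt_mem_nhds (lt_add_of_pos_left b (pos_of_ne_zero hne))] with s hsG hbs
    exact ⟨s - b, hsG, tsub_add_cancel_of_le hbs.le⟩
  exact (SupMeasure.supDeriv_supIntegral_le_of_mem_nhds _ hmem).trans_eq iSup_image

lemma coverSup_dilate (z : ℕ → ℝ≥0 × ClosedSets) {a : ℝ≥0} (ha : 0 < a) :
    (coverSup z).dilate a = coverSup fun j => ((z j).1, (z j).2.contract a) := by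
  apply SupMeasure.onOpen_injective
  funext G
  change ⨆ s ∈ (fun t => a * t) '' (G : Set ℝ≥0), (coverSup z).supDeriv s
    = ⨆ t ∈ G, coverFun z (a * t)
  rw [iSup_image]
  refine le_antisymm (iSup₂_le fun t ht => ?_)
    (iSup₂_mono fun t _ => SupMeasure.le_supDeriv_supIntegral _ _)
  have hmem : (fun t => a * t) '' (G : Set ℝ≥0) ∈ nhds (a * t) :=
    (Homeomorph.mulLeft₀ a ha.ne').isOpenMap.image_mem_nhds (G.isOpen.mem_nhds ht)
  exact (SupMeasure.supDeriv_supIntegral_le_of_mem_nhds _ hmem).trans_eq iSup_image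

lemma coverSup_scale (z : ℕ → ℝ≥0 × ClosedSets) (c : ℝ≥0) :
    (coverSup z).scale c = coverSup fun j => (c * (z j).1, (z j).2) := by
  apply SupMeasure.onOpen_injective
  funext G
  change (c : ℝ≥0∞) * ⨆ t ∈ G, coverFun z t = ⨆ t ∈ G, coverFun _ t
  simp only [ENNReal.mul_iSup, coverFun, ← ENNReal.tsum_mul_left, ENNReal.coe_mul,
    Set.indicator_const_mul]

section MapMarkedLaw

variable (α : ℝ) (μ : Measure ClosedSets) [SFinite μ]

lemma map_prodMap_id_markedLaw {f : ClosedSets → ClosedSets} (hf : Measurable f) :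
    (markedLaw α μ).map (Prod.map id f) = markedLaw α (μ.map f) := by
  rw [markedLaw, markedLaw, ← Measure.map_prod_map _ _ measurable_id hf, Measure.map_id]

lemma map_prodMap_mul_markedLaw {c : ℝ≥0} (hc : 0 < c) :
    (markedLaw α μ).map (Prod.map (fun u => c * u) id) = (c ^ α : ℝ≥0) • markedLaw α μ := by
  rw [markedLaw, ← Measure.map_prod_map _ _ (measurable_const_mul c) measurable_id,
    Measure.map_id, map_mul_powerMeasure _ _ hc, Measure.prod_smul_left,
    show -(-(1 + α) + 1) = α by ring]

lemma markedLaw_smul (c : ℝ≥0) : markedLaw α (c • μ) = c • markedLaw α μ :=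
  Measure.prod_smul_right c

lemma map_translate_meanMeasure (β : ℝ) (Q : Measure ClosedSets) [SFinite Q] :
    (meanMeasure α β Q).map (Prod.map id fun p => p.2.translate p.1)
      = markedLaw α (shiftedLaw β Q) := by
  rw [markedLaw, shiftedLaw, ← Measure.map_id (μ := powerMeasure α (-(1 + α))),
    Measure.map_prod_map _ _ measurable_id ClosedSets.measurable_translate]
  rfl

end MapMarkedLaw

section Laws

variable {α β : ℝ} {μ : Measure ClosedSets} [SFinite μ] {Ω : Type*} [MeasurableSpace Ω]
  {P : Measure Ω} [IsFiniteMeasure P] {X : ℕ → Ω → ℝ≥0 × ClosedSets}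

lemma isStationarySupMeasure_coverSup (hX : IsPoissonEnumeration X (markedLaw α μ) P)
    (hμ : HasHittingBound β μ) (hα : 0 < α) (hβ1 : β < 1)
    (hrestart : ∀ b, μ.map (ClosedSets.restart b) = μ) :
    IsStationarySupMeasure (fun ω => coverSup fun j => X j ω) P := by
  intro b
  have hX' : IsPoissonEnumeration (fun j ω => ((X j ω).1, (X j ω).2.restart b))
      (markedLaw α μ) P := by
    have hmap := hX.map (measurable_id.prodMap (ClosedSets.measurable_restart b))
    rwa [map_prodMap_id_markedLaw α μ (ClosedSets.measurable_restart b), hrestart b] at hmap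
  have shift_ae : (fun ω => coverSup fun j => ((X j ω).1, (X j ω).2.restart b))
      =ᵐ[P] fun ω => (coverSup fun j => X j ω).shift b := by
    filter_upwards [ae_supDeriv_coverSup_eq_zero hX hμ hα hβ1 b] with ω hω
    exact (coverSup_shift hω).symm
  refine ⟨(measurable_coverSup hX'.measurable).aemeasurable.congr shift_ae,
    (measurable_coverSup hX.measurable).aemeasurable, ?_⟩
  rw [← Measure.map_congr shift_ae]
  exact hX'.map_coverSup_eq hX fun δ hδ K hK => markedLaw_heavyHit_ne_top hμ hα hβ1 hδ hK

lemma isSelfSimilarSupMeasure_coverSup (hX : IsPoissonEnumeration X (markedLaw α μ) P)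
    (hμ : HasHittingBound β μ) (hα : 0 < α) (hβ1 : β < 1)
    (hcontract : ∀ a : ℝ≥0, 0 < a → μ.map (ClosedSets.contract a) = (a ^ (1 - β) : ℝ≥0) • μ) :
    IsSelfSimilarSupMeasure ((1 - β) / α) (fun ω => coverSup fun j => X j ω) P := by
  intro a ha
  have hX_contract : IsPoissonEnumeration (fun j ω => ((X j ω).1, (X j ω).2.contract a))
      ((a ^ (1 - β) : ℝ≥0) • markedLaw α μ) P := by
    have hmap := hX.map (measurable_id.prodMap (ClosedSets.measurable_contract a))
    rwa [map_prodMap_id_markedLaw α μ (ClosedSets.measurable_contract a), hcontract a ha,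
      markedLaw_smul] at hmap
  have hX_mul : IsPoissonEnumeration (fun j ω => (a ^ ((1 - β) / α) * (X j ω).1, (X j ω).2))
      ((a ^ (1 - β) : ℝ≥0) • markedLaw α μ) P := by
    have hmap := hX.map ((measurable_const_mul (a ^ ((1 - β) / α))).prodMap measurable_id)
    rwa [map_prodMap_mul_markedLaw α μ (NNReal.rpow_pos ha), ← NNReal.rpow_mul,
      div_mul_cancel₀ _ hα.ne'] at hmap
  simp only [coverSup_dilate _ ha, coverSup_scale]
  refine ⟨(measurable_coverSup hX_contract.measurable).aemeasurable,
    (measurable_coverSup hX_mul.measurable).aemeasurable,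
    hX_contract.map_coverSup_eq hX_mul fun δ hδ K hK => ?_⟩
  rw [Measure.smul_apply, ENNReal.smul_def, smul_eq_mul]
  exact ENNReal.mul_ne_top ENNReal.coe_ne_top (markedLaw_heavyHit_ne_top hμ hα hβ1 hδ hK)

end Laws

lemma eta_eq_coverSup {Ω : Type*} (U V : ℕ → Ω → ℝ≥0) (R : ℕ → Ω → ClosedSets) :
    eta U V R = fun ω => coverSup fun j => (U j ω, (R j ω).translate (V j ω)) := rfl

end

theorem mainTheorem2 {Ω Ω' : Type*} [MeasurableSpace Ω] [MeasurableSpace Ω']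
    (P : Measure Ω) [IsProbabilityMeasure P] (P' : Measure Ω') [IsProbabilityMeasure P']
    (α β : ℝ) (hα : 0 < α) (hβ : 0 < β) (hβ1 : β < 1)
    (S : ℝ≥0 → Ω' → ℝ≥0) (hS : IsStableSubordinator β S P')
    (U V : ℕ → Ω → ℝ≥0) (R : ℕ → Ω → ClosedSets)
    (hN : IsPoissonEnumeration (fun j ω => (U j ω, V j ω, R j ω))
      (meanMeasure α β (P'.map (closedRange S))) P) :
    IsRandomSupMeasure (eta U V R) ∧
      IsStationarySupMeasure (eta U V R) P ∧
      IsSelfSimilarSupMeasure ((1 - β) / α) (eta U V R) P := by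
  obtain ⟨c, hc, S', hS', hae⟩ := hS.exists_isRegularSubordinator
  have hQ : P'.map (closedRange S) = P'.map (closedRange S') := by
    refine Measure.map_congr ?_
    filter_upwards [hae] with ω hω
    simp only [closedRange, hω]
  rw [hQ] at hN
  have := hS'.isProbabilityMeasure_map_closedRange
  have hX := hN.map (measurable_id.prodMap ClosedSets.measurable_translate)
  rw [map_translate_meanMeasure] at hX
  have hμ : HasHittingBound β (shiftedLaw β (P'.map (closedRange S'))) :=
    hS'.shiftedLaw_hitting_Icc_le hc hβ1
  rw [eta_eq_coverSup]
  exact ⟨measurable_coverSup hX.measurable,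
    isStationarySupMeasure_coverSup hX hμ hα hβ1 (hS'.map_restart_shiftedLaw hc hβ1),
    isSelfSimilarSupMeasure_coverSup hX hμ hα hβ1 fun a ha => hS'.map_contract_shiftedLaw ha⟩
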